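/- Let $d\in\{2,3\}$ and let $\Omega\subset\mathbb R^d$ be a bounded polygonal (polyhedral) domain: open, connected, $\operatorname{int}\overline\Omega=\Omega$, and $\overline\Omega$ a finite union of nondegenerate closed simplices. Write $(\cdot,\cdot)$ and $\langle\cdot,\cdot\rangle$ for the inner products of $L^2(\Omega)$ and $L^2(\partial\Omega)$ (and of their vector- and tensor-valued versions), $\varepsilon(v)=\frac12(\nabla v+\nabla^T v)$, $\mathbf{RM}$ for the infinitesimal rigid motions, and $H^1_\perp(\Omega)^d$ for the $v\in H^1(\Omega)^d$ with $(v,r)=0$ for all $r\in\mathbf{RM}$. Data: constants $\gamma>0$, $\beta\ge 0$, $a_0>0$, $b_0>0$, $\theta_f>0$, $\lambda^*\ge 0$; a measurable symmetric $K=K(x)$ with $K_1|\zeta|^2\le K(x)\zeta\cdot\zeta\le K_2|\zeta|^2$ for a.e. $x$ and all $\zeta\in\mathbb R^d$, where $K_1,K_2>0$; $\rho_f\in L^\infty(\Omega)$ (for instance a constant), $g\in\mathbb R^d$; time-independent $F\in L^2(\Omega)^d$, $F_1\in L^2(\partial\Omega)^d$, $\phi\in L^2(\Omega)$, $\phi_1\in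 L^2(\partial\Omega)$ with $(F,v)+\langle F_1,v\rangle=0$ for all $v\in\mathbf{RM}$; $\tau_0\in H^1(\Omega)^d$, $p_0\in L^2(\Omega)$; $T>0$. Put $$\chi_1=\frac{b_0}{b_0^2+\beta a_0},\quad \chi_2=\frac{\beta}{b_0^2+\beta a_0},\quad \chi_3=\frac{a_0}{b_0^2+\beta a_0},\quad \varpi_0=a_0p_0+b_0\operatorname{div}\tau_0 .$$ A weak solution is a tuple $(\tau,\delta,\varpi,p,q)$ with $\tau\in L^\infty(0,T;H^1_\perp(\Omega)^d)$, $\delta,q\in L^\infty(0,T;L^2(\Omega))$, $\varpi\in L^\infty(0,T;L^2(\Omega))\cap H^1(0,T;H^1(\Omega)')$, $p\in L^\infty(0,T;L^2(\Omega))\cap L^2(0,T;H^1(\Omega))$, and, if $\lambda^*>0$, with a weak time derivative $(\operatorname{div}\tau)_t\in L^1(0,T;L^2(\Omega))$, such that for a.e. $t\in(0,T)$ $$\gamma(\varepsilon(\tau),\varepsilon(v))-(\delta,\operatorname{div}v)=(F,v)+\langle F_1,v\rangle\quad\forall v\in H^1(\Omega)^d,$$ $$\chi_3(\delta,\eta)+(\operatorname{div}\tau,\eta)+\lambda^*\chi_3((\operatorname{div}\tau)_t,\eta)=\chi_1(\varpi,\eta)\quad\forall\eta\in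 L^2(\Omega),$$ $$(\varpi_t,\psi)_{\rm dual}+\tfrac1{\theta_f}(K(\nabla p-\rho_fg),\nabla\psi)=(\phi,\psi)+\langle\phi_1,\psi\rangle\quad\forall\psi\in H^1(\Omega),$$ $$p=\chi_1\delta+\chi_2\varpi+\lambda^*\chi_1(\operatorname{div}\tau)_t,\qquad q=\chi_1\varpi-\chi_3\delta-\lambda^*\chi_3(\operatorname{div}\tau)_t,$$ and $\varpi(0)=\varpi_0$. (For $\lambda^*=0$ the terms with $\lambda^*$ are absent, here and below.) There is a constant $C>0$ depending only on $\Omega$ such that every weak solution has the following properties. 1. (Energy law.) If $\lambda^*>0$, then $(\operatorname{div}\tau)_t\in L^2(0,T;L^2(\Omega))$. After modification on a null set of times, $\tau$ is weakly continuous on $[0,T]$ with values in $H^1(\Omega)^d$, and $\delta$, $\varpi$ and (if $\lambda^*>0$) $(\operatorname{div}\tau)_t$ are weakly continuous on $[0,T]$ with values in $L^2(\Omega)$, with $\varpi(0)=\varpi_0$. All time integrals below converge, and for these representatives and every $s\in[0,T]$ $$J(s)+\lambda^*\int_0^s\|(\operatorname{div}\tau)_t\|_{L^2(\Omega)}^2dt+\frac1{\theta_f}\int_0^s(K(\nabla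 p-\rho_fg),\nabla p)\,dt-\int_0^s(\phi,p)\,dt-\int_0^s\langle\phi_1,p\rangle\,dt=J(0),$$ where $$J(s)=\tfrac12\Big[\gamma\|\varepsilon(\tau(s))\|^2+\chi_2\|\varpi(s)\|^2+\chi_3\|\delta(s)\|^2+(\lambda^*)^2\chi_3\|(\operatorname{div}\tau)_t(s)\|^2+2\lambda^*\chi_3((\operatorname{div}\tau)_t(s),\delta(s))-2(F,\tau(s))-2\langle F_1,\tau(s)\rangle\Big]$$ with $L^2(\Omega)$ norms. 2. (Bound.) $$\|\varpi_t\|_{L^2(0,T;H^1(\Omega)')}\le\frac1{\theta_f}\|K(\nabla p-\rho_fg)\|_{L^2(0,T;L^2(\Omega))}+\sqrt T\big(\|\phi\|_{L^2(\Omega)}+C\|\phi_1\|_{L^2(\partial\Omega)}\big)<\infty .$$ -/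

import Mathlib

open MeasureTheory Set Filter Topology
open scoped ENNReal ContDiff Matrix

noncomputable section

namespace Biot

/-- The Euclidean space `ℝ^d`. -/
abbrev E (d : ℕ) : Type := EuclideanSpace ℝ (Fin d)

/-- A bounded polygonal (`d = 2`) or polyhedral (`d = 3`) domain: a connected open set whose closure
is a finite union of closed nondegenerate simplices, and which lies on one side of its boundary
(no slits, expressed by `interior (closure Ω) = Ω`). -/
structure IsPolyhedralDomain {d : ℕ} (Ω : Set (E d)) : Prop where
  isOpen : IsOpen Ω
  isConnected : IsConnected Ω
  interior_closure : interior (closure Ω) = Ω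
  simplices : ∃ S : Set (Affine.Simplex ℝ (E d) d), S.Finite ∧
    closure Ω = ⋃ s ∈ S, convexHull ℝ (Set.range s.points)

/-! ### Lebesgue and Sobolev spaces -/

/-- `L²(Ω)`. -/
abbrev L2 {d : ℕ} (Ω : Set (E d)) : Type := Lp ℝ 2 (volume.restrict Ω)

/-- `L²(Ω)^d`. -/
abbrev L2vec {d : ℕ} (Ω : Set (E d)) : Type := PiLp 2 (fun _ : Fin d => L2 Ω)

/-- Surface measure on `∂Ω`: the `(d-1)`-dimensional Hausdorff measure, normalised so that it is
the usual `(d-1)`-dimensional area. -/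
def surface {d : ℕ} (Ω : Set (E d)) : Measure (E d) :=
  (Measure.euclideanHausdorffMeasure (d - 1)).restrict (frontier Ω)

/-- `L²(∂Ω)`. -/
abbrev L2bd {d : ℕ} (Ω : Set (E d)) : Type := Lp ℝ 2 (surface Ω)

/-- `L²(∂Ω)^d`. -/
abbrev L2bdvec {d : ℕ} (Ω : Set (E d)) : Type := PiLp 2 (fun _ : Fin d => L2bd Ω)

/-- Classical partial derivative. -/
def pderiv {d : ℕ} (φ : E d → ℝ) (i : Fin d) (x : E d) : ℝ :=
  fderiv ℝ φ x (EuclideanSpace.single i 1)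

/-- Test functions `C_c^∞(U)`. -/
structure IsTest {V : Type*} [NormedAddCommGroup V] [NormedSpace ℝ V]
    (U : Set V) (φ : V → ℝ) : Prop where
  smooth : ContDiff ℝ ∞ φ
  compact : HasCompactSupport φ
  supp : tsupport φ ⊆ U

/-- `g` is the weak partial derivative `∂ᵢ u` in `Ω`. -/
def IsWeakPartial {d : ℕ} (Ω : Set (E d)) (i : Fin d) (u g : L2 Ω) : Prop :=
  ∀ φ : E d → ℝ, IsTest Ω φ →
    ∫ x in Ω, u x * pderiv φ i x = - ∫ x in Ω, g x * φ x

theorem integrable_mul_of_continuous {d : ℕ} {Ω : Set (E d)} (u : L2 Ω) {f : E d → ℝ}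
    (hf : Continuous f) (hc : HasCompactSupport f) :
    Integrable (fun x => u x * f x) (volume.restrict Ω) :=
  MemLp.integrable_mul (p := 2) (q := 2) (Lp.memLp u) (hf.memLp_of_hasCompactSupport hc)

theorem IsTest.integrable_mul {d : ℕ} {Ω : Set (E d)} {φ : E d → ℝ} (h : IsTest Ω φ) (u : L2 Ω) :
    Integrable (fun x => u x * φ x) (volume.restrict Ω) :=
  integrable_mul_of_continuous u h.smooth.continuous h.compact

theorem IsTest.integrable_mul_pderiv {d : ℕ} {Ω : Set (E d)} {φ : E d → ℝ} (h : IsTest Ω φ)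
    (i : Fin d) (u : L2 Ω) :
    Integrable (fun x => u x * pderiv φ i x) (volume.restrict Ω) :=
  integrable_mul_of_continuous u
    ((h.smooth.continuous_fderiv (by simp)).clm_apply continuous_const)
    (h.compact.fderiv_apply ℝ _)

theorem IsWeakPartial.add {d : ℕ} {Ω : Set (E d)} {i : Fin d} {u g u' g' : L2 Ω}
    (h : IsWeakPartial Ω i u g) (h' : IsWeakPartial Ω i u' g') :
    IsWeakPartial Ω i (u + u') (g + g') := by
  intro φ hφ
  have e1 : ∫ x in Ω, (u + u') x * pderiv φ i x
      = ∫ x in Ω, (u x * pderiv φ i x + u' x * pderiv φ i x) := by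
    refine integral_congr_ae ?_
    filter_upwards [Lp.coeFn_add u u'] with x hx
    rw [hx, Pi.add_apply]; ring
  have e2 : ∫ x in Ω, (g + g') x * φ x = ∫ x in Ω, (g x * φ x + g' x * φ x) := by
    refine integral_congr_ae ?_
    filter_upwards [Lp.coeFn_add g g'] with x hx
    rw [hx, Pi.add_apply]; ring
  rw [e1, e2, integral_add (hφ.integrable_mul_pderiv i u) (hφ.integrable_mul_pderiv i u'),
    integral_add (hφ.integrable_mul g) (hφ.integrable_mul g'), h φ hφ, h' φ hφ]
  ring

theorem IsWeakPartial.smul {d : ℕ} {Ω : Set (E d)} {i : Fin d} {u g : L2 Ω} (c : ℝ)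
    (h : IsWeakPartial Ω i u g) : IsWeakPartial Ω i (c • u) (c • g) := by
  intro φ hφ
  have e1 : ∫ x in Ω, (c • u) x * pderiv φ i x = ∫ x in Ω, c * (u x * pderiv φ i x) := by
    refine integral_congr_ae ?_
    filter_upwards [Lp.coeFn_smul c u] with x hx
    rw [hx, Pi.smul_apply, smul_eq_mul]; ring
  have e2 : ∫ x in Ω, (c • g) x * φ x = ∫ x in Ω, c * (g x * φ x) := by
    refine integral_congr_ae ?_
    filter_upwards [Lp.coeFn_smul c g] with x hx
    rw [hx, Pi.smul_apply, smul_eq_mul]; ring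
  rw [e1, e2, integral_const_mul, integral_const_mul, h φ hφ]
  ring

theorem IsWeakPartial.zero {d : ℕ} {Ω : Set (E d)} {i : Fin d} :
    IsWeakPartial Ω i (0 : L2 Ω) 0 := by
  have h0 : IsWeakPartial Ω i ((0 : ℝ) • (0 : L2 Ω)) ((0 : ℝ) • (0 : L2 Ω)) := by
    intro φ hφ
    have e : ∀ f : E d → ℝ, ∫ x in Ω, ((0 : ℝ) • (0 : L2 Ω)) x * f x = 0 := by
      intro f
      refine integral_eq_zero_of_ae ?_
      filter_upwards [Lp.coeFn_smul (0 : ℝ) (0 : L2 Ω)] with x hx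
      rw [hx]; simp
    rw [e, e, neg_zero]
  simpa using h0

/-- The Sobolev space `H¹(Ω) = W^{1,2}(Ω)`: pairs of `u ∈ L²(Ω)` and its weak gradient in
`L²(Ω)^d`, with the Hilbert norm `‖u‖² + ‖∇u‖²`. -/
def H1 {d : ℕ} (Ω : Set (E d)) : Submodule ℝ (WithLp 2 (L2 Ω × L2vec Ω)) where
  carrier := {w | ∀ i, IsWeakPartial Ω i w.fst (w.snd i)}
  add_mem' := fun ha hb i => (ha i).add (hb i)
  zero_mem' := fun _ => IsWeakPartial.zero
  smul_mem' := fun c _ ha i => (ha i).smul c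

/-- The element of `L²(Ω)` underlying an element of `H¹(Ω)`. -/
def toL2 {d : ℕ} {Ω : Set (E d)} (u : H1 Ω) : L2 Ω := u.1.fst

/-- The weak partial derivative `∂ᵢ u` of `u ∈ H¹(Ω)`. -/
def wpart {d : ℕ} {Ω : Set (E d)} (i : Fin d) (u : H1 Ω) : L2 Ω := u.1.snd i

/-- `H¹(Ω)^d`. -/
abbrev H1vec {d : ℕ} (Ω : Set (E d)) : Type := PiLp 2 (fun _ : Fin d => H1 Ω)

/-- The divergence of `v ∈ H¹(Ω)^d`. -/
def divg {d : ℕ} {Ω : Set (E d)} (v : H1vec Ω) : L2 Ω := ∑ i, wpart i (v i)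

/-- Entries of the strain tensor `ε(v) = (∇v + ∇ᵀv)/2`. -/
def strain {d : ℕ} {Ω : Set (E d)} (v : H1vec Ω) (i j : Fin d) : L2 Ω :=
  (1 / 2 : ℝ) • (wpart i (v j) + wpart j (v i))

/-- `(ε(v), ε(w))`. -/
def strainInner {d : ℕ} {Ω : Set (E d)} (v w : H1vec Ω) : ℝ :=
  ∑ i, ∑ j, inner ℝ (strain v i j) (strain w i j)

/-- The inclusion `H¹(Ω) → L²(Ω)` as a bounded operator. -/
def toL2L {d : ℕ} (Ω : Set (E d)) : H1 Ω →L[ℝ] L2 Ω :=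
  (WithLp.fstL 2 ℝ (L2 Ω) (L2vec Ω)).comp (H1 Ω).subtypeL

/-- `H¹(Ω)'` with the dual norm. -/
abbrev H1dual {d : ℕ} (Ω : Set (E d)) : Type := H1 Ω →L[ℝ] ℝ

/-- The embedding `L²(Ω) → H¹(Ω)'`, `f ↦ (f, ·)`. -/
def L2toDual {d : ℕ} {Ω : Set (E d)} (f : L2 Ω) : H1dual Ω := (innerSL ℝ f).comp (toL2L Ω)

/-! ### Boundary traces -/

/-- `g ∈ L²(∂Ω)` is the trace of `u ∈ H¹(Ω)`: some smooth functions on `ℝ^d` converge to `u` in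
`H¹(Ω)`, and their restrictions to `∂Ω` converge to `g` in `L²(∂Ω)`. -/
def IsTrace {d : ℕ} {Ω : Set (E d)} (u : H1 Ω) (g : L2bd Ω) : Prop :=
  ∃ φ : ℕ → E d → ℝ, (∀ n, ContDiff ℝ ∞ (φ n)) ∧
    Tendsto (fun n => eLpNorm (fun x => φ n x - toL2 u x) 2 (volume.restrict Ω)) atTop (𝓝 0) ∧
    (∀ i, Tendsto (fun n => eLpNorm (fun x => pderiv (φ n) i x - wpart i u x) 2
      (volume.restrict Ω)) atTop (𝓝 0)) ∧
    Tendsto (fun n => eLpNorm (fun x => φ n x - g x) 2 (surface Ω)) atTop (𝓝 0)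

open Classical in
/-- The trace on `∂Ω` of a function in `H¹(Ω)`. -/
def trace {d : ℕ} {Ω : Set (E d)} (u : H1 Ω) : L2bd Ω :=
  if h : ∃ g, IsTrace u g then h.choose else 0

/-- `⟨f, u⟩`, the `L²(∂Ω)` product of `f` and the trace of `u`. -/
def bdPair {d : ℕ} {Ω : Set (E d)} (f : L2bd Ω) (u : H1 Ω) : ℝ := inner ℝ f (trace u)

/-! ### Rigid motions -/

/-- The `i`-th component at `x` of the infinitesimal rigid motion `x ↦ a + A x`; `A` will be
skew-symmetric, so that `A x` is `b × x` if `d = 3`, and `b (-x₂, x₁)` if `d = 2`. -/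
def rigid {d : ℕ} (a : Fin d → ℝ) (A : Matrix (Fin d) (Fin d) ℝ) (i : Fin d) (x : E d) : ℝ :=
  a i + ∑ j, A i j * x j

/-- `v ∈ H¹_⊥(Ω)`: `v` is `L²`-orthogonal to all infinitesimal rigid motions. -/
def OrthRM {d : ℕ} {Ω : Set (E d)} (v : H1vec Ω) : Prop :=
  ∀ (a : Fin d → ℝ) (A : Matrix (Fin d) (Fin d) ℝ), Aᵀ = -A →
    ∑ i, ∫ x in Ω, toL2 (v i) x * rigid a A i x = 0

/-! ### Functions of time -/

/-- Lebesgue measure on the time interval `(0,T)`. -/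
def timeMeas (T : ℝ) : Measure ℝ := volume.restrict (Ioo 0 T)

/-- `u'` is the weak derivative of `u` on `(0,T)`, for functions with values in `X`. -/
def HasWeakTimeDeriv {X : Type*} [NormedAddCommGroup X] [NormedSpace ℝ X]
    (T : ℝ) (u u' : ℝ → X) : Prop :=
  Integrable u (timeMeas T) ∧ Integrable u' (timeMeas T) ∧
    ∀ θ : ℝ → ℝ, IsTest (Ioo 0 T) θ →
      ∫ t in Ioo 0 T, deriv θ t • u t = - ∫ t in Ioo 0 T, θ t • u' t

/-- The continuous representative of `u` on `[0,T]` takes the value `x₀` at `0`. -/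
def HasInitialValue {X : Type*} [TopologicalSpace X] (T : ℝ) (u : ℝ → X) (x₀ : X) : Prop :=
  ∃ c : ℝ → X, ContinuousOn c (Icc 0 T) ∧ c =ᵐ[timeMeas T] u ∧ c 0 = x₀

/-- Weak continuity on `[0,T]` of a function with values in a Hilbert space. -/
def WeaklyContinuous {X : Type*} [NormedAddCommGroup X] [InnerProductSpace ℝ X]
    (T : ℝ) (u : ℝ → X) : Prop :=
  ∀ w : X, ContinuousOn (fun t => inner ℝ (u t) w) (Icc 0 T)

/-! ### The problem -/

/-- The data of the Biot model with secondary consolidation, with the standing assumptions. -/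
structure Data {d : ℕ} (Ω : Set (E d)) where
  /-- Lamé constants. -/
  γ : ℝ
  β : ℝ
  /-- Constrained specific storage coefficient and Biot-Willis constant. -/
  a₀ : ℝ
  b₀ : ℝ
  /-- Solvent viscosity. -/
  θf : ℝ
  /-- Secondary consolidation coefficient `λ*`. -/
  lam : ℝ
  /-- Permeability tensor and its bounds. -/
  K : E d → Matrix (Fin d) (Fin d) ℝ
  K₁ : ℝ
  K₂ : ℝ
  /-- Fluid density and gravitational acceleration. -/
  ρf : E d → ℝ
  grav : E d
  /-- Body force, boundary traction, fluid source and boundary flux. -/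
  F : L2vec Ω
  F₁ : L2bdvec Ω
  φ : L2 Ω
  φ₁ : L2bd Ω
  /-- Initial displacement and pressure. -/
  τ₀ : H1vec Ω
  p₀ : L2 Ω
  γ_pos : 0 < γ
  β_nonneg : 0 ≤ β
  a₀_pos : 0 < a₀
  b₀_pos : 0 < b₀
  θf_pos : 0 < θf
  lam_nonneg : 0 ≤ lam
  K₁_pos : 0 < K₁
  K₂_pos : 0 < K₂
  K_meas : ∀ i j, AEMeasurable (fun x => K x i j) (volume.restrict Ω)
  K_symm : ∀ᵐ x ∂(volume.restrict Ω), (K x)ᵀ = K x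
  K_bounds : ∀ᵐ x ∂(volume.restrict Ω), ∀ ζ : Fin d → ℝ,
    K₁ * (ζ ⬝ᵥ ζ) ≤ (K x *ᵥ ζ) ⬝ᵥ ζ ∧ (K x *ᵥ ζ) ⬝ᵥ ζ ≤ K₂ * (ζ ⬝ᵥ ζ)
  ρf_mem : MemLp ρf ∞ (volume.restrict Ω)
  /-- `(F, v) + ⟨F₁, v⟩ = 0` for all rigid motions `v`. -/
  compat : ∀ (a : Fin d → ℝ) (A : Matrix (Fin d) (Fin d) ℝ), Aᵀ = -A →
    (∑ i, ∫ x in Ω, F i x * rigid a A i x) + ∑ i, ∫ x, F₁ i x * rigid a A i x ∂(surface Ω) = 0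

namespace Data

variable {d : ℕ} {Ω : Set (E d)} (D : Data Ω)

def χ₁ : ℝ := D.b₀ / (D.b₀ ^ 2 + D.β * D.a₀)

def χ₂ : ℝ := D.β / (D.b₀ ^ 2 + D.β * D.a₀)

def χ₃ : ℝ := D.a₀ / (D.b₀ ^ 2 + D.β * D.a₀)

/-- `ϖ₀ = a₀ p₀ + b₀ div τ₀`. -/
def ϖ₀ : L2 Ω := D.a₀ • D.p₀ + D.b₀ • divg D.τ₀

/-- The load `(F, v) + ⟨F₁, v⟩`. -/
def load (v : H1vec Ω) : ℝ :=
  (∑ i, inner ℝ (D.F i) (toL2 (v i))) + ∑ i, bdPair (D.F₁ i) (v i)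

/-- The fluid source `(φ, ψ) + ⟨φ₁, ψ⟩`. -/
def source (ψ : H1 Ω) : ℝ := inner ℝ D.φ (toL2 ψ) + bdPair D.φ₁ ψ

/-- The vector field `K (∇p - ρ_f g)`. -/
def flux (p : H1 Ω) (x : E d) : E d :=
  WithLp.toLp 2 (D.K x *ᵥ fun i => wpart i p x - D.ρf x * D.grav i)

/-- `(K (∇p - ρ_f g), ∇ψ)`. -/
def darcy (p ψ : H1 Ω) : ℝ := ∫ x in Ω, ∑ i, D.flux p x i * wpart i ψ x

/-- The norm of `K (∇p - ρ_f g)` in `L²(0,T;L²(Ω))`. -/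
def fluxNorm (T : ℝ) (p : ℝ → H1 Ω) : ℝ≥0∞ :=
  (∫⁻ t in Ioo 0 T, ∫⁻ x in Ω, ‖D.flux (p t) x‖ₑ ^ 2) ^ (1 / 2 : ℝ)

/-- The energy `J` of a state `(τ, δ, ϖ)` with `(div τ)_t = r`. -/
def J (τ : H1vec Ω) (δ ϖ r : L2 Ω) : ℝ :=
  (1 / 2) * (D.γ * strainInner τ τ + D.χ₂ * ‖ϖ‖ ^ 2 + D.χ₃ * ‖δ‖ ^ 2
    + D.lam ^ 2 * D.χ₃ * ‖r‖ ^ 2 + 2 * D.lam * D.χ₃ * inner ℝ r δ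
    - 2 * D.load τ)

/-- `(τ, δ, ϖ, p, q)` is a weak solution on `(0,T)` of the reformulated problem; `ϖt` is the
derivative `ϖ_t`, and `r` is `(div τ)_t`, which occurs in the problem only if `λ* > 0` (for `λ* = 0`
it is arbitrary, and all terms with `r` vanish). -/
structure IsWeakSolution (T : ℝ) (τ : ℝ → H1vec Ω) (δ ϖ : ℝ → L2 Ω) (p : ℝ → H1 Ω) (q : ℝ → L2 Ω)
    (ϖt : ℝ → H1dual Ω) (r : ℝ → L2 Ω) : Prop where
  τ_mem : MemLp τ ∞ (timeMeas T)
  τ_orth : ∀ᵐ t ∂(timeMeas T), OrthRM (τ t)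
  δ_mem : MemLp δ ∞ (timeMeas T)
  ϖ_mem : MemLp ϖ ∞ (timeMeas T)
  ϖt_mem : MemLp ϖt 2 (timeMeas T)
  ϖ_deriv : HasWeakTimeDeriv T (fun t => L2toDual (ϖ t)) ϖt
  q_mem : MemLp q ∞ (timeMeas T)
  p_mem : MemLp p 2 (timeMeas T)
  p_mem_L2 : MemLp (fun t => toL2 (p t)) ∞ (timeMeas T)
  r_deriv : 0 < D.lam → HasWeakTimeDeriv T (fun t => divg (τ t)) r
  momentum : ∀ᵐ t ∂(timeMeas T), ∀ v : H1vec Ω,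
    D.γ * strainInner (τ t) v - inner ℝ (δ t) (divg v) = D.load v
  constraint : ∀ᵐ t ∂(timeMeas T), ∀ η : L2 Ω,
    D.χ₃ * inner ℝ (δ t) η + inner ℝ (divg (τ t)) η + D.lam * D.χ₃ * inner ℝ (r t) η
      = D.χ₁ * inner ℝ (ϖ t) η
  diffusion : ∀ᵐ t ∂(timeMeas T), ∀ ψ : H1 Ω,
    ϖt t ψ + (1 / D.θf) * D.darcy (p t) ψ = D.source ψ
  p_eq : ∀ᵐ t ∂(timeMeas T),
    toL2 (p t) = D.χ₁ • δ t + D.χ₂ • ϖ t + (D.lam * D.χ₁) • r t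
  q_eq : ∀ᵐ t ∂(timeMeas T),
    q t = D.χ₁ • ϖ t - D.χ₃ • δ t - (D.lam * D.χ₃) • r t
  initial : HasInitialValue T (fun t => L2toDual (ϖ t)) (L2toDual D.ϖ₀)

end Data

end Biot

end

open Biot

open MeasureTheory Set Filter Topology
open scoped ENNReal ContDiff Matrix

noncomputable section

namespace Biot

/-! ### Functions of time -/

/-! The energy law is the chain rule for a quadratic energy along a path too rough to differentiate:
`ϖ_t` lies only in `H¹(Ω)'`, and neither `τ` nor `δ` has a time derivative of its own. What replaces
differentiation is convexity. With `k = δ + λ* (div τ)_t` the energy is a nonnegative quadratic form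
in `(τ, ϖ, k)` minus the load, so its increment from `t` to `s` is at least its linearisation at
`t`. The momentum equation at `t` and the constraint at both times turn this linearisation into
`(ϖ(s) - ϖ(t), p(t)) - λ* ((div τ)_t(t), div τ(s) - div τ(t))`, that is, `B (∫ F) (G t)` with `∫`
from `t` to `s`, `F = (ϖ_t, (div τ)_t)` and `G = (p, -λ* (div τ)_t)`, both square integrable in time
(`le_stateEnergy_sub`).

A one-sided bound valid for `s` on both sides of `t` forces equality. Integrated over `t ∈ (a,b)`
with `s = t + h`, it says that a function of `h` has a local minimum at `h = 0`; that function is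
differentiable there because translation is continuous in `L²`, so its derivative vanishes. This is
the identity between almost all pairs of times (`energy_identity_ae`). It extends to every time: one
inequality is lower semicontinuity of the energy, and a gap in the other would force `‖G t‖²` to be
at least a multiple of `1/|t - s|` near `s`, which is not integrable (`energy_identity`).

Representatives defined at every time come from weak compactness and uniqueness in the limit
(`exists_weaklyContinuous`). Uniqueness needs only that a field with zero strain is a rigid motion,
and that `H¹(Ω)` and the divergences are dense in `L²(Ω)`; neither Korn's inequality nor an inf-sup
bound enters. Testing the diffusion equation with `p(t)` converts the integral of `ϖ_t(p)` into the
Darcy and source terms.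

The bound for `ϖ_t` is read off the diffusion equation and the trace inequality, which is proved
face by face, integrating along segments towards the opposite vertex. -/

theorem Icc_subset_closure_of_ae {T : ℝ} (hT : 0 < T) {P : ℝ → Prop}
    (h : ∀ᵐ t ∂(timeMeas T), P t) : Icc 0 T ⊆ closure (Ioo 0 T ∩ {t | P t}) := by
  have h1 : ∀ᵐ t : ℝ, t ∈ Ioo 0 T → P t := (ae_restrict_iff' measurableSet_Ioo).1 h
  have h2 : Dense {t : ℝ | t ∈ Ioo 0 T → P t} := Measure.dense_of_ae h1
  have h3 := h2.open_subset_closure_inter (isOpen_Ioo (a := (0 : ℝ)) (b := T))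
  have h4 : Ioo 0 T ∩ {t : ℝ | t ∈ Ioo 0 T → P t} = Ioo 0 T ∩ {t | P t} := by
    ext t; simp only [mem_inter_iff, mem_ofPred_eq]; tauto
  rw [h4] at h3
  rw [← closure_Ioo hT.ne]
  exact closure_minimal h3 isClosed_closure

theorem exists_of_ae_timeMeas {T : ℝ} (hT : 0 < T) {P : ℝ → Prop}
    (h : ∀ᵐ t ∂(timeMeas T), P t) : ∃ t ∈ Ioo 0 T, P t := by
  have := Icc_subset_closure_of_ae hT h (left_mem_Icc.2 hT.le)
  obtain ⟨t, ht⟩ := closure_nonempty_iff.1 ⟨_, this⟩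
  exact ⟨t, ht.1, ht.2⟩

theorem eqOn_of_ae_eq {T : ℝ} (hT : 0 < T) {Y : Type*} [TopologicalSpace Y] [T2Space Y]
    {f g : ℝ → Y} (hf : ContinuousOn f (Icc 0 T)) (hg : ContinuousOn g (Icc 0 T))
    (h : ∀ᵐ t ∂(timeMeas T), f t = g t) : EqOn f g (Icc 0 T) := by
  have h1 : EqOn f g (Ioo 0 T ∩ {t | f t = g t}) := fun t ht => ht.2
  exact h1.of_subset_closure hf hg (fun t ht => Ioo_subset_Icc_self ht.1)
    (Icc_subset_closure_of_ae hT h)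

theorem ae_mem_timeMeas (T : ℝ) : ∀ᵐ t ∂(timeMeas T), t ∈ Ioo 0 T :=
  ae_restrict_mem measurableSet_Ioo

instance isFiniteMeasure_timeMeas (T : ℝ) : IsFiniteMeasure (timeMeas T) := by
  unfold timeMeas; infer_instance

theorem intervalIntegrable_of_timeMeas {T : ℝ} {X : Type*} [NormedAddCommGroup X] {f : ℝ → X}
    (hf : Integrable f (timeMeas T)) {a b : ℝ} (ha : a ∈ Icc 0 T) (hb : b ∈ Icc 0 T) :
    IntervalIntegrable f volume a b := by
  have h0 : (0 : ℝ) ≤ T := ha.1.trans ha.2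
  have : IntervalIntegrable f volume 0 T :=
    (intervalIntegrable_iff_integrableOn_Ioo_of_le h0).2 hf
  exact this.mono_set (by rw [uIcc_of_le h0]; exact uIcc_subset_Icc ha hb)

theorem continuousOn_primitive_of_timeMeas {T : ℝ} {X : Type*} [NormedAddCommGroup X]
    [NormedSpace ℝ X] {f : ℝ → X} (hf : Integrable f (timeMeas T)) (hT : 0 < T) :
    ContinuousOn (fun s => ∫ t in (0 : ℝ)..s, f t) (Icc 0 T) := by
  have h := intervalIntegral.continuousOn_primitive_interval (f := f) (a := 0) (b := T)
    (μ := volume) ?_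
  · rwa [uIcc_of_le hT.le] at h
  · rw [uIcc_of_le hT.le, integrableOn_Icc_iff_integrableOn_Ioo]
    exact hf

/-- A bounded function of time, tested with enough functionals that make it continuous, has a
weakly continuous representative. -/
theorem exists_weaklyContinuous {X : Type*} [NormedAddCommGroup X] [InnerProductSpace ℝ X]
    [CompleteSpace X] {T : ℝ} (hT : 0 < T) {u : ℝ → X} (hu : MemLp u ∞ (timeMeas T))
    {I : Type*} (f : I → X →L[ℝ] ℝ) (c : I → ℝ → ℝ) (hc : ∀ i, ContinuousOn (c i) (Icc 0 T))
    (hf : ∀ x, (∀ i, f i x = 0) → x = 0) (h : ∀ᵐ t ∂(timeMeas T), ∀ i, f i (u t) = c i t) :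
    ∃ u' : ℝ → X, u' =ᵐ[timeMeas T] u ∧ WeaklyContinuous T u' ∧
      ∀ t ∈ Icc 0 T, ∀ i, f i (u' t) = c i t := by
  set M : ℝ := (eLpNorm u ∞ (timeMeas T)).toReal with hM
  have hbd : ∀ᵐ t ∂(timeMeas T), ‖u t‖ ≤ M := by
    filter_upwards [enorm_ae_le_eLpNormEssSup u (timeMeas T)] with t ht
    rw [hM, eLpNorm_exponent_top, ← toReal_enorm]
    refine ENNReal.toReal_mono ?_ ht
    rw [← eLpNorm_exponent_top]; exact hu.eLpNorm_ne_top
  have hG := Icc_subset_closure_of_ae hT (hbd.and h)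
  -- Banach–Alaoglu: along an ultrafilter of good times tending to `t`, the values `u s` converge
  -- weakly; each `f i` passes to the limit and keeps the value prescribed by continuity of `c i`.
  have key : ∀ t ∈ Icc 0 T, ∃ x : X, ‖x‖ ≤ M ∧ ∀ i, f i x = c i t := by
    intro t ht
    set G := Ioo 0 T ∩ {t | ‖u t‖ ≤ M ∧ ∀ i, f i (u t) = c i t}
    have : (𝓝[G] t).NeBot := mem_closure_iff_nhdsWithin_neBot.1 (hG ht)
    let U : Ultrafilter ℝ := Ultrafilter.of (𝓝[G] t)
    have hU : (U : Filter ℝ) ≤ 𝓝[G] t := Ultrafilter.of_le _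
    have hUG : G ∈ U := hU self_mem_nhdsWithin
    let e : ℝ → WeakDual ℝ X := fun s => StrongDual.toWeakDual (innerSL ℝ (u s))
    obtain ⟨L, hL, hUL⟩ := (WeakDual.isCompact_closedBall (𝕜 := ℝ) (E := X) 0 M).ultrafilter_le_nhds
      (U.map e) (by
        rw [le_principal_iff]
        refine mem_map.2 (mem_of_superset hUG fun s hs => ?_)
        simpa [e] using hs.2.1)
    let x : X := (InnerProductSpace.toDual ℝ X).symm (WeakDual.toStrongDual L)
    have hx : ∀ w, inner ℝ x w = L w := fun w => InnerProductSpace.toDual_symm_apply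
    have htend : ∀ w, Tendsto (fun s => inner ℝ (u s) w) U (𝓝 (inner ℝ x w)) := by
      intro w
      rw [hx]
      exact ((WeakDual.eval_continuous w).tendsto L).comp hUL
    refine ⟨x, ?_, fun i => ?_⟩
    · have : ‖WeakDual.toStrongDual L‖ ≤ M := by simpa using hL
      simpa [x] using this
    · have h1 := htend ((InnerProductSpace.toDual ℝ X).symm (f i))
      have h2 : ∀ y : X, inner ℝ y ((InnerProductSpace.toDual ℝ X).symm (f i)) = f i y := fun y => by
        rw [real_inner_comm]; exact InnerProductSpace.toDual_symm_apply
      simp only [h2] at h1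
      have h3 : Tendsto (c i) U (𝓝 (c i t)) :=
        ((hc i t ht).mono (fun s hs => Ioo_subset_Icc_self hs.1)).tendsto.mono_left hU
      exact tendsto_nhds_unique (h1.congr' (mem_of_superset hUG fun s hs => hs.2.2 i)) h3
  classical
  let u' : ℝ → X := fun t => if ht : t ∈ Icc 0 T then (key t ht).choose else 0
  have hu' : ∀ t ∈ Icc 0 T, ‖u' t‖ ≤ M ∧ ∀ i, f i (u' t) = c i t := by
    intro t ht
    simp only [u', dif_pos ht]
    exact (key t ht).choose_spec
  refine ⟨u', ?_, ?_, fun t ht => (hu' t ht).2⟩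
  · filter_upwards [h, ae_mem_timeMeas T] with t ht htT
    refine sub_eq_zero.1 (hf _ fun i => ?_)
    rw [map_sub, (hu' t (Ioo_subset_Icc_self htT)).2 i, ht i, sub_self]
  -- The directions in which `u'` is continuous form a subspace, closed because `u'` is bounded. It
  -- contains the Riesz representatives of all `f i`, and these have trivial orthogonal complement
  -- since the `f i` separate points.
  · let N : Submodule ℝ X :=
      { carrier := {w | ContinuousOn (fun t => inner ℝ (u' t) w) (Icc 0 T)}
        add_mem' := fun ha hb => by
          simp only [mem_ofPred_eq, inner_add_right]; exact ContinuousOn.add ha hb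
        zero_mem' := by simpa using continuousOn_const
        smul_mem' := fun r w hw => by
          simp only [mem_ofPred_eq, inner_smul_right]; exact continuousOn_const.mul hw }
    have hcl : IsClosed (N : Set X) := by
      refine isClosed_of_closure_subset fun w hw => ?_
      have h0 : ContinuousOn (fun t => inner ℝ (u' t) w) (Icc 0 T) := by
        refine continuousOn_of_uniform_approx_of_continuousOn fun V hV => ?_
        obtain ⟨ε, hε, hεV⟩ := Metric.mem_uniformity_dist.1 hV
        have hM0 : 0 < |M| + 1 := by positivity
        obtain ⟨w', hw', hd⟩ := Metric.mem_closure_iff.1 hw (ε / (|M| + 1)) (by positivity)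
        refine ⟨_, hw', fun t ht => hεV ?_⟩
        rw [Real.dist_eq, ← inner_sub_right]
        calc |inner ℝ (u' t) (w - w')| ≤ ‖u' t‖ * ‖w - w'‖ := abs_real_inner_le_norm _ _
          _ ≤ (|M| + 1) * ‖w - w'‖ := by
            gcongr
            exact ((hu' t ht).1.trans (le_abs_self M)).trans (by linarith)
          _ < (|M| + 1) * (ε / (|M| + 1)) := by
            rw [← dist_eq_norm]; gcongr
          _ = ε := by field_simp
      exact h0
    have : CompleteSpace N := hcl.completeSpace_coe
    have hbot : Nᗮ = ⊥ := by
      refine (Submodule.eq_bot_iff _).2 fun x hx => hf x fun i => ?_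
      have hi : (InnerProductSpace.toDual ℝ X).symm (f i) ∈ N := by
        have h2 : ∀ y : X, inner ℝ y ((InnerProductSpace.toDual ℝ X).symm (f i)) = f i y :=
          fun y => by rw [real_inner_comm]; exact InnerProductSpace.toDual_symm_apply
        change ContinuousOn (fun t => inner ℝ (u' t) _) (Icc 0 T)
        simp only [h2]
        exact (hc i).congr fun t ht => (hu' t ht).2 i
      have h3 := (Submodule.mem_orthogonal _ _).1 hx _ hi
      rwa [InnerProductSpace.toDual_symm_apply] at h3
    have htop : N = ⊤ := (Submodule.orthogonal_eq_bot_iff).1 hbot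
    intro w
    have : w ∈ N := htop ▸ Submodule.mem_top
    exact this

theorem WeaklyContinuous.comp_clm {X Y : Type*} [NormedAddCommGroup X] [InnerProductSpace ℝ X]
    [CompleteSpace X] [NormedAddCommGroup Y] [InnerProductSpace ℝ Y] [CompleteSpace Y] {T : ℝ}
    {u : ℝ → X} (hu : WeaklyContinuous T u) (L : X →L[ℝ] Y) :
    WeaklyContinuous T (fun t => L (u t)) := by
  intro w
  simp only [← ContinuousLinearMap.adjoint_inner_right]
  exact hu _

theorem WeaklyContinuous.clm {X : Type*} [NormedAddCommGroup X] [InnerProductSpace ℝ X]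
    [CompleteSpace X] {T : ℝ} {u : ℝ → X} (hu : WeaklyContinuous T u) (L : X →L[ℝ] ℝ) :
    ContinuousOn (fun t => L (u t)) (Icc 0 T) := by
  have h := hu ((InnerProductSpace.toDual ℝ X).symm L)
  have h2 : ∀ y : X, inner ℝ y ((InnerProductSpace.toDual ℝ X).symm L) = L y :=
    fun y => by rw [real_inner_comm]; exact InnerProductSpace.toDual_symm_apply
  simpa only [h2] using h

section

variable {X : Type*} [NormedAddCommGroup X] [InnerProductSpace ℝ X] {T : ℝ} {u v : ℝ → X}

theorem WeaklyContinuous.sub (hu : WeaklyContinuous T u) (hv : WeaklyContinuous T v) :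
    WeaklyContinuous T (fun t => u t - v t) := by
  intro w; simp only [inner_sub_left]; exact (hu w).sub (hv w)

theorem WeaklyContinuous.const_smul (hu : WeaklyContinuous T u) (c : ℝ) :
    WeaklyContinuous T (fun t => c • u t) := by
  intro w; simp only [real_inner_smul_left]; exact continuousOn_const.mul (hu w)

theorem ContinuousOn.weaklyContinuous (hu : ContinuousOn u (Icc 0 T)) : WeaklyContinuous T u :=
  fun _ => hu.inner continuousOn_const

end

/-! ### Weak time derivatives -/

/-- The primitive from `-∞` vanishes to the left of the support of `η`, and to its right because `η`
has mean zero. -/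
theorem exists_isTest_deriv_eq {T : ℝ} (hT : 0 < T) {η : ℝ → ℝ} (hη : IsTest (Ioo 0 T) η)
    (h0 : ∫ t, η t = 0) : ∃ θ : ℝ → ℝ, IsTest (Ioo 0 T) θ ∧ deriv θ = η := by
  have hcont := hη.smooth.continuous
  -- Inserting `T / 2` keeps the compact set nonempty when `η = 0`.
  have hK : IsCompact (insert (T / 2) (tsupport η)) := hη.compact.isCompact.insert _
  have hKs : insert (T / 2) (tsupport η) ⊆ Ioo 0 T :=
    insert_subset ⟨by linarith, by linarith⟩ hη.supp
  obtain ⟨a, ha⟩ := hK.exists_isLeast (insert_nonempty _ _)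
  obtain ⟨b, hb⟩ := hK.exists_isGreatest (insert_nonempty _ _)
  have haη : ∀ t, t < a → η t = 0 := fun t ht => by
    by_contra hc
    exact absurd (ha.2 (mem_insert_of_mem _ (subset_tsupport _ hc))) (not_le.2 ht)
  have hbη : ∀ t, b < t → η t = 0 := fun t ht => by
    by_contra hc
    exact absurd (hb.2 (mem_insert_of_mem _ (subset_tsupport _ hc))) (not_le.2 ht)
  set θ : ℝ → ℝ := fun t => ∫ s in Iic t, η s with hθ
  have hint : Integrable η := hcont.integrable_of_hasCompactSupport hη.compact
  have hderiv : ∀ t, HasDerivAt θ (η t) t := by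
    intro t
    have h1 : θ = fun t => (∫ s in Iic (0 : ℝ), η s) + ∫ s in (0 : ℝ)..t, η s := by
      funext t
      rw [hθ, ← intervalIntegral.integral_Iic_sub_Iic hint.integrableOn hint.integrableOn]
      ring
    rw [h1]
    exact ((hcont.integral_hasStrictDerivAt 0 t).hasDerivAt).const_add _
  have hd : deriv θ = η := funext fun t => (hderiv t).deriv
  have hθa : ∀ t, t < a → θ t = 0 := fun t ht =>
    setIntegral_eq_zero_of_forall_eq_zero fun s hs => haη s (lt_of_le_of_lt hs ht)
  have hθb : ∀ t, b < t → θ t = 0 := by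
    intro t ht
    have h2 : θ t + ∫ s in Ioi t, η s = 0 := by
      rw [hθ]
      simp only
      rw [intervalIntegral.integral_Iic_add_Ioi hint.integrableOn hint.integrableOn, h0]
    have h3 : ∫ s in Ioi t, η s = 0 :=
      setIntegral_eq_zero_of_forall_eq_zero fun s hs => hbη s (ht.trans hs)
    rwa [h3, add_zero] at h2
  have hsupp : tsupport θ ⊆ Icc a b := by
    refine closure_minimal (fun t ht => ?_) isClosed_Icc
    by_contra hc
    rw [mem_Icc, not_and_or, not_le, not_le] at hc
    exact ht (hc.elim (hθa t) (hθb t))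
  refine ⟨θ, ⟨?_, ?_, ?_⟩, hd⟩
  · refine contDiff_infty_iff_deriv.2 ⟨fun t => (hderiv t).differentiableAt, ?_⟩
    rw [hd]; exact hη.smooth
  · exact isCompact_Icc.of_isClosed_subset (isClosed_tsupport _) hsupp
  · exact hsupp.trans (Icc_subset_Ioo (hKs ha.1).1 (hKs hb.1).2)

theorem exists_isTest_integral_eq_one {T : ℝ} (hT : 0 < T) :
    ∃ ρ : ℝ → ℝ, IsTest (Ioo 0 T) ρ ∧ ∫ t, ρ t = 1 := by
  let f : ContDiffBump (T / 2) := ⟨T / 8, T / 4, by positivity, by linarith⟩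
  refine ⟨f.normed volume, ⟨f.contDiff_normed, f.hasCompactSupport_normed, ?_⟩, f.integral_normed⟩
  rw [f.tsupport_normed_eq, Real.closedBall_eq_Icc]
  exact Icc_subset_Ioo (by change 0 < T / 2 - T / 4; linarith)
    (by change T / 2 + T / 4 < T; linarith)

theorem IsTest.integrable_smul {X : Type*} [NormedAddCommGroup X] [NormedSpace ℝ X] {T : ℝ}
    {u : ℝ → X} (hu : Integrable u (timeMeas T)) {θ : ℝ → ℝ} (hθ : Continuous θ)
    (hc : HasCompactSupport θ) : Integrable (fun t => θ t • u t) (timeMeas T) := by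
  obtain ⟨C, hC⟩ := hc.exists_bound_of_continuous hθ
  exact hu.bdd_smul C hθ.aestronglyMeasurable (Eventually.of_forall hC)

theorem IsTest.deriv_continuous {U : Set ℝ} {θ : ℝ → ℝ} (h : IsTest U θ) :
    Continuous (deriv θ) := h.smooth.continuous_deriv (by simp)

theorem IsTest.integral_Ioo {T : ℝ} {θ : ℝ → ℝ} (h : IsTest (Ioo 0 T) θ) :
    ∫ t in Ioo 0 T, θ t = ∫ t, θ t :=
  setIntegral_eq_integral_of_forall_compl_eq_zero fun t ht => by
    by_contra hc
    exact ht (h.supp (subset_tsupport _ hc))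

/-- The du Bois-Reymond lemma: subtracting a multiple of a fixed bump `ρ` of mass one gives any test
function mean zero, hence makes it the derivative of a test function. The constant is the
`ρ`-average of `w`. -/
theorem exists_ae_eq_const_of_weakTimeDeriv_zero {X : Type*} [NormedAddCommGroup X]
    [NormedSpace ℝ X] [CompleteSpace X] {T : ℝ} (hT : 0 < T) {w : ℝ → X}
    (hw : Integrable w (timeMeas T))
    (h : ∀ θ : ℝ → ℝ, IsTest (Ioo 0 T) θ → ∫ t in Ioo 0 T, deriv θ t • w t = 0) :
    ∃ x : X, ∀ᵐ t ∂(timeMeas T), w t = x := by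
  obtain ⟨ρ, hρ, hρ1⟩ := exists_isTest_integral_eq_one hT
  set x : X := ∫ t in Ioo 0 T, ρ t • w t with hx
  refine ⟨x, ?_⟩
  have hloc : LocallyIntegrableOn (fun t => w t - x) (Ioo 0 T) volume :=
    IntegrableOn.locallyIntegrableOn (Integrable.sub hw (integrable_const x))
  have := (isOpen_Ioo (a := (0 : ℝ)) (b := T)).ae_eq_zero_of_integral_contDiff_smul_eq_zero hloc ?_
  · refine (ae_restrict_iff' measurableSet_Ioo).2 ?_
    filter_upwards [this] with t ht htT using sub_eq_zero.1 (ht htT)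
  intro η hη1 hη2 hη3
  have hη : IsTest (Ioo 0 T) η := ⟨hη1, hη2, hη3⟩
  set c : ℝ := ∫ t, η t with hc
  have htest : IsTest (Ioo 0 T) (fun t => η t - c * ρ t) := by
    refine ⟨hη1.sub (contDiff_const.mul hρ.smooth), ?_, ?_⟩
    · exact hη2.sub (hρ.compact.mul_left)
    · refine (tsupport_sub _ _).trans (union_subset hη3 ?_)
      exact (closure_mono (Function.support_mul_subset_right _ _)).trans hρ.supp
  have hz : ∫ t, (η t - c * ρ t) = 0 := by
    rw [integral_sub (hη1.continuous.integrable_of_hasCompactSupport hη2)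
      ((hρ.smooth.continuous.integrable_of_hasCompactSupport hρ.compact).const_mul c),
      integral_const_mul, hρ1, ← hc]
    ring
  obtain ⟨θ, hθ, hθ'⟩ := exists_isTest_deriv_eq hT htest hz
  have h1 := h θ hθ
  rw [hθ'] at h1
  have i1 := IsTest.integrable_smul hw hη1.continuous hη2
  have i2 := IsTest.integrable_smul hw hρ.smooth.continuous hρ.compact
  have i3 := IsTest.integrable_smul (integrable_const (μ := timeMeas T) x) hη1.continuous hη2
  have e1 : ∫ t in Ioo 0 T, (η t - c * ρ t) • w t
      = (∫ t in Ioo 0 T, η t • w t) - c • x := by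
    rw [hx, ← integral_smul]
    refine Eq.trans ?_ (integral_sub i1 (i2.smul c))
    refine integral_congr_ae (Eventually.of_forall fun t => ?_)
    simp only [sub_smul, mul_smul]
  have e2 : ∫ t in Ioo 0 T, η t • (w t - x) = (∫ t in Ioo 0 T, η t • w t) - c • x := by
    simp only [smul_sub]
    refine (integral_sub i1 i3).trans ?_
    rw [integral_smul_const, hc, ← hη.integral_Ioo]
    rfl
  have e3 : ∫ t, η t • (w t - x) = ∫ t in Ioo 0 T, η t • (w t - x) := by
    refine (setIntegral_eq_integral_of_forall_compl_eq_zero fun t ht => ?_).symm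
    have : η t = 0 := by
      by_contra hc
      exact ht (hη3 (subset_tsupport _ hc))
    rw [this, zero_smul]
  rw [e3, e2, ← e1, h1]

/-- Integration by parts for an `f` that is merely integrable, by Fubini on the triangle `s ≤ t`. -/
theorem integral_deriv_smul_primitive {X : Type*} [NormedAddCommGroup X] [NormedSpace ℝ X]
    [CompleteSpace X] {T : ℝ} {f : ℝ → X} (hf : Integrable f (timeMeas T))
    {θ : ℝ → ℝ} (hθ : IsTest (Ioo 0 T) θ) :
    ∫ t in Ioo 0 T, deriv θ t • ∫ s in (0 : ℝ)..t, f s = - ∫ t in Ioo 0 T, θ t • f t := by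
  let μ := timeMeas T
  have hθT : θ T = 0 := by
    by_contra hc
    exact (hθ.supp (subset_tsupport _ hc)).2.false
  let k : ℝ × ℝ → X := {z : ℝ × ℝ | z.2 ≤ z.1}.indicator fun z => deriv θ z.1 • f z.2
  have hk : Integrable k (μ.prod μ) := by
    refine Integrable.indicator ?_ (measurableSet_le measurable_snd measurable_fst)
    have h1 : Integrable (deriv θ) μ :=
      (hθ.deriv_continuous.integrable_of_hasCompactSupport hθ.compact.deriv).restrict
    exact Integrable.smul_prod h1 hf
  have e1 : ∫ t in Ioo 0 T, deriv θ t • ∫ s in (0 : ℝ)..t, f s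
      = ∫ t, ∫ s, k (t, s) ∂μ ∂μ := by
    refine setIntegral_congr_fun measurableSet_Ioo fun t ht => ?_
    have : (fun s => k (t, s)) = (Iic t).indicator fun s => deriv θ t • f s := by
      funext s; simp only [k, indicator, mem_ofPred_eq, mem_Iic]
    change _ = ∫ s, (fun s => k (t, s)) s ∂μ
    rw [this, integral_indicator measurableSet_Iic]
    change _ = ∫ x, _ ∂((volume.restrict (Ioo 0 T)).restrict (Iic t))
    rw [Measure.restrict_restrict measurableSet_Iic,
      integral_smul, intervalIntegral.integral_of_le ht.1.le]
    congr 3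
    ext s; simp only [mem_Ioc, mem_inter_iff, mem_Iic, mem_Ioo]
    exact ⟨fun h => ⟨h.2, h.1, h.2.trans_lt ht.2⟩, fun h => ⟨h.2.1, h.1⟩⟩
  have e2 : ∫ s, ∫ t, k (t, s) ∂μ ∂μ = ∫ s in Ioo 0 T, (- θ s) • f s := by
    refine setIntegral_congr_fun measurableSet_Ioo fun s hs => ?_
    have : (fun t => k (t, s)) = (Ici s).indicator fun t => deriv θ t • f s := by
      funext t; by_cases hst : s ≤ t <;> simp [k, hst]
    change ∫ t, (fun t => k (t, s)) t ∂μ = _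
    rw [this, integral_indicator measurableSet_Ici]
    change ∫ x, _ ∂((volume.restrict (Ioo 0 T)).restrict (Ici s)) = _
    rw [Measure.restrict_restrict measurableSet_Ici,
      integral_smul_const]
    congr 1
    have h2 : Ici s ∩ Ioo 0 T = Ico s T := by
      ext t; simp only [mem_Ico, mem_inter_iff, mem_Ici, mem_Ioo]
      exact ⟨fun h => ⟨h.1, h.2.2⟩, fun h => ⟨h.1, hs.1.trans_le h.1, h.2⟩⟩
    rw [h2, integral_Ico_eq_integral_Ioo, ← integral_Ioc_eq_integral_Ioo,
      ← intervalIntegral.integral_of_le hs.2.le,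
      intervalIntegral.integral_deriv_eq_sub
        (fun t _ => hθ.smooth.differentiable (by simp) t)
        (hθ.deriv_continuous.intervalIntegrable _ _), hθT, zero_sub]
  rw [e1, integral_integral_swap (f := fun t s => k (t, s)) hk, e2, ← integral_neg]
  simp only [neg_smul]

/-- A function with an integrable weak derivative is, up to a constant, its primitive. -/
theorem HasWeakTimeDeriv.exists_ae_eq {X : Type*} [NormedAddCommGroup X] [NormedSpace ℝ X]
    [CompleteSpace X] {T : ℝ} (hT : 0 < T) {u u' : ℝ → X} (h : HasWeakTimeDeriv T u u') :
    ∃ x : X, ∀ᵐ t ∂(timeMeas T), u t = x + ∫ s in (0 : ℝ)..t, u' s := by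
  obtain ⟨hu, hu', h⟩ := h
  set v : ℝ → X := fun t => ∫ s in (0 : ℝ)..t, u' s with hv
  have hvi : Integrable v (timeMeas T) :=
    ((continuousOn_primitive_of_timeMeas hu' hT).integrableOn_Icc).mono_set Ioo_subset_Icc_self
  obtain ⟨x, hx⟩ := exists_ae_eq_const_of_weakTimeDeriv_zero hT (hu.sub hvi) (fun θ hθ => by
    simp only [Pi.sub_apply, smul_sub]
    refine (integral_sub (IsTest.integrable_smul hu hθ.deriv_continuous hθ.compact.deriv)
      (IsTest.integrable_smul hvi hθ.deriv_continuous hθ.compact.deriv)).trans ?_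
    change (∫ t in Ioo 0 T, deriv θ t • u t) - ∫ t in Ioo 0 T, deriv θ t • v t = 0
    rw [h θ hθ, integral_deriv_smul_primitive hu' hθ, sub_self])
  refine ⟨x, ?_⟩
  filter_upwards [hx] with t ht
  rw [← ht, Pi.sub_apply, sub_add_cancel]


/-! ### Energy identities in time -/

/-- Cauchy–Schwarz against the constant `1`, obtained from the nonnegativity of the variance of
`‖F‖`. -/
theorem sq_integral_norm_le {X : Type*} [NormedAddCommGroup X] {μ : Measure ℝ}
    [IsFiniteMeasure μ] {F : ℝ → X} (hF : MemLp F 2 μ) :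
    (∫ t, ‖F t‖ ∂μ) ^ 2 ≤ μ.real univ * ∫ t, ‖F t‖ ^ 2 ∂μ := by
  rcases eq_or_ne μ 0 with h0 | h0
  · simp [h0]
  have hL : 0 < μ.real univ := by
    have : NeZero μ := ⟨h0⟩
    exact measureReal_univ_pos
  set m := ∫ t, ‖F t‖ ∂μ
  set S := ∫ t, ‖F t‖ ^ 2 ∂μ
  set L := μ.real univ
  have h1 : Integrable (fun t => ‖F t‖) μ := (hF.integrable (by norm_num)).norm
  have h2 : Integrable (fun t => ‖F t‖ ^ 2) μ := (memLp_two_iff_integrable_sq_norm hF.1).1 hF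
  have h3 : ∫ t, (‖F t‖ - m / L) ^ 2 ∂μ = S - 2 * (m / L) * m + (m / L) ^ 2 * L := by
    have : ∀ t, (‖F t‖ - m / L) ^ 2 = ‖F t‖ ^ 2 - 2 * (m / L) * ‖F t‖ + (m / L) ^ 2 := fun t => by
      ring
    simp only [this]
    rw [integral_add (by exact h2.sub (h1.const_mul _)) (integrable_const _),
      integral_sub h2 (h1.const_mul _), integral_const_mul, integral_const, smul_eq_mul,
      mul_comm (μ.real univ)]
  have h4 : 0 ≤ ∫ t, (‖F t‖ - m / L) ^ 2 ∂μ := integral_nonneg fun t => sq_nonneg _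
  rw [h3] at h4
  have h5 : S - 2 * (m / L) * m + (m / L) ^ 2 * L = S - m ^ 2 / L := by field_simp; ring
  rw [h5, sub_nonneg, div_le_iff₀ hL] at h4
  linarith

section Pairing

variable {X Y : Type*} [NormedAddCommGroup X] [NormedSpace ℝ X]
  [NormedAddCommGroup Y] [NormedSpace ℝ Y] (B : X →L[ℝ] Y →L[ℝ] ℝ)

theorem integrable_pairing {α : Type*} [MeasurableSpace α] {μ : Measure α} {F : α → X} {G : α → Y}
    (hF : MemLp F 2 μ) (hG : MemLp G 2 μ) : Integrable (fun t => B (F t) (G t)) μ :=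
  memLp_one_iff_integrable.1 (B.memLp_of_bilin 1 hF hG)

/-- Translation acts continuously on `L²(ℝ; X)`, and the pairing of `L²` functions is continuous. -/
theorem continuous_integral_pairing_translate {F : ℝ → X} {G : ℝ → Y}
    (hF : MemLp F 2 volume) (hG : MemLp G 2 volume) :
    Continuous fun σ : ℝ => ∫ t, B (F (σ + t)) (G t) := by
  have : Fact ((2 : ℝ≥0∞) ≠ ⊤) := ⟨by simp⟩
  have h1 : Continuous fun σ : ℝ => B.lpPairing volume 2 2 (DomAddAct.mk σ +ᵥ hF.toLp F)
      (hG.toLp G) := by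
    have : Continuous fun σ : ℝ => (DomAddAct.mk σ +ᵥ hF.toLp F : Lp X 2 (volume : Measure ℝ)) :=
      (DomAddAct.continuous_mk).vadd continuous_const
    exact ((B.lpPairing volume 2 2).continuous.comp this).clm_apply continuous_const
  refine h1.congr fun σ => ?_
  rw [ContinuousLinearMap.lpPairing_eq_integral]
  refine integral_congr_ae ?_
  rw [DomAddAct.mk_vadd_toLp]
  filter_upwards [MemLp.coeFn_toLp (hF.comp_measurePreserving
    (measurePreserving_vadd σ (volume : Measure ℝ))), hG.coeFn_toLp] with t h1 h2
  rw [h2]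
  exact congrArg (fun z => B z (G t)) h1

/-- Fubini on `(0,h) × ℝ`. The shear `(σ, t) ↦ (σ, σ + t)` preserves the product measure, so the
translated `F` is square integrable on the product and the double integral converges absolutely. -/
theorem integral_pairing_primitive {F : ℝ → X} {G : ℝ → Y} [CompleteSpace X]
    (hF : MemLp F 2 volume) (hG : MemLp G 2 volume) (h : ℝ) :
    Integrable (fun t => B (∫ s in t..(t + h), F s) (G t)) ∧
    ∫ t, B (∫ s in t..(t + h), F s) (G t) = ∫ σ in (0 : ℝ)..h, ∫ t, B (F (σ + t)) (G t) := by
  have hloc : ∀ t, IntervalIntegrable (fun σ => F (σ + t)) volume 0 h := fun t => by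
    have h1 := (hF.comp_measurePreserving (measurePreserving_add_right volume t)).restrict (uIoc 0 h)
    have : IsFiniteMeasure (volume.restrict (uIoc 0 h)) :=
      isFiniteMeasure_restrict.2 (by simp [uIoc])
    exact intervalIntegrable_iff.2 (h1.integrable (by norm_num))
  have e1 : ∀ t, B (∫ s in t..(t + h), F s) (G t) = ∫ σ in (0 : ℝ)..h, B (F (σ + t)) (G t) := by
    intro t
    have := intervalIntegral.integral_comp_add_right (a := 0) (b := h) F t
    rw [zero_add, add_comm h t] at this
    rw [← this]
    exact ((B.flip (G t)).intervalIntegral_comp_comm (hloc t)).symm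
  let μ : Measure ℝ := volume.restrict (uIoc 0 h)
  have hμ : IsFiniteMeasure μ := by
    exact isFiniteMeasure_restrict.2 (by simp [uIoc])
  have hF1 : AEStronglyMeasurable (fun z : ℝ × ℝ => F (z.1 + z.2)) (μ.prod volume) := by
    have h1 := hF.1.comp_snd (μ := μ)
    exact h1.comp_measurePreserving (measurePreserving_prod_add μ volume)
  have hF2 : MemLp (fun z : ℝ × ℝ => F (z.1 + z.2)) 2 (μ.prod volume) := by
    refine (memLp_two_iff_integrable_sq_norm hF1).2 ?_
    have h1 := ((memLp_two_iff_integrable_sq_norm hF.1).1 hF).comp_snd μ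
    exact (measurePreserving_prod_add μ volume).integrable_comp_of_integrable h1
  have hG2 : MemLp (fun z : ℝ × ℝ => G z.2) 2 (μ.prod volume) := by
    refine (memLp_two_iff_integrable_sq_norm hG.1.comp_snd).2 ?_
    exact ((memLp_two_iff_integrable_sq_norm hG.1).1 hG).comp_snd μ
  have hint := integrable_pairing B hF2 hG2
  simp only [e1]
  refine ⟨?_, ?_⟩
  · simp only [intervalIntegral.intervalIntegral_eq_integral_uIoc]
    exact hint.swap.integral_prod_left.smul (if 0 ≤ h then (1 : ℝ) else -1)
  · simp only [intervalIntegral.intervalIntegral_eq_integral_uIoc]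
    rw [integral_smul, integral_integral_swap (f := fun t σ => B (F (σ + t)) (G t)) hint.swap]

/-- The fundamental theorem of calculus in `h`, whose integrand `σ ↦ ∫ B (F (σ + t)) (G t)` is
continuous. No pointwise differentiation of the primitive of `F` is involved. -/
theorem hasDerivAt_integral_pairing_primitive {F : ℝ → X} {G : ℝ → Y} [CompleteSpace X]
    (hF : MemLp F 2 volume) (hG : MemLp G 2 volume) :
    HasDerivAt (fun h => ∫ t, B (∫ s in t..(t + h), F s) (G t)) (∫ t, B (F t) (G t)) 0 := by
  simp only [(integral_pairing_primitive B hF hG _).2]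
  have h1 := ((continuous_integral_pairing_translate B hF hG).integral_hasStrictDerivAt 0 0).hasDerivAt
  simpa using h1


/-- Primitives of `L²` functions are Hölder continuous of exponent `1/2`; squared, this is the
factor `|b - a|` behind the singularity `1/|t - s|` in `energy_identity`. -/
theorem sq_norm_intervalIntegral_le {T : ℝ} {F : ℝ → X} (hF : MemLp F 2 (timeMeas T)) {a b : ℝ}
    (ha : a ∈ Icc 0 T) (hb : b ∈ Icc 0 T) :
    ‖∫ t in a..b, F t‖ ^ 2 ≤ |b - a| * ∫ t in Ioo 0 T, ‖F t‖ ^ 2 := by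
  have hsub : uIoc a b ⊆ Ioc 0 T := by
    intro t ht
    rw [mem_uIoc] at ht
    rcases ht with ht | ht
    · exact ⟨ha.1.trans_lt ht.1, ht.2.trans hb.2⟩
    · exact ⟨hb.1.trans_lt ht.1, ht.2.trans ha.2⟩
  have hT : timeMeas T = volume.restrict (Ioc 0 T) := restrict_Ioo_eq_restrict_Ioc
  have hF' : MemLp F 2 (volume.restrict (uIoc a b)) := by
    rw [hT] at hF
    exact hF.mono_measure (Measure.restrict_mono hsub le_rfl)
  have : IsFiniteMeasure (volume.restrict (uIoc a b)) := by
    exact isFiniteMeasure_restrict.2 (by simp [uIoc])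
  have h1 : ‖∫ t in a..b, F t‖ ≤ ∫ t in uIoc a b, ‖F t‖ :=
    intervalIntegral.norm_integral_le_integral_norm_uIoc
  have h2 := sq_integral_norm_le hF'
  have h3 : (volume.restrict (uIoc a b)).real univ = |b - a| := by
    rw [measureReal_restrict_apply_univ, Measure.real, uIoc, Real.volume_Ioc,
      max_sub_min_eq_abs, ENNReal.toReal_ofReal (abs_nonneg _)]
  rw [h3] at h2
  refine (pow_le_pow_left₀ (norm_nonneg _) h1 2).trans (h2.trans ?_)
  gcongr ?_ * ?_
  have h4 : Integrable (fun t => ‖F t‖ ^ 2) (volume.restrict (Ioc 0 T)) :=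
    hT ▸ (memLp_two_iff_integrable_sq_norm hF.1).1 hF
  rw [← integral_Ioc_eq_integral_Ioo]
  exact setIntegral_mono_set h4 (Eventually.of_forall fun t => sq_nonneg _) hsub.eventuallyLE

/-- At points `a < b` where the primitive `P` of `J` is differentiable with derivative `J`, the
integral of `J (t + h) - J t` over `(a,b)` has derivative `J b - J a` at `h = 0`. By hypothesis it
dominates a function of `h` with the same value at `0` and derivative `∫ B (F) (G)` there; since `h`
takes both signs, the two derivatives agree. -/
theorem energy_identity_ae [CompleteSpace X] {T : ℝ} (hT : 0 < T) {F : ℝ → X} {G : ℝ → Y}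
    (hF : MemLp F 2 (timeMeas T)) (hG : MemLp G 2 (timeMeas T)) {J : ℝ → ℝ}
    (hJi : Integrable J (timeMeas T))
    (hJ : ∀ᵐ t ∂(timeMeas T), ∀ s ∈ Icc 0 T, B (∫ σ in t..s, F σ) (G t) ≤ J s - J t) :
    ∃ c : ℝ, ∀ᵐ t ∂(timeMeas T), J t = c + ∫ σ in (0 : ℝ)..t, B (F σ) (G σ) := by
  set F₀ : ℝ → X := (Ioo 0 T).indicator F
  set G₀ : ℝ → Y := (Ioo 0 T).indicator G
  set J₀ : ℝ → ℝ := (Ioo 0 T).indicator J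
  have hF₀ : MemLp F₀ 2 volume := (memLp_indicator_iff_restrict measurableSet_Ioo).2 hF
  have hG₀ : MemLp G₀ 2 volume := (memLp_indicator_iff_restrict measurableSet_Ioo).2 hG
  have hJ₀ : Integrable J₀ volume := (integrable_indicator_iff measurableSet_Ioo).2 hJi
  set P : ℝ → ℝ := fun x => ∫ t in (0 : ℝ)..x, J₀ t
  have hP : ∀ᵐ x : ℝ, HasDerivAt P (J₀ x) x := by
    filter_upwards [LocallyIntegrable.ae_hasDerivAt_integral hJ₀.locallyIntegrable] with x hx using hx 0
  have hBi : Integrable (fun t => B (F t) (G t)) (timeMeas T) := integrable_pairing B hF hG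
  have key : ∀ a b : ℝ, a ∈ Ioo 0 T → b ∈ Ioo 0 T → a < b → HasDerivAt P (J₀ a) a →
      HasDerivAt P (J₀ b) b → J b - J a = ∫ σ in a..b, B (F σ) (G σ) := by
    intro a b ha hb hab hPa hPb
    have hsub : Ioo a b ⊆ Ioo 0 T := fun t ht => ⟨ha.1.trans ht.1, ht.2.trans hb.2⟩
    set G₁ : ℝ → Y := (Ioo a b).indicator G₀
    have hG₁ : MemLp G₁ 2 volume := hG₀.indicator measurableSet_Ioo
    have hQ := hasDerivAt_integral_pairing_primitive B hF₀ hG₁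
    set Q : ℝ → ℝ := fun h => ∫ t, B (∫ s in t..(t + h), F₀ s) (G₁ t)
    set R : ℝ → ℝ := fun h => P (b + h) - P (a + h)
    have hR : HasDerivAt R (J₀ b - J₀ a) 0 := by
      refine HasDerivAt.sub ?_ ?_
      · exact HasDerivAt.comp_const_add b 0 (by simpa using hPb)
      · exact HasDerivAt.comp_const_add a 0 (by simpa using hPa)
    -- The restriction on `|h|` keeps `t + h` in `(0,T)` for `t ∈ (a,b)`, where the zero extensions
    -- agree with the original functions.
    have hmin : IsLocalMin (fun h => R h - Q h) 0 := by
      have hδ : 0 < min a (T - b) := lt_min ha.1 (sub_pos.2 hb.2)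
      have hball : ∀ᶠ h : ℝ in 𝓝 0, |h| < min a (T - b) := by
        have := Metric.ball_mem_nhds (0 : ℝ) hδ
        filter_upwards [this] with h hh
        simpa using hh
      filter_upwards [hball] with h hh
      have hint := (integral_pairing_primitive B hF₀ hG₁ h).1
      have e0 : R 0 - Q 0 = P b - P a := by simp [R, Q]
      have hii : ∀ x y, IntervalIntegrable J₀ volume x y := fun x y => hJ₀.intervalIntegrable
      have e1 : R h - (P b - P a) = ∫ t in Ioo a b, (J₀ (t + h) - J₀ t) := by
        rw [← integral_Ioc_eq_integral_Ioo, ← intervalIntegral.integral_of_le hab.le,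
          intervalIntegral.integral_sub ((hJ₀.comp_add_right h).intervalIntegrable) (hii _ _),
          intervalIntegral.integral_comp_add_right J₀ h,
          ← intervalIntegral.integral_interval_sub_left (hii 0 _) (hii 0 _),
          ← intervalIntegral.integral_interval_sub_left (hii 0 b) (hii 0 _)]
      have e2 : Q h = ∫ t in Ioo a b, B (∫ s in t..(t + h), F₀ s) (G₁ t) := by
        refine (setIntegral_eq_integral_of_forall_compl_eq_zero fun t ht => ?_).symm
        simp [G₁, indicator_of_notMem ht]
      have e3 : Q h ≤ R h - (P b - P a) := by
        rw [e1, e2]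
        refine integral_mono_ae hint.integrableOn
          ((hJ₀.comp_add_right h).sub hJ₀).integrableOn ?_
        have hJ' := (ae_restrict_iff' measurableSet_Ioo).1 hJ
        refine (ae_restrict_iff' measurableSet_Ioo).2 ?_
        filter_upwards [hJ'] with t ht htab
        have hm1 := min_le_left a (T - b)
        have hm2 := min_le_right a (T - b)
        obtain ⟨h1, h2⟩ := abs_lt.1 hh
        have hth : t + h ∈ Ioo 0 T := ⟨by linarith [htab.1], by linarith [htab.2]⟩
        have h3 := ht (hsub htab) (t + h) (Ioo_subset_Icc_self hth)
        have h4 : G₁ t = G t := by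
          simp [G₁, G₀, indicator_of_mem htab, indicator_of_mem (hsub htab)]
        have h5 : ∫ s in t..(t + h), F₀ s = ∫ s in t..(t + h), F s := by
          refine intervalIntegral.integral_congr fun s hs => ?_
          refine indicator_of_mem ?_ _
          exact ordConnected_Ioo.uIcc_subset (hsub htab) hth hs
        simp only [J₀, h4, h5, indicator_of_mem (hsub htab), indicator_of_mem hth]
        exact h3
      rw [e0]; linarith
    have h0 := hmin.hasDerivAt_eq_zero (hR.sub hQ)
    have h1 : ∫ t, B (F₀ t) (G₁ t) = ∫ σ in a..b, B (F σ) (G σ) := by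
      rw [intervalIntegral.integral_of_le hab.le, integral_Ioc_eq_integral_Ioo]
      rw [← setIntegral_eq_integral_of_forall_compl_eq_zero (s := Ioo a b)]
      · refine setIntegral_congr_fun measurableSet_Ioo fun t ht => ?_
        simp [F₀, G₁, G₀, indicator_of_mem ht, indicator_of_mem (hsub ht)]
      · intro t ht
        simp [G₁, indicator_of_notMem ht]
    rw [h1] at h0
    simp only [J₀, indicator_of_mem ha, indicator_of_mem hb] at h0
    linarith
  have hP' : ∀ᵐ t ∂(timeMeas T), HasDerivAt P (J₀ t) t := ae_restrict_of_ae hP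
  obtain ⟨a, ha, hPa⟩ := exists_of_ae_timeMeas hT hP'
  refine ⟨J a - ∫ σ in (0 : ℝ)..a, B (F σ) (G σ), ?_⟩
  filter_upwards [hP', ae_mem_timeMeas T] with b hPb hb
  have hi : ∀ x ∈ Ioo 0 T, IntervalIntegrable (fun t => B (F t) (G t)) volume 0 x := fun x hx =>
    intervalIntegrable_of_timeMeas hBi ⟨le_rfl, hT.le⟩ (Ioo_subset_Icc_self hx)
  have hadd : (∫ σ in (0 : ℝ)..b, B (F σ) (G σ)) - ∫ σ in (0 : ℝ)..a, B (F σ) (G σ)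
      = ∫ σ in a..b, B (F σ) (G σ) :=
    intervalIntegral.integral_interval_sub_left (hi b hb) (hi a ha)
  rcases lt_trichotomy a b with h | h | h
  · have := key a b ha hb h hPa hPb
    linarith
  · subst h; ring
  · have := key b a hb ha h hPb hPa
    rw [intervalIntegral.integral_symm] at this
    linarith

/-- The energy identity at every time, from a one-sided inequality at almost every time and the
lower semicontinuity of the energy. -/
theorem energy_identity [CompleteSpace X] {T : ℝ} (hT : 0 < T) {F : ℝ → X} {G : ℝ → Y}
    (hF : MemLp F 2 (timeMeas T)) (hG : MemLp G 2 (timeMeas T)) {J : ℝ → ℝ}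
    (hJi : Integrable J (timeMeas T))
    (hJ : ∀ᵐ t ∂(timeMeas T), ∀ s ∈ Icc 0 T, B (∫ σ in t..s, F σ) (G t) ≤ J s - J t)
    (hlsc : ∀ s ∈ Icc 0 T, ∀ ε > 0, ∀ᶠ t in 𝓝[Icc 0 T] s, J s ≤ J t + ε) :
    ∀ s ∈ Icc 0 T, J s = J 0 + ∫ σ in (0 : ℝ)..s, B (F σ) (G σ) := by
  obtain ⟨c, hc⟩ := energy_identity_ae B hT hF hG hJi hJ
  have hBi : Integrable (fun t => B (F t) (G t)) (timeMeas T) := integrable_pairing B hF hG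
  set E : ℝ → ℝ := fun s => c + ∫ σ in (0 : ℝ)..s, B (F σ) (G σ) with hE
  have hEc : ContinuousOn E (Icc 0 T) :=
    continuousOn_const.add (continuousOn_primitive_of_timeMeas hBi hT)
  suffices h : ∀ s ∈ Icc 0 T, J s = E s by
    intro s hs
    rw [h s hs, h 0 (left_mem_Icc.2 hT.le)]
    simp [hE]
  intro s hs
  refine le_antisymm ?_ ?_
  -- `J s ≤ E s`: lower semicontinuity along good times tending to `s`, at which `J = E`.
  · refine le_of_forall_pos_le_add fun ε hε => ?_
    set A := Ioo 0 T ∩ {t | J t = c + ∫ σ in (0 : ℝ)..t, B (F σ) (G σ)}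
    have hA : A ⊆ Icc 0 T := fun t ht => Ioo_subset_Icc_self ht.1
    have : (𝓝[A] s).NeBot :=
      mem_closure_iff_nhdsWithin_neBot.1 (Icc_subset_closure_of_ae hT hc hs)
    have h1 : Tendsto E (𝓝[A] s) (𝓝 (E s)) := ((hEc s hs).mono hA).tendsto
    have h2 : ∀ᶠ t in 𝓝[A] s, J s ≤ E t + ε := by
      filter_upwards [nhdsWithin_mono s hA (hlsc s hs ε hε), self_mem_nhdsWithin] with t ht htA
      rw [hE]; simp only; rw [← htA.2]; exact ht
    exact ge_of_tendsto (h1.add_const ε) h2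
  -- `E s ≤ J s`: if `J s` lay below `E s` by `2 ε`, then for almost every `t` near `s` the
  -- increment `J s - J t` would be below `-ε`, so the pairing would exceed `ε` in absolute value.
  -- Hölder continuity of the primitive of `F` then bounds `1/|t - s|` by a multiple of `‖G t‖²`,
  -- which is integrable.
  · by_contra hlt
    rw [not_le] at hlt
    set ε := (E s - J s) / 2 with hε
    have hε0 : 0 < ε := by rw [hε]; linarith
    obtain ⟨δ, hδ, hball⟩ := Metric.continuousOn_iff.1 hEc s hs ε hε0
    set α := max 0 (s - δ / 2)
    set β := min T (s + δ / 2)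
    have hαs : α ≤ s := max_le hs.1 (by linarith)
    have hsβ : s ≤ β := le_min hs.2 (by linarith)
    have hα0 : 0 ≤ α := le_max_left _ _
    have hβT : β ≤ T := min_le_left _ _
    have hα1 : s - δ / 2 ≤ α := le_max_right _ _
    have hβ1 : β ≤ s + δ / 2 := min_le_right _ _
    -- For `s = 0` or `s = T` the window is one-sided, but still nondegenerate because `0 < T`.
    have hαβ : α ≠ β := by
      intro h
      have h1 : α = s := le_antisymm hαs (by rw [h]; exact hsβ)
      have h2 : β = s := by rw [← h, h1]
      rcases max_choice 0 (s - δ / 2) with h3 | h3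
      · rcases min_choice T (s + δ / 2) with h4 | h4
        · have : α = 0 := h3
          have : β = T := h4
          linarith
        · have : β = s + δ / 2 := h4
          linarith
      · have : α = s - δ / 2 := h3
        linarith
    have hnot : ¬ IntervalIntegrable (fun t => (t - s)⁻¹) volume α β := by
      rw [intervalIntegrable_sub_inv_iff, not_or, not_not]
      exact ⟨hαβ, by rw [uIcc_of_le (hαs.trans hsβ)]; exact ⟨hαs, hsβ⟩⟩
    refine hnot ?_
    set N := ∫ t in Ioo 0 T, ‖F t‖ ^ 2
    have hN : 0 ≤ N := integral_nonneg fun t => sq_nonneg _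
    have hG2 : Integrable (fun t => ‖G t‖ ^ 2) (timeMeas T) :=
      (memLp_two_iff_integrable_sq_norm hG.1).1 hG
    have hii := (intervalIntegrable_of_timeMeas (hG2.const_mul (‖B‖ ^ 2 * N / ε ^ 2))
      (a := α) (b := β) ⟨hα0, hαs.trans hs.2⟩ ⟨hs.1.trans hsβ, hβT⟩)
    rw [intervalIntegrable_iff_integrableOn_Ioo_of_le (hαs.trans hsβ)] at hii ⊢
    refine Integrable.mono' hii ?_ ?_
    · exact ((measurable_id.sub_const s).inv).aestronglyMeasurable
    · have hJ' := (ae_restrict_iff' measurableSet_Ioo).1 (hJ.and hc)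
      refine (ae_restrict_iff' measurableSet_Ioo).2 ?_
      filter_upwards [hJ'] with t ht htαβ
      have htT : t ∈ Ioo 0 T := ⟨hα0.trans_lt htαβ.1, htαβ.2.trans_le hβT⟩
      obtain ⟨h1, h2⟩ := ht htT
      have h3 := h1 s hs
      have h4 : dist (E t) (E s) < ε := by
        refine hball t (Ioo_subset_Icc_self htT) ?_
        rw [Real.dist_eq, abs_lt]
        exact ⟨by linarith [htαβ.1], by linarith [htαβ.2]⟩
      have h5 : J t = E t := h2
      have h6 : ε ≤ |B (∫ σ in t..s, F σ) (G t)| := by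
        rw [Real.dist_eq, abs_lt] at h4
        refine le_trans ?_ (neg_le_abs _)
        linarith [h4.1]
      have h7 : |B (∫ σ in t..s, F σ) (G t)| ≤ ‖B‖ * ‖∫ σ in t..s, F σ‖ * ‖G t‖ :=
        B.le_opNorm₂ _ _
      have h8 := sq_norm_intervalIntegral_le hF (Ioo_subset_Icc_self htT) hs
      have h9 : ε ^ 2 ≤ ‖B‖ ^ 2 * (|s - t| * N) * ‖G t‖ ^ 2 := by
        calc ε ^ 2 ≤ (‖B‖ * ‖∫ σ in t..s, F σ‖ * ‖G t‖) ^ 2 :=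
              pow_le_pow_left₀ hε0.le (h6.trans h7) 2
          _ = ‖B‖ ^ 2 * ‖∫ σ in t..s, F σ‖ ^ 2 * ‖G t‖ ^ 2 := by ring
          _ ≤ _ := by gcongr
      rw [norm_inv, Real.norm_eq_abs, abs_sub_comm]
      have h10 : 0 < |s - t| := by
        by_contra hc0
        have : |s - t| = 0 := le_antisymm (not_lt.1 hc0) (abs_nonneg _)
        rw [this] at h9
        have := pow_pos hε0 2
        linarith
      rw [inv_le_iff_one_le_mul₀ h10]
      have h11 : 0 < ε ^ 2 := pow_pos hε0 2
      calc (1 : ℝ) = ε ^ 2 / ε ^ 2 := (div_self h11.ne').symm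
        _ ≤ (‖B‖ ^ 2 * (|s - t| * N) * ‖G t‖ ^ 2) / ε ^ 2 := by gcongr
        _ = _ := by ring

end Pairing

/-! ### The trace inequality -/

/-- The integrand of the squared `H¹` norm of a smooth function. -/
def h1Density {d : ℕ} (φ : E d → ℝ) (x : E d) : ℝ := φ x ^ 2 + ∑ i, pderiv φ i x ^ 2

theorem continuous_pderiv {d : ℕ} {φ : E d → ℝ} (hφ : ContDiff ℝ ∞ φ) (i : Fin d) :
    Continuous (pderiv φ i) :=
  (hφ.continuous_fderiv (by simp)).clm_apply continuous_const

theorem continuous_h1Density {d : ℕ} {φ : E d → ℝ} (hφ : ContDiff ℝ ∞ φ) :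
    Continuous (h1Density φ) := by
  unfold h1Density
  have := fun i => continuous_pderiv hφ i
  have := hφ.continuous
  fun_prop

theorem h1Density_nonneg {d : ℕ} (φ : E d → ℝ) (x : E d) : 0 ≤ h1Density φ x := by
  unfold h1Density; positivity

theorem fderiv_eq_sum_pderiv {d : ℕ} (φ : E d → ℝ) (x w : E d) :
    fderiv ℝ φ x w = ∑ i, w i * pderiv φ i x := by
  have h : w = ∑ i, w i • EuclideanSpace.single i (1 : ℝ) := by
    have := (EuclideanSpace.basisFun (Fin d) ℝ).sum_repr w
    simpa using this.symm
  conv_lhs => rw [h]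
  simp [pderiv]

/-- The left side is the derivative of `φ²` in direction `w`. Young's inequality in each coordinate
counts `φ x ^ 2` once per coordinate, whence a factor that `d + 1` covers. -/
theorem two_mul_abs_mul_fderiv_le {d : ℕ} (φ : E d → ℝ) (x w : E d) {M : ℝ} (hM : ‖w‖ ≤ M) :
    |2 * φ x * fderiv ℝ φ x w| ≤ (M * (d + 1)) * h1Density φ x := by
  have hM0 : 0 ≤ M := (norm_nonneg _).trans hM
  rw [fderiv_eq_sum_pderiv, Finset.mul_sum]
  calc |∑ i, 2 * φ x * (w i * pderiv φ i x)| ≤ ∑ i, |2 * φ x * (w i * pderiv φ i x)| :=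
        Finset.abs_sum_le_sum_abs _ _
    _ ≤ ∑ i, M * (φ x ^ 2 + pderiv φ i x ^ 2) := by
        refine Finset.sum_le_sum fun i _ => ?_
        have h1 : |w i| ≤ M := (PiLp.norm_apply_le w i).trans hM
        have h2 : 2 * (|φ x| * |pderiv φ i x|) ≤ φ x ^ 2 + pderiv φ i x ^ 2 := by
          rw [← sq_abs (φ x), ← sq_abs (pderiv φ i x)]
          nlinarith [sq_nonneg (|φ x| - |pderiv φ i x|)]
        calc |2 * φ x * (w i * pderiv φ i x)|
            = |w i| * (2 * (|φ x| * |pderiv φ i x|)) := by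
              rw [abs_mul, abs_mul, abs_mul, abs_two]; ring
          _ ≤ M * (φ x ^ 2 + pderiv φ i x ^ 2) := by gcongr
    _ = M * (d * φ x ^ 2 + ∑ i, pderiv φ i x ^ 2) := by
        rw [← Finset.mul_sum, Finset.sum_add_distrib]; simp
    _ ≤ (M * (d + 1)) * h1Density φ x := by
        rw [mul_assoc]
        refine mul_le_mul_of_nonneg_left ?_ hM0
        have h3 : 0 ≤ ∑ i, pderiv φ i x ^ 2 := by positivity
        have h4 : (0 : ℝ) ≤ d := by positivity
        have h5 := mul_nonneg h4 h3
        unfold h1Density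
        nlinarith [sq_nonneg (φ x)]

/-- A one-dimensional trace inequality on the segment from `x` towards `o`. -/
theorem sq_le_lintegral_segment {d : ℕ} {φ : E d → ℝ} (hφ : ContDiff ℝ ∞ φ) (x o : E d) {M : ℝ}
    (hM : ‖o - x‖ ≤ M) :
    ENNReal.ofReal (φ x ^ 2) ≤ ENNReal.ofReal (2 + M * (d + 1)) *
      ∫⁻ θ in Ioc (0 : ℝ) (1 / 2), ENNReal.ofReal (h1Density φ (x + θ • (o - x))) := by
  have hM0 : 0 ≤ M := (norm_nonneg _).trans hM
  set w := o - x
  set l : ℝ → E d := fun θ => x + θ • w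
  have hl : Continuous l := by fun_prop
  have hl' : ∀ θ, HasDerivAt l w θ := fun θ => by
    have h := ((hasDerivAt_id θ).smul_const w).const_add x
    rw [one_smul] at h
    exact h
  set g : ℝ → ℝ := fun θ => φ (l θ) ^ 2
  set g' : ℝ → ℝ := fun θ => 2 * φ (l θ) * fderiv ℝ φ (l θ) w
  have hg : ∀ θ, HasDerivAt g (g' θ) θ := fun θ => by
    have h1 := ((hφ.differentiable (by simp) (l θ)).hasFDerivAt).comp_hasDerivAt θ (hl' θ)
    have h2 := h1.pow 2
    simp only [Nat.cast_ofNat, Nat.add_one_sub_one, pow_one] at h2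
    exact h2
  have hg'c : Continuous g' := by
    have h1 := (hφ.continuous_fderiv (by simp)).comp hl
    have h2 := hφ.continuous.comp hl
    exact (continuous_const.mul h2).mul (h1.clm_apply continuous_const)
  set H : ℝ → ℝ := fun θ => h1Density φ (l θ)
  have hHc : Continuous H := (continuous_h1Density hφ).comp hl
  have hgc : Continuous g := (hφ.continuous.comp hl).pow 2
  have hbd : ∀ θ, |g' θ| ≤ (M * (d + 1)) * H θ := fun θ => two_mul_abs_mul_fderiv_le φ _ _ hM
  have hgH : ∀ θ, g θ ≤ H θ := fun θ => by
    simp only [g, H, h1Density]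
    have : 0 ≤ ∑ i, pderiv φ i (l θ) ^ 2 := by positivity
    linarith
  have hHn : ∀ θ, 0 ≤ H θ := fun θ => h1Density_nonneg _ _
  set I := ∫ θ in (0 : ℝ)..(1 / 2), H θ
  have h1 : ∀ θ ∈ Icc (0 : ℝ) (1 / 2), g 0 ≤ g θ + (M * (d + 1)) * I := by
    intro θ hθ
    have e : ∫ s in (0 : ℝ)..θ, g' s = g θ - g 0 :=
      intervalIntegral.integral_eq_sub_of_hasDerivAt (fun s _ => hg s)
        (hg'c.intervalIntegrable _ _)
    have e2 : |∫ s in (0 : ℝ)..θ, g' s| ≤ ∫ s in (0 : ℝ)..θ, (M * (d + 1)) * H s := by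
      refine (intervalIntegral.abs_integral_le_integral_abs hθ.1).trans ?_
      exact intervalIntegral.integral_mono_on hθ.1 (hg'c.abs.intervalIntegrable _ _)
        ((continuous_const.mul hHc).intervalIntegrable _ _) fun s _ => hbd s
    have e3 : ∫ s in (0 : ℝ)..θ, (M * (d + 1)) * H s
        ≤ ∫ s in (0 : ℝ)..(1 / 2), (M * (d + 1)) * H s :=
      intervalIntegral.integral_mono_interval le_rfl hθ.1 hθ.2
        (Eventually.of_forall fun s => mul_nonneg (by positivity) (hHn s))
        ((continuous_const.mul hHc).intervalIntegrable _ _)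
    rw [intervalIntegral.integral_const_mul (M * (d + 1)) H (a := 0) (b := 1 / 2)] at e3
    rw [e] at e2
    have := (abs_le.1 (e2.trans e3)).1
    linarith
  -- Averaging `h1` over an interval of length `1/2` produces the summand `2` in the final constant.
  have h2 : g 0 * (1 / 2) ≤ (∫ θ in (0 : ℝ)..(1 / 2), g θ) + (M * (d + 1)) * I * (1 / 2) := by
    have := intervalIntegral.integral_mono_on (a := 0) (b := 1 / 2) (by norm_num)
      (continuous_const.intervalIntegrable (μ := volume) _ _)
      ((hgc.add continuous_const).intervalIntegrable _ _) h1
    simp only [Pi.add_apply] at this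
    rw [intervalIntegral.integral_add (hgc.intervalIntegrable _ _)
      (continuous_const.intervalIntegrable _ _), intervalIntegral.integral_const,
      intervalIntegral.integral_const] at this
    simp only [smul_eq_mul] at this
    linarith
  have h3 : ∫ θ in (0 : ℝ)..(1 / 2), g θ ≤ I :=
    intervalIntegral.integral_mono_on (by norm_num) (hgc.intervalIntegrable _ _)
      (hHc.intervalIntegrable _ _) fun s _ => hgH s
  have h4 : φ x ^ 2 ≤ (2 + M * (d + 1)) * I := by
    have : g 0 = φ x ^ 2 := by simp [g, l]
    rw [← this]; linarith
  have h5 : ENNReal.ofReal I = ∫⁻ θ in Ioc (0 : ℝ) (1 / 2), ENNReal.ofReal (H θ) := by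
    simp only [I]
    rw [intervalIntegral.integral_of_le (by norm_num), ofReal_integral_eq_lintegral_ofReal
      ((hHc.integrableOn_Icc).mono_set Ioc_subset_Icc_self)
      (Eventually.of_forall hHn)]
  rw [← h5, ← ENNReal.ofReal_mul (by positivity)]
  exact ENNReal.ofReal_le_ofReal h4

/-- The trace inequality on a face of a bounded convex set which is opposite to a point `o`. -/
theorem exists_face_trace_le {d : ℕ} {S : Set (E d)} (hS : Convex ℝ S) (hSb : Bornology.IsBounded S)
    (hSc : IsClosed S) (f : E d →ᵃ[ℝ] ℝ) {o : E d} (ho : o ∈ S) (hfo : f o ≠ 0) :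
    ∃ C : ℝ≥0∞, C ≠ ⊤ ∧ ∀ φ : E d → ℝ, ContDiff ℝ ∞ φ →
      ∫⁻ x in {x ∈ S | f x = 0}, ENNReal.ofReal (φ x ^ 2)
        ∂(Measure.euclideanHausdorffMeasure (d - 1))
      ≤ C * ∫⁻ x in S, ENNReal.ofReal (h1Density φ x) := by
  rcases eq_empty_or_nonempty {x ∈ S | f x = 0} with hemp | ⟨b, hbS, hb⟩
  · exact ⟨0, by simp, fun φ _ => by rw [hemp]; simp⟩
  set V := LinearMap.ker f.linear
  have hob : f.linear (o - b) = f o := by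
    have := f.linearMap_vsub o b
    simp only [vsub_eq_sub] at this
    rw [this, hb, sub_zero]
  have hV : Module.finrank ℝ V = d - 1 := by
    have h1 : Module.finrank ℝ (LinearMap.range f.linear) + Module.finrank ℝ V
      = Module.finrank ℝ (E d) := f.linear.finrank_range_add_finrank_ker
    have h2 : LinearMap.range f.linear = ⊤ := by
      rw [LinearMap.range_eq_top]
      refine LinearMap.surjective fun h => hfo ?_
      rw [← hob, h]; simp
    rw [h2, finrank_top, Module.finrank_self, finrank_euclideanSpace_fin] at h1
    omega
  -- For `d = 0` the points `o` and `b` would coincide. From here on `d - 1 + 1 = d`, which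
  -- truncated subtraction alone does not give.
  have hd : 1 ≤ d := by
    by_contra h
    have : d = 0 := by omega
    subst this
    exact hfo (by rw [Subsingleton.elim o b]; exact hb)
  let e : V ≃ₗᵢ[ℝ] E (d - 1) := ((stdOrthonormalBasis ℝ V).reindex (finCongr hV)).repr
  let i : E (d - 1) →ₗᵢ[ℝ] E d := V.subtypeₗᵢ.comp e.symm.toLinearIsometry
  have hi : ∀ y, f.linear (i y) = 0 := fun y => (e.symm y).2
  have hi' : ∀ v, f.linear v = 0 → ∃ y, i y = v := fun v hv =>
    ⟨e ⟨v, hv⟩, by simp [i]⟩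
  let ι : E (d - 1) → E d := fun y => b + i y
  have hι : Isometry ι := fun y z => by simp [ι]
  have hιm : MeasurableEmbedding ι := hι.isClosedEmbedding.measurableEmbedding
  -- Coordinates adapted to the face: `y` runs along its hyperplane and `θ` in the transversal
  -- direction `o - b`.
  let Λ₀ : E (d - 1) × ℝ →ₗ[ℝ] E d :=
    i.toLinearMap.coprod (LinearMap.toSpanSingleton ℝ (E d) (o - b))
  have hΛ₀ : ∀ z, Λ₀ z = i z.1 + z.2 • (o - b) := fun z => by simp [Λ₀]
  have hinj : Function.Injective Λ₀ := by
    rw [← LinearMap.ker_eq_bot, LinearMap.ker_eq_bot']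
    intro z hz
    rw [hΛ₀] at hz
    have h1 := congrArg f.linear hz
    rw [map_add, map_smul, hi, hob, zero_add, smul_eq_mul, map_zero] at h1
    have h2 : z.2 = 0 := (mul_eq_zero.1 h1).resolve_right hfo
    rw [h2, zero_smul, add_zero] at hz
    have h3 : z.1 = 0 := i.injective (by rw [hz, map_zero])
    exact Prod.ext h3 h2
  let Λ : (E (d - 1) × ℝ) ≃L[ℝ] E d :=
    (LinearMap.linearEquivOfInjective Λ₀ hinj (by simp; omega)).toContinuousLinearEquiv
  have hΛ : ∀ y θ, Λ (y, θ) = i y + θ • (o - b) := fun y θ => hΛ₀ (y, θ)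
  -- Uniqueness of Haar measure replaces the Jacobian of `Λ`: the pushforward is some finite
  -- multiple `c` of Lebesgue measure.
  let ν : Measure (E d) := ((volume : Measure (E (d - 1))).prod volume).map Λ
  have hν : ν.IsAddHaarMeasure := Λ.isAddHaarMeasure_map _
  have hνc : ν = (ν.addHaarScalarFactor volume) • (volume : Measure (E d)) :=
    Measure.isAddLeftInvariant_eq_smul ν volume
  set c := ν.addHaarScalarFactor volume
  obtain ⟨M, hM⟩ := hSb.subset_closedBall o
  have hM' : ∀ x ∈ S, ‖o - x‖ ≤ M := fun x hx => by
    rw [← dist_eq_norm, dist_comm]; exact hM hx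
  have hM0 : 0 ≤ M := by simpa using hM' o ho
  refine ⟨ENNReal.ofReal (2 + M * (d + 1)) * (2 ^ (d - 1) * c),
    ENNReal.mul_ne_top ENNReal.ofReal_ne_top (ENNReal.mul_ne_top (by simp) ENNReal.coe_ne_top),
    fun φ hφ => ?_⟩
  set F := {x ∈ S | f x = 0}
  have hFr : F ⊆ range ι := by
    rintro x ⟨-, hx⟩
    obtain ⟨y, hy⟩ := hi' (x - b) (by
      have := f.linearMap_vsub x b
      simp only [vsub_eq_sub] at this
      rw [this, hb, hx, sub_zero])
    exact ⟨y, by simp [ι, hy]⟩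
  set H : E d → ℝ≥0∞ := S.indicator fun x => ENNReal.ofReal (h1Density φ x)
  have hHm : Measurable H :=
    (ENNReal.measurable_ofReal.comp (continuous_h1Density hφ).measurable).indicator
      hSc.measurableSet
  set K := ENNReal.ofReal (2 + M * (d + 1))
  have e1 : ∫⁻ x in F, ENNReal.ofReal (φ x ^ 2) ∂(Measure.euclideanHausdorffMeasure (d - 1))
      = ∫⁻ y in ι ⁻¹' F, ENNReal.ofReal (φ (ι y) ^ 2) := by
    have h1 := hι.map_euclideanHausdorffMeasure (d := d - 1)
    rw [EuclideanSpace.euclideanHausdorffMeasure_eq_volume] at h1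
    rw [← Measure.restrict_restrict_of_subset hFr, ← h1, hιm.restrict_map, hιm.lintegral_map]
  have e2 : ∀ y ∈ ι ⁻¹' F, ENNReal.ofReal (φ (ι y) ^ 2)
      ≤ K * ∫⁻ θ in Ioc (0 : ℝ) (1 / 2), H (b + Λ ((1 - θ) • y, θ)) := by
    intro y hy
    refine (sq_le_lintegral_segment hφ (ι y) o (hM' _ hy.1)).trans ?_
    refine mul_le_mul_right (le_of_eq ?_) _
    refine setLIntegral_congr_fun measurableSet_Ioc fun θ hθ => ?_
    -- Moving towards `o` contracts the face coordinate by `1 - θ`.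
    have h1 : ι y + θ • (o - ι y) = b + Λ ((1 - θ) • y, θ) := by
      rw [hΛ, map_smul]
      simp only [ι]
      module
    have h2 : b + Λ ((1 - θ) • y, θ) ∈ S := by
      rw [← h1]
      have := hS.add_smul_sub_mem hy.1 ho (t := θ) ⟨hθ.1.le, by linarith [hθ.2]⟩
      exact this
    simp only [H]
    rw [indicator_of_mem h2, h1]
  -- The segments stop halfway to `o`, so that the contraction factor is at least `1/2` and undoing
  -- it costs at most `2 ^ (d - 1)`.
  have e3 : ∀ θ ∈ Ioc (0 : ℝ) (1 / 2), ∫⁻ y, H (b + Λ ((1 - θ) • y, θ))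
      ≤ 2 ^ (d - 1) * ∫⁻ y, H (b + Λ (y, θ)) := by
    intro θ hθ
    have hr : (1 / 2 : ℝ) ≤ 1 - θ := by linarith [hθ.2]
    have hr0 : (1 - θ) ≠ 0 := by linarith
    have hk : Measurable fun y => H (b + Λ (y, θ)) := by
      refine hHm.comp ?_
      have : Continuous fun y => b + Λ (y, θ) := by fun_prop
      exact this.measurable
    have h1 := lintegral_map (μ := (volume : Measure (E (d - 1)))) hk (measurable_const_smul (1 - θ))
    rw [← h1, Measure.map_addHaar_smul _ hr0, lintegral_smul_measure, finrank_euclideanSpace_fin,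
      smul_eq_mul]
    gcongr
    have h2 : |((1 - θ) ^ (d - 1))⁻¹| ≤ 2 ^ (d - 1) := by
      rw [abs_of_nonneg (by positivity), ← inv_pow]
      gcongr
      rw [inv_le_comm₀ (by linarith) (by norm_num)]
      linarith
    refine (ENNReal.ofReal_le_ofReal h2).trans ?_
    rw [ENNReal.ofReal_pow (by norm_num)]
    simp
  have hm2 : Measurable fun z : E (d - 1) × ℝ => H (b + Λ ((1 - z.2) • z.1, z.2)) := by
    refine hHm.comp ?_
    have : Continuous fun z : E (d - 1) × ℝ => b + Λ ((1 - z.2) • z.1, z.2) := by fun_prop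
    exact this.measurable
  have hm3 : Measurable fun z : E (d - 1) × ℝ => H (b + Λ z) := by
    refine hHm.comp ?_
    have : Continuous fun z : E (d - 1) × ℝ => b + Λ z := by fun_prop
    exact this.measurable
  rw [e1]
  have hmF : MeasurableSet (ι ⁻¹' F) := by
    have h1 : IsClosed F := hSc.inter (isClosed_singleton.preimage f.continuous_of_finiteDimensional)
    exact (h1.preimage hι.continuous).measurableSet
  calc ∫⁻ y in ι ⁻¹' F, ENNReal.ofReal (φ (ι y) ^ 2)
      ≤ ∫⁻ y in ι ⁻¹' F, K * ∫⁻ θ in Ioc (0 : ℝ) (1 / 2), H (b + Λ ((1 - θ) • y, θ)) :=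
        setLIntegral_mono' hmF e2
    _ ≤ ∫⁻ y, K * ∫⁻ θ in Ioc (0 : ℝ) (1 / 2), H (b + Λ ((1 - θ) • y, θ)) :=
        setLIntegral_le_lintegral _ _
    _ = K * ∫⁻ θ in Ioc (0 : ℝ) (1 / 2), ∫⁻ y, H (b + Λ ((1 - θ) • y, θ)) := by
        rw [lintegral_const_mul' _ _ ENNReal.ofReal_ne_top,
          lintegral_lintegral_swap (by exact hm2.aemeasurable)]
    _ ≤ K * ∫⁻ θ in Ioc (0 : ℝ) (1 / 2), 2 ^ (d - 1) * ∫⁻ y, H (b + Λ (y, θ)) := by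
        exact mul_le_mul_right (setLIntegral_mono' measurableSet_Ioc e3) _
    _ ≤ K * ∫⁻ θ : ℝ, 2 ^ (d - 1) * ∫⁻ y, H (b + Λ (y, θ)) := by
        exact mul_le_mul_right (setLIntegral_le_lintegral _ _) _
    _ = K * (2 ^ (d - 1) * ∫⁻ x, H (b + x) ∂ν) := by
        rw [lintegral_const_mul' _ _ (by simp)]
        congr 2
        rw [lintegral_map (by fun_prop) Λ.continuous.measurable]
        exact (lintegral_prod_symm' (fun z => H (b + Λ z)) hm3).symm
    _ = K * (2 ^ (d - 1) * (c * ∫⁻ x, H x)) := by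
        rw [lintegral_add_left_eq_self, hνc, lintegral_smul_measure]
        rfl
    _ = K * (2 ^ (d - 1) * c) * ∫⁻ x in S, ENNReal.ofReal (h1Density φ x) := by
        rw [lintegral_indicator hSc.measurableSet]
        ring

/-- The affine basis formed by the vertices of a full-dimensional simplex. -/
def simplexBasis {d : ℕ} (s : Affine.Simplex ℝ (E d) d) : AffineBasis (Fin (d + 1)) ℝ (E d) :=
  ⟨s.points, s.independent,
    s.independent.affineSpan_eq_top_iff_card_eq_finrank_add_one.2 (by simp)⟩

/-- The trace inequality for smooth functions on a polyhedral domain. -/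
theorem IsPolyhedralDomain.exists_smooth_trace_le {d : ℕ} {Ω : Set (E d)}
    (hΩ : IsPolyhedralDomain Ω) :
    ∃ C : ℝ≥0∞, C ≠ ⊤ ∧ ∀ φ : E d → ℝ, ContDiff ℝ ∞ φ →
      ∫⁻ x, ENNReal.ofReal (φ x ^ 2) ∂(surface Ω)
      ≤ C * ∫⁻ x in Ω, ENNReal.ofReal (h1Density φ x) := by
  obtain ⟨S, hS, hcl⟩ := hΩ.simplices
  have : Finite S := hS
  have : Fintype S := Fintype.ofFinite S
  let hull : S → Set (E d) := fun s => convexHull ℝ (range s.1.points)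
  let A : S × Fin (d + 1) → Set (E d) := fun z =>
    {x ∈ hull z.1 | (simplexBasis z.1.1).coord z.2 x = 0}
  have hhull : ∀ s : S, hull s ⊆ closure Ω := fun s => by
    rw [hcl]; exact subset_biUnion_of_mem (u := fun s : Affine.Simplex ℝ (E d) d =>
      convexHull ℝ (range s.points)) s.2
  -- The interior of a simplex lies in `interior (closure Ω) = Ω`, and the frontier of a convex set
  -- is null.
  have hvol : ∀ s : S, (hull s : Set (E d)) ≤ᵐ[volume] Ω := fun s => by
    have h1 : interior (hull s) ⊆ Ω := by
      rw [← hΩ.interior_closure]; exact interior_mono (hhull s)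
    have h2 : volume (frontier (hull s)) = 0 :=
      (convex_convexHull ℝ _).addHaar_frontier volume
    have h3 : hull s ⊆ interior (hull s) ∪ frontier (hull s) := by
      rw [← closure_eq_interior_union_frontier]; exact subset_closure
    have h4 : ∀ᵐ x, x ∉ frontier (hull s) := measure_eq_zero_iff_ae_notMem.1 h2
    filter_upwards [h4] with x hx hxs
    exact h1 ((h3 hxs).resolve_right hx)
  have hface : ∀ z : S × Fin (d + 1), ∃ C : ℝ≥0∞, C ≠ ⊤ ∧ ∀ φ : E d → ℝ, ContDiff ℝ ∞ φ →
      ∫⁻ x in A z, ENNReal.ofReal (φ x ^ 2) ∂(Measure.euclideanHausdorffMeasure (d - 1))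
      ≤ C * ∫⁻ x in Ω, ENNReal.ofReal (h1Density φ x) := by
    intro z
    have hfin : (range z.1.1.points).Finite := finite_range _
    obtain ⟨C, hC, h⟩ := exists_face_trace_le (convex_convexHull ℝ (range z.1.1.points))
      (hfin.isCompact_convexHull (𝕜 := ℝ)).isBounded
      (hfin.isCompact_convexHull (𝕜 := ℝ)).isClosed
      ((simplexBasis z.1.1).coord z.2) (o := z.1.1.points z.2)
      (subset_convexHull ℝ _ (mem_range_self _))
      (by
        have : (simplexBasis z.1.1).coord z.2 (simplexBasis z.1.1 z.2) = 1 :=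
          (simplexBasis z.1.1).coord_apply_eq z.2
        change (simplexBasis z.1.1).coord z.2 (simplexBasis z.1.1 z.2) ≠ 0
        rw [this]; exact one_ne_zero)
    refine ⟨C, hC, fun φ hφ => (h φ hφ).trans (mul_le_mul_right ?_ _)⟩
    exact lintegral_mono' (Measure.restrict_mono_ae (hvol z.1)) le_rfl
  choose C hC hCφ using hface
  -- The simplices may overlap: every face is charged the integral over the whole of `Ω`, and the
  -- constants add.
  refine ⟨∑ z, C z, ENNReal.sum_ne_top.2 fun z _ => hC z, fun φ hφ => ?_⟩
  -- A boundary point lies in some simplex but not in its interior, which is part of `Ω`; hence one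
  -- of its barycentric coordinates vanishes.
  have hsub : frontier Ω ⊆ ⋃ z, A z := by
    intro x hx
    have hxc : x ∈ closure Ω := frontier_subset_closure hx
    rw [hcl] at hxc
    obtain ⟨s, hs, hxs⟩ := mem_iUnion₂.1 hxc
    have hxi : x ∉ interior (convexHull ℝ (range s.points)) := by
      intro h
      have : x ∈ Ω := by
        rw [← hΩ.interior_closure]; exact interior_mono (hhull ⟨s, hs⟩) h
      rw [hΩ.isOpen.frontier_eq] at hx
      exact hx.2 this
    have h1 : convexHull ℝ (range s.points) = {x | ∀ i, 0 ≤ (simplexBasis s).coord i x} :=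
      (simplexBasis s).convexHull_eq_nonneg_coord
    have h2 : interior (convexHull ℝ (range s.points))
        = {x | ∀ i, 0 < (simplexBasis s).coord i x} := (simplexBasis s).interior_convexHull
    rw [h2, mem_ofPred_eq, not_forall] at hxi
    obtain ⟨i, hi⟩ := hxi
    refine mem_iUnion.2 ⟨(⟨s, hs⟩, i), hxs, ?_⟩
    have h3 := hxs
    rw [h1] at h3
    exact le_antisymm (not_lt.1 hi) (h3 i)
  calc ∫⁻ x, ENNReal.ofReal (φ x ^ 2) ∂(surface Ω)
      ≤ ∫⁻ x in ⋃ z, A z, ENNReal.ofReal (φ x ^ 2)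
          ∂(Measure.euclideanHausdorffMeasure (d - 1)) := lintegral_mono_set hsub
    _ ≤ ∑' z, ∫⁻ x in A z, ENNReal.ofReal (φ x ^ 2)
          ∂(Measure.euclideanHausdorffMeasure (d - 1)) := lintegral_iUnion_le _ _
    _ = ∑ z, ∫⁻ x in A z, ENNReal.ofReal (φ x ^ 2)
          ∂(Measure.euclideanHausdorffMeasure (d - 1)) := tsum_fintype _
    _ ≤ ∑ z, C z * ∫⁻ x in Ω, ENNReal.ofReal (h1Density φ x) :=
        Finset.sum_le_sum fun z _ => hCφ z φ hφ
    _ = (∑ z, C z) * ∫⁻ x in Ω, ENNReal.ofReal (h1Density φ x) := by rw [Finset.sum_mul]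

theorem sq_eLpNorm_two {α : Type*} [MeasurableSpace α] {μ : Measure α} (f : α → ℝ) :
    eLpNorm f 2 μ ^ 2 = ∫⁻ x, ENNReal.ofReal (f x ^ 2) ∂μ := by
  rw [eLpNorm_eq_lintegral_rpow_enorm_toReal (by norm_num) (by norm_num), ← ENNReal.rpow_natCast,
    ← ENNReal.rpow_mul]
  simp only [ENNReal.toReal_ofNat, Nat.cast_ofNat, one_div]
  rw [inv_mul_cancel₀ (by norm_num), ENNReal.rpow_one]
  refine lintegral_congr fun x => ?_
  rw [Real.enorm_eq_ofReal_abs, ENNReal.ofReal_rpow_of_nonneg (abs_nonneg _) (by norm_num)]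
  norm_num

theorem IsPolyhedralDomain.exists_eLpNorm_trace_le {d : ℕ} {Ω : Set (E d)}
    (hΩ : IsPolyhedralDomain Ω) :
    ∃ C : ℝ≥0∞, C ≠ ⊤ ∧ ∀ φ : E d → ℝ, ContDiff ℝ ∞ φ →
      eLpNorm φ 2 (surface Ω) ≤ C * (eLpNorm φ 2 (volume.restrict Ω)
        + ∑ i, eLpNorm (pderiv φ i) 2 (volume.restrict Ω)) := by
  obtain ⟨C, hC, h⟩ := hΩ.exists_smooth_trace_le
  -- The estimate is squared, with factor `C * (d + 1)`; adding `1` makes the square of the constant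
  -- dominate this without taking a root.
  refine ⟨C * (d + 1) + 1, by finiteness, fun φ hφ => ?_⟩
  set W := eLpNorm φ 2 (volume.restrict Ω) + ∑ i, eLpNorm (pderiv φ i) 2 (volume.restrict Ω)
  have hW1 : eLpNorm φ 2 (volume.restrict Ω) ≤ W := le_self_add
  have hW2 : ∀ i, eLpNorm (pderiv φ i) 2 (volume.restrict Ω) ≤ W := fun i =>
    (Finset.single_le_sum (f := fun i => eLpNorm (pderiv φ i) 2 (volume.restrict Ω))
      (fun _ _ => zero_le) (Finset.mem_univ i)).trans le_add_self
  have e1 : ∫⁻ x in Ω, ENNReal.ofReal (h1Density φ x) ≤ (d + 1) * W ^ 2 := by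
    have e2 : ∀ x, ENNReal.ofReal (h1Density φ x)
        = ENNReal.ofReal (φ x ^ 2) + ∑ i, ENNReal.ofReal (pderiv φ i x ^ 2) := fun x => by
      rw [h1Density, ENNReal.ofReal_add (sq_nonneg _) (Finset.sum_nonneg fun i _ => sq_nonneg _),
        ENNReal.ofReal_sum_of_nonneg fun i _ => sq_nonneg _]
    have hm : ∀ i, Measurable fun x => ENNReal.ofReal (pderiv φ i x ^ 2) := fun i =>
      ENNReal.measurable_ofReal.comp ((continuous_pderiv hφ i).pow 2).measurable
    simp only [e2]
    have hm0 : Measurable fun x => ENNReal.ofReal (φ x ^ 2) :=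
      ENNReal.measurable_ofReal.comp (hφ.continuous.pow 2).measurable
    rw [lintegral_add_left hm0,
      lintegral_finsetSum _ fun i _ => hm i]
    simp only [← sq_eLpNorm_two]
    calc _ ≤ W ^ 2 + ∑ i : Fin d, W ^ 2 := by
          gcongr with i
          exact hW2 i
      _ = (d + 1) * W ^ 2 := by
          simp only [Finset.sum_const, Finset.card_univ, Fintype.card_fin, nsmul_eq_mul]; ring
  have e3 : eLpNorm φ 2 (surface Ω) ^ 2 ≤ ((C * (d + 1) + 1) * W) ^ 2 := by
    rw [sq_eLpNorm_two]
    calc _ ≤ C * ((d + 1) * W ^ 2) := (h φ hφ).trans (mul_le_mul_right e1 _)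
      _ = (C * (d + 1)) * W ^ 2 := by ring
      _ ≤ (C * (d + 1) + 1) ^ 2 * W ^ 2 := by
          gcongr
          calc C * (d + 1) ≤ (C * (d + 1) + 1) * 1 := by rw [mul_one]; exact le_self_add
            _ ≤ (C * (d + 1) + 1) * (C * (d + 1) + 1) := by gcongr; exact le_add_self
            _ = _ := by ring
      _ = _ := by ring
  exact (ENNReal.pow_le_pow_left_iff two_ne_zero).1 e3

theorem norm_toL2_le {d : ℕ} {Ω : Set (E d)} (u : H1 Ω) : ‖toL2 u‖ ≤ ‖u‖ :=
  WithLp.norm_fst_le (p := 2) (x := u.1)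

theorem norm_wpart_le {d : ℕ} {Ω : Set (E d)} (i : Fin d) (u : H1 Ω) : ‖wpart i u‖ ≤ ‖u‖ :=
  (PiLp.norm_apply_le u.1.snd i).trans (WithLp.norm_snd_le (p := 2) (x := u.1))

/-- The trace inequality in `H¹(Ω)`. -/
theorem IsPolyhedralDomain.exists_norm_trace_le {d : ℕ} {Ω : Set (E d)}
    (hΩ : IsPolyhedralDomain Ω) :
    ∃ C : ℝ, 0 < C ∧ ∀ u : H1 Ω, ‖trace u‖ ≤ C * ‖u‖ := by
  obtain ⟨C, hC, h⟩ := hΩ.exists_eLpNorm_trace_le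
  have key : ∀ (u : H1 Ω) (g : L2bd Ω), IsTrace u g →
      ‖g‖ₑ ≤ C * (‖toL2 u‖ₑ + ∑ i, ‖wpart i u‖ₑ) := by
    rintro u g ⟨φ, hφ, h0, h1, h2⟩
    set a := fun n => eLpNorm (fun x => φ n x - toL2 u x) 2 (volume.restrict Ω)
    set b := fun i n => eLpNorm (fun x => pderiv (φ n) i x - wpart i u x) 2 (volume.restrict Ω)
    set c := fun n => eLpNorm (fun x => φ n x - g x) 2 (surface Ω)
    have hlim : Tendsto (fun n => c n + C * ((a n + ‖toL2 u‖ₑ) + ∑ i, (b i n + ‖wpart i u‖ₑ)))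
        atTop (𝓝 (0 + C * ((0 + ‖toL2 u‖ₑ) + ∑ i, (0 + ‖wpart i u‖ₑ)))) := by
      refine h2.add (ENNReal.Tendsto.const_mul ((h0.add tendsto_const_nhds).add ?_) (Or.inr hC))
      exact tendsto_finsetSum _ fun i _ => (h1 i).add tendsto_const_nhds
    simp only [zero_add] at hlim
    refine ge_of_tendsto' hlim fun n => ?_
    have hs := (hφ n).continuous.aestronglyMeasurable (μ := surface Ω)
    have hs' := (hφ n).continuous.aestronglyMeasurable (μ := volume.restrict Ω)
    have e1 : ‖g‖ₑ ≤ c n + eLpNorm (φ n) 2 (surface Ω) := by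
      rw [Lp.enorm_def]
      have : (g : E d → ℝ) = fun x => φ n x - (φ n x - g x) := by funext x; ring
      rw [this, add_comm]
      exact eLpNorm_sub_le hs (hs.sub (Lp.aestronglyMeasurable g)) (by norm_num)
    have e2 : eLpNorm (φ n) 2 (volume.restrict Ω) ≤ a n + ‖toL2 u‖ₑ := by
      rw [Lp.enorm_def]
      have : φ n = (fun x => φ n x - toL2 u x) + toL2 u := by funext x; simp
      conv_lhs => rw [this]
      exact eLpNorm_add_le (hs'.sub (Lp.aestronglyMeasurable _)) (Lp.aestronglyMeasurable _)
        (by norm_num)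
    have e3 : ∀ i, eLpNorm (pderiv (φ n) i) 2 (volume.restrict Ω) ≤ b i n + ‖wpart i u‖ₑ := by
      intro i
      rw [Lp.enorm_def]
      have : pderiv (φ n) i = (fun x => pderiv (φ n) i x - wpart i u x) + wpart i u := by
        funext x; simp
      conv_lhs => rw [this]
      exact eLpNorm_add_le ((continuous_pderiv (hφ n) i).aestronglyMeasurable.sub
        (Lp.aestronglyMeasurable _)) (Lp.aestronglyMeasurable _) (by norm_num)
    refine e1.trans (add_le_add_right ((h _ (hφ n)).trans (mul_le_mul_right ?_ _)) _)
    exact add_le_add e2 (Finset.sum_le_sum fun i _ => e3 i)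
  refine ⟨C.toReal * (d + 1) + 1, by positivity, fun u => ?_⟩
  unfold trace
  split_ifs with hu
  · have h1 := key u _ hu.choose_spec
    have hfin : ∑ i, ‖wpart i u‖ₑ ≠ ⊤ := ENNReal.sum_ne_top.2 fun i _ => enorm_ne_top
    have h2 := ENNReal.toReal_mono
      (ENNReal.mul_ne_top hC (ENNReal.add_ne_top.2 ⟨enorm_ne_top, hfin⟩)) h1
    rw [toReal_enorm, ENNReal.toReal_mul, ENNReal.toReal_add enorm_ne_top hfin,
      ENNReal.toReal_sum fun i _ => enorm_ne_top] at h2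
    simp only [toReal_enorm] at h2
    have h3 : ‖toL2 u‖ + ∑ i, ‖wpart i u‖ ≤ (d + 1) * ‖u‖ := by
      calc _ ≤ ‖u‖ + ∑ i : Fin d, ‖u‖ :=
            add_le_add (norm_toL2_le u) (Finset.sum_le_sum fun i _ => norm_wpart_le i u)
        _ = _ := by simp; ring
    calc _ ≤ C.toReal * ((d + 1) * ‖u‖) := h2.trans (by gcongr)
      _ ≤ (C.toReal * (d + 1) + 1) * ‖u‖ := by nlinarith [norm_nonneg u]
  -- When no trace exists, `trace u` is the default value `0`.
  · simp only [norm_zero]; positivity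

theorem abs_bdPair_le {d : ℕ} {Ω : Set (E d)} {C : ℝ} (hC : ∀ u : H1 Ω, ‖trace u‖ ≤ C * ‖u‖)
    (f : L2bd Ω) (u : H1 Ω) : |bdPair f u| ≤ (C * ‖f‖) * ‖u‖ := by
  refine (abs_real_inner_le_norm _ _).trans ?_
  calc ‖f‖ * ‖trace u‖ ≤ ‖f‖ * (C * ‖u‖) := by gcongr; exact hC u
    _ = _ := by ring

/-! ### Sobolev spaces -/

theorem integral_mul_eq_inner {d : ℕ} {Ω : Set (E d)} {f : E d → ℝ}
    (hf : MemLp f 2 (volume.restrict Ω)) (u : L2 Ω) :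
    ∫ x in Ω, u x * f x = inner ℝ (hf.toLp f) u := by
  rw [L2.inner_def]
  refine integral_congr_ae ?_
  filter_upwards [hf.coeFn_toLp] with x hx
  rw [hx]; rfl

theorem IsTest.memLp {d : ℕ} {U Ω : Set (E d)} {φ : E d → ℝ} (h : IsTest U φ) :
    MemLp φ 2 (volume.restrict Ω) :=
  h.smooth.continuous.memLp_of_hasCompactSupport h.compact

theorem IsTest.pderiv {d : ℕ} {U : Set (E d)} {φ : E d → ℝ} (h : IsTest U φ) (i : Fin d) :
    IsTest U (pderiv φ i) := by
  refine ⟨?_, h.compact.fderiv_apply ℝ _, ?_⟩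
  · exact (h.smooth.fderiv_right (m := ∞) (by simp)).clm_apply contDiff_const
  · refine (closure_minimal (fun x hx => ?_) (isClosed_tsupport _)).trans h.supp
    refine support_fderiv_subset ℝ (f := φ) ?_
    rw [Function.mem_support] at hx ⊢
    intro h0
    exact hx (by simp [Biot.pderiv, h0])

/-- Each weak-derivative condition equates two continuous functionals of the pair. Completeness
follows, as the Riesz representatives in `exists_weaklyContinuous` require. -/
theorem isClosed_H1 {d : ℕ} (Ω : Set (E d)) :
    IsClosed (H1 Ω : Set (WithLp 2 (L2 Ω × L2vec Ω))) := by
  have : (H1 Ω : Set (WithLp 2 (L2 Ω × L2vec Ω))) = ⋂ (i : Fin d) (φ : E d → ℝ) (h : IsTest Ω φ),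
      {w | inner ℝ ((h.pderiv i).memLp.toLp _ : L2 Ω) w.fst
        = - inner ℝ (h.memLp.toLp _ : L2 Ω) (w.snd i)} := by
    ext w
    simp only [mem_iInter, mem_ofPred_eq, ← integral_mul_eq_inner]
    rfl
  rw [this]
  refine isClosed_iInter fun i => isClosed_iInter fun φ => isClosed_iInter fun h => ?_
  refine isClosed_eq (by fun_prop) ?_
  have h1 : Continuous fun w : WithLp 2 (L2 Ω × L2vec Ω) => w.snd i :=
    ((PiLp.proj 2 (𝕜 := ℝ) (fun _ : Fin d => L2 Ω) i).comp
      (WithLp.sndL 2 ℝ (L2 Ω) (L2vec Ω))).continuous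
  fun_prop

instance completeSpace_H1 {d : ℕ} (Ω : Set (E d)) : CompleteSpace (H1 Ω) :=
  (isClosed_H1 Ω).completeSpace_coe

/-- The weak partial derivative as a bounded operator. -/
def wpartL {d : ℕ} (Ω : Set (E d)) (i : Fin d) : H1 Ω →L[ℝ] L2 Ω :=
  ((PiLp.proj 2 (𝕜 := ℝ) (fun _ : Fin d => L2 Ω) i).comp
    (WithLp.sndL 2 ℝ (L2 Ω) (L2vec Ω))).comp (H1 Ω).subtypeL

/-- The components of a vector field as a bounded operator. -/
def compL {d : ℕ} (Ω : Set (E d)) (i : Fin d) : H1vec Ω →L[ℝ] H1 Ω :=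
  PiLp.proj 2 (𝕜 := ℝ) (fun _ : Fin d => H1 Ω) i

/-- The divergence as a bounded operator. -/
def divL {d : ℕ} (Ω : Set (E d)) : H1vec Ω →L[ℝ] L2 Ω :=
  ∑ i, (wpartL Ω i).comp (compL Ω i)

/-- The entries of the strain tensor as bounded operators. -/
def strainL {d : ℕ} (Ω : Set (E d)) (i j : Fin d) : H1vec Ω →L[ℝ] L2 Ω :=
  (1 / 2 : ℝ) • ((wpartL Ω i).comp (compL Ω j) + (wpartL Ω j).comp (compL Ω i))

theorem toL2L_apply {d : ℕ} {Ω : Set (E d)} (u : H1 Ω) : toL2L Ω u = toL2 u := rfl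

theorem wpartL_apply {d : ℕ} {Ω : Set (E d)} (i : Fin d) (u : H1 Ω) :
    wpartL Ω i u = wpart i u := rfl

theorem divL_apply {d : ℕ} {Ω : Set (E d)} (v : H1vec Ω) : divL Ω v = divg v := by
  simp [divL, divg, wpartL_apply, compL]

theorem strainL_apply {d : ℕ} {Ω : Set (E d)} (i j : Fin d) (v : H1vec Ω) :
    strainL Ω i j v = strain v i j := rfl

theorem isWeakPartial_wpart {d : ℕ} {Ω : Set (E d)} (i : Fin d) (u : H1 Ω) :
    IsWeakPartial Ω i (toL2 u) (wpart i u) := u.2 i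

theorem L2_eq_zero_of_forall_test {d : ℕ} {Ω : Set (E d)} (hΩ : IsOpen Ω) (f : L2 Ω)
    (h : ∀ φ : E d → ℝ, IsTest Ω φ → ∫ x in Ω, f x * φ x = 0) : f = 0 := by
  have hloc : LocallyIntegrableOn f Ω volume := by
    intro x hx
    obtain ⟨r, hr, hball⟩ := Metric.isOpen_iff.1 hΩ x hx
    refine ⟨Metric.ball x r ∩ Ω, inter_comm Ω _ ▸
      inter_mem_nhdsWithin _ (Metric.ball_mem_nhds x hr), ?_⟩
    have h1 : MemLp f 2 (volume.restrict (Metric.ball x r ∩ Ω)) :=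
      (Lp.memLp f).mono_measure (Measure.restrict_mono inter_subset_right le_rfl)
    have : IsFiniteMeasure (volume.restrict (Metric.ball x r ∩ Ω)) :=
      isFiniteMeasure_restrict.2 (measure_ne_top_of_subset inter_subset_left
        measure_ball_lt_top.ne)
    exact h1.integrable (by norm_num)
  have h1 := hΩ.ae_eq_zero_of_integral_contDiff_smul_eq_zero hloc fun g hg1 hg2 hg3 => by
    rw [← h g ⟨hg1, hg2, hg3⟩, setIntegral_eq_integral_of_forall_compl_eq_zero]
    · simp only [smul_eq_mul, mul_comm]
    · intro x hx
      rw [image_eq_zero_of_notMem_tsupport fun hc => hx (hg3 hc), mul_zero]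
  refine Lp.ext ?_
  filter_upwards [(ae_restrict_iff' hΩ.measurableSet).2 h1, Lp.coeFn_zero ℝ 2 (volume.restrict Ω)]
    with x hx h0
  rw [hx, h0]; rfl

/-- The weak gradient is determined by the function, so the first component of the pair controls the
second. -/
theorem H1_eq_zero {d : ℕ} {Ω : Set (E d)} (hΩ : IsOpen Ω) (u : H1 Ω) (h : toL2 u = 0) :
    u = 0 := by
  have h1 : ∀ i, wpart i u = 0 := fun i => by
    refine L2_eq_zero_of_forall_test hΩ _ fun φ hφ => ?_
    have := isWeakPartial_wpart i u φ hφ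
    rw [h, integral_mul_eq_inner (hφ.pderiv i).memLp, inner_zero_right] at this
    linarith
  refine Subtype.ext (WithLp.ofLp_injective 2 (Prod.ext h ?_))
  exact PiLp.ext h1

theorem integral_mul_pderiv {d : ℕ} {f φ : E d → ℝ} (hf : ContDiff ℝ ∞ f) (hφ : ContDiff ℝ ∞ φ)
    (hc : HasCompactSupport φ) (i : Fin d) :
    ∫ x, f x * pderiv φ i x = - ∫ x, pderiv f i x * φ x := by
  refine integral_mul_fderiv_eq_neg_fderiv_mul_of_integrable ?_ ?_ ?_
    (fun x _ => hf.differentiable (by simp) x) (fun x _ => hφ.differentiable (by simp) x)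
  · exact ((continuous_pderiv hf i).mul hφ.continuous).integrable_of_hasCompactSupport hc.mul_left
  · exact (hf.continuous.mul (continuous_pderiv hφ i)).integrable_of_hasCompactSupport
      (hc.fderiv_apply ℝ _).mul_left
  · exact (hf.continuous.mul hφ.continuous).integrable_of_hasCompactSupport hc.mul_left

theorem memLp_of_continuous {d : ℕ} {Ω : Set (E d)} (hb : Bornology.IsBounded Ω) {f : E d → ℝ}
    (hf : Continuous f) (p : ℝ≥0∞) : MemLp f p (volume.restrict Ω) := by
  have hK : IsCompact (closure Ω) := hb.isCompact_closure
  obtain ⟨C, hC⟩ := hK.exists_bound_of_continuousOn hf.continuousOn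
  have : IsFiniteMeasure (volume.restrict Ω) :=
    isFiniteMeasure_restrict.2 (measure_ne_top_of_subset subset_closure hK.measure_lt_top.ne)
  refine MemLp.of_bound hf.aestronglyMeasurable C ?_
  refine ae_restrict_of_ae_restrict_of_subset subset_closure ?_
  exact (ae_restrict_mem isClosed_closure.measurableSet).mono fun x hx => hC x hx

/-- The restriction of a smooth function to a bounded open set, as an element of `H¹`. -/
def ofSmooth {d : ℕ} {Ω : Set (E d)} (hb : Bornology.IsBounded Ω) {f : E d → ℝ}
    (hf : ContDiff ℝ ∞ f) : H1 Ω :=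
  ⟨WithLp.toLp 2 ((memLp_of_continuous hb hf.continuous 2).toLp f, WithLp.toLp 2 fun i =>
    (memLp_of_continuous hb (continuous_pderiv hf i) 2).toLp (pderiv f i)), by
    intro i φ hφ
    have hz : ∀ x ∉ Ω, φ x = 0 := fun x hx =>
      image_eq_zero_of_notMem_tsupport fun hc => hx (hφ.supp hc)
    have hz' : ∀ x ∉ Ω, pderiv φ i x = 0 := fun x hx =>
      image_eq_zero_of_notMem_tsupport fun hc => hx ((hφ.pderiv i).supp hc)
    have key : ∀ {g ψ : E d → ℝ} (hg : MemLp g 2 (volume.restrict Ω)), (∀ x ∉ Ω, ψ x = 0) →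
        ∫ x in Ω, (hg.toLp g : L2 Ω) x * ψ x = ∫ x, g x * ψ x := by
      intro g ψ hg hψ
      refine Eq.trans ?_ (setIntegral_eq_integral_of_forall_compl_eq_zero (s := Ω)
        (fun x hx => by rw [hψ x hx, mul_zero]))
      refine integral_congr_ae ?_
      filter_upwards [hg.coeFn_toLp] with x hx
      rw [hx]
    exact (key (memLp_of_continuous hb hf.continuous 2) hz').trans ((integral_mul_pderiv hf hφ.smooth hφ.compact i).trans
      (congrArg Neg.neg (key (memLp_of_continuous hb (continuous_pderiv hf i) 2) hz).symm))⟩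

theorem toL2_ofSmooth {d : ℕ} {Ω : Set (E d)} (hb : Bornology.IsBounded Ω) {f : E d → ℝ}
    (hf : ContDiff ℝ ∞ f) :
    toL2 (ofSmooth hb hf) = (memLp_of_continuous hb hf.continuous 2).toLp f := rfl

theorem wpart_ofSmooth {d : ℕ} {Ω : Set (E d)} (hb : Bornology.IsBounded Ω) {f : E d → ℝ}
    (hf : ContDiff ℝ ∞ f) (i : Fin d) :
    wpart i (ofSmooth hb hf)
      = (memLp_of_continuous hb (continuous_pderiv hf i) 2).toLp (pderiv f i) := rfl

theorem L2_eq_zero_of_forall_H1 {d : ℕ} {Ω : Set (E d)} (hΩ : IsOpen Ω)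
    (hb : Bornology.IsBounded Ω) (f : L2 Ω) (h : ∀ ψ : H1 Ω, inner ℝ f (toL2 ψ) = 0) : f = 0 := by
  refine L2_eq_zero_of_forall_test hΩ f fun φ hφ => ?_
  have := h (ofSmooth hb hφ.smooth)
  rw [toL2_ofSmooth, real_inner_comm, ← integral_mul_eq_inner] at this
  exact this

/-! ### Functions with vanishing weak gradient. -/

/-- Mollifications of `u` have zero gradient on the ball, so they are constant there, and they
converge to `u` almost everywhere. -/
theorem exists_const_on_ball {d : ℕ} {Ω : Set (E d)} (u : L2 Ω) (hΩ : IsOpen Ω)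
    (h : ∀ i, IsWeakPartial Ω i u 0) {x₀ : E d} (hx₀ : x₀ ∈ Ω) :
    ∃ c : ℝ, ∃ r > 0, Metric.ball x₀ r ⊆ Ω ∧ ∀ᵐ x, x ∈ Metric.ball x₀ r → u x = c := by
  obtain ⟨R, hR, hball⟩ := Metric.isOpen_iff.1 hΩ x₀ hx₀
  set r := R / 2
  have hr : 0 < r := half_pos hR
  have hsub : Metric.ball x₀ r ⊆ Ω :=
    (Metric.ball_subset_ball (half_le_self hR.le)).trans hball
  set U : E d → ℝ := Ω.indicator u
  have hU : LocallyIntegrable U volume := by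
    have h1 : MemLp U 2 volume := (memLp_indicator_iff_restrict hΩ.measurableSet).2 (Lp.memLp u)
    exact h1.locallyIntegrable (by norm_num)
  -- Outer radii stay below `r = R / 2`, so a kernel centred in the ball of radius `r` is supported
  -- in `Ω`. The fixed ratio `2` of outer to inner radius is what almost everywhere convergence
  -- requires.
  let ρ : ℕ → ContDiffBump (0 : E d) := fun n =>
    ⟨r / 4 / (n + 1), r / 2 / (n + 1), by positivity, by gcongr; norm_num⟩
  have hρr : ∀ n, (ρ n).rOut < r := fun n => by
    change r / 2 / (n + 1) < r
    rw [div_lt_iff₀ (by positivity)]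
    nlinarith [(Nat.cast_nonneg n : (0 : ℝ) ≤ n)]
  have hlim := ContDiffBump.ae_convolution_tendsto_right_of_locallyIntegrable
    (φ := ρ) (l := atTop) (K := 2) (g := U) (μ := volume)
    (tendsto_const_nhds.div_atTop (tendsto_natCast_atTop_atTop.atTop_add tendsto_const_nhds))
    (Eventually.of_forall fun n => by
      change r / 2 / (n + 1) ≤ 2 * (r / 4 / (n + 1))
      refine le_of_eq ?_; ring) hU
  have hderiv : ∀ n, ∀ x ∈ Metric.ball x₀ r,
      HasFDerivAt (convolution ((ρ n).normed volume) U (ContinuousLinearMap.lsmul ℝ ℝ) volume)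
        (0 : E d →L[ℝ] ℝ) x := by
    intro n x hx
    set η := (ρ n).normed volume
    have hηs : ContDiff ℝ ∞ η := (ρ n).contDiff_normed
    have hηc : HasCompactSupport η := (ρ n).hasCompactSupport_normed
    have h1 := hηc.hasFDerivAt_convolution_left (ContinuousLinearMap.lsmul ℝ ℝ)
      (hηs.of_le (by simp)) hU x
    have hex := (hηc.fderiv ℝ).convolutionExists_left
      ((ContinuousLinearMap.lsmul ℝ ℝ).precompL (E d)) (hηs.continuous_fderiv (by simp)) hU x
    have h2 : convolution (fderiv ℝ η) U ((ContinuousLinearMap.lsmul ℝ ℝ).precompL (E d))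
        volume x = 0 := by
      -- A partial derivative of the mollification at `x` is, up to sign, the weak-derivative
      -- identity for `u` tested with `y ↦ η (x - y)`.
      have hbasis : ∀ i : Fin d, convolution (fderiv ℝ η) U
          ((ContinuousLinearMap.lsmul ℝ ℝ).precompL (E d)) volume x
            (EuclideanSpace.single i 1) = 0 := by
        intro i
        rw [convolution_def, ContinuousLinearMap.integral_apply hex]
        simp only [ContinuousLinearMap.precompL_apply, ContinuousLinearMap.lsmul_apply, smul_eq_mul]
        set ψ : E d → ℝ := fun y => η (x - y)
        have hψt : IsTest Ω ψ := by
          have hψsupp : tsupport ψ ⊆ Metric.closedBall x (ρ n).rOut := by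
            refine closure_minimal (fun y hy => ?_) Metric.isClosed_closedBall
            have h3 : x - y ∈ Function.support η := hy
            rw [(ρ n).support_normed_eq] at h3
            rw [Metric.mem_closedBall, dist_comm, dist_eq_norm]
            exact (mem_ball_zero_iff.1 h3).le
          refine ⟨hηs.comp (contDiff_const.sub contDiff_id), ?_, hψsupp.trans ?_⟩
          · exact (isCompact_closedBall x _).of_isClosed_subset (isClosed_tsupport _) hψsupp
          · refine (fun y hy => hball ?_)
            have h4 := Metric.mem_closedBall.1 hy
            have h5 := Metric.mem_ball.1 hx
            have h6 := hρr n
            rw [Metric.mem_ball]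
            calc dist y x₀ ≤ dist y x + dist x x₀ := dist_triangle _ _ _
              _ < r + r := by linarith
              _ = R := by simp [r]
        have hψd : ∀ y, pderiv ψ i y = - fderiv ℝ η (x - y) (EuclideanSpace.single i 1) := by
          intro y
          have h3 : HasFDerivAt ψ ((fderiv ℝ η (x - y)).comp
              (-ContinuousLinearMap.id ℝ (E d))) y :=
            (hηs.differentiable (by simp) (x - y)).hasFDerivAt.comp y
              ((hasFDerivAt_id y).const_sub x)
          simp [pderiv, h3.fderiv]
        have h7 := integral_sub_left_eq_self (μ := (volume : Measure (E d)))
          (fun t => fderiv ℝ η t (EuclideanSpace.single i 1) * U (x - t)) x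
        rw [← h7]
        simp only [sub_sub_cancel]
        have h8 := h i ψ hψt
        have h9 : ∫ y in Ω, (0 : L2 Ω) y * ψ y = 0 := by
          rw [integral_mul_eq_inner hψt.memLp, inner_zero_right]
        rw [h9, neg_zero] at h8
        have h10 : ∫ y, fderiv ℝ η (x - y) (EuclideanSpace.single i 1) * U y
            = - ∫ y in Ω, u y * pderiv ψ i y := by
          rw [← integral_neg, ← setIntegral_eq_integral_of_forall_compl_eq_zero (s := Ω)]
          · refine setIntegral_congr_fun hΩ.measurableSet fun y hy => ?_
            simp only [U, indicator_of_mem hy, hψd]; ring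
          · intro y hy
            simp only [U, indicator_of_notMem hy, mul_zero]
        rw [h10, h8, neg_zero]
      ext w
      have hw : w = ∑ i, w i • EuclideanSpace.single i (1 : ℝ) := by
        simpa using ((EuclideanSpace.basisFun (Fin d) ℝ).sum_repr w).symm
      rw [hw, map_sum]
      simp only [map_smul, hbasis, smul_zero, Finset.sum_const_zero, zero_apply]
    rwa [h2] at h1
  have hconst : ∀ n, ∀ x ∈ Metric.ball x₀ r, ∀ y ∈ Metric.ball x₀ r,
      convolution ((ρ n).normed volume) U (ContinuousLinearMap.lsmul ℝ ℝ) volume x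
      = convolution ((ρ n).normed volume) U (ContinuousLinearMap.lsmul ℝ ℝ) volume y :=
    fun n x hx y hy => Metric.isOpen_ball.is_const_of_fderiv_eq_zero (𝕜 := ℝ)
      (convex_ball x₀ r).isPreconnected
      (fun z hz => (hderiv n z hz).differentiableAt.differentiableWithinAt)
      (fun z hz => (hderiv n z hz).fderiv) hx hy
  obtain ⟨y, hyb, hy⟩ : ∃ y ∈ Metric.ball x₀ r, Tendsto (fun n =>
      convolution ((ρ n).normed volume) U (ContinuousLinearMap.lsmul ℝ ℝ) volume y) atTop
      (𝓝 (U y)) := by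
    have hd := Measure.dense_of_ae hlim
    obtain ⟨y, hy1, hy2⟩ := hd.inter_open_nonempty _ Metric.isOpen_ball
      ⟨x₀, Metric.mem_ball_self hr⟩
    exact ⟨y, hy1, hy2⟩
  refine ⟨U y, r, hr, hsub, ?_⟩
  filter_upwards [hlim] with x hx hxb
  have h1 : U x = u x := indicator_of_mem (hsub hxb) _
  rw [← h1]
  refine tendsto_nhds_unique hx (hy.congr fun n => hconst n _ hyb _ hxb)

/-- On a connected open set, a function with vanishing weak gradient is constant. -/
theorem exists_ae_eq_const_of_weakPartial_zero {d : ℕ} {Ω : Set (E d)} (hΩ : IsOpen Ω)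
    (hc : IsConnected Ω) (u : L2 Ω) (h : ∀ i, IsWeakPartial Ω i u 0) :
    ∃ c : ℝ, ∀ᵐ x ∂(volume.restrict Ω), u x = c := by
  choose! c r hr hsub hae using fun x (hx : x ∈ Ω) => exists_const_on_ball u hΩ h hx
  -- Overlapping balls share a point where `u` takes both constants, so the local constants form a
  -- locally constant function on the connected set `Ω`.
  have heq : ∀ x ∈ Ω, ∀ y ∈ Ω, y ∈ Metric.ball x (r x) → c y = c x := by
    intro x hx y hy hyx
    have hne : (Metric.ball x (r x) ∩ Metric.ball y (r y)).Nonempty :=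
      ⟨y, hyx, Metric.mem_ball_self (hr y hy)⟩
    have hd := Measure.dense_of_ae ((hae x hx).and (hae y hy))
    obtain ⟨z, hz, hz1, hz2⟩ := hd.inter_open_nonempty _
      (Metric.isOpen_ball.inter Metric.isOpen_ball) hne
    rw [← hz1 hz.1, ← hz2 hz.2]
  have hloc : IsLocallyConstant fun x : Ω => c x := by
    rw [IsLocallyConstant.iff_eventually_eq]
    intro x
    have : ∀ᶠ y : Ω in 𝓝 x, (y : E d) ∈ Metric.ball (x : E d) (r x) :=
      continuous_subtype_val.continuousAt.eventually
        (Metric.ball_mem_nhds _ (hr x x.2))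
    filter_upwards [this] with y hy using heq x x.2 y y.2 hy
  obtain ⟨x₀, hx₀⟩ := hc.nonempty
  have : PreconnectedSpace Ω := isPreconnected_iff_preconnectedSpace.1 hc.isPreconnected
  have hall : ∀ x ∈ Ω, c x = c x₀ := fun x hx =>
    hloc.apply_eq_of_preconnectedSpace ⟨x, hx⟩ ⟨x₀, hx₀⟩
  refine ⟨c x₀, ?_⟩
  rw [ae_restrict_iff' hΩ.measurableSet]
  have hnull : volume {x | x ∈ Ω ∧ u x ≠ c x₀} = 0 := by
    refine measure_null_of_locally_null _ fun x hx => ?_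
    refine ⟨Metric.ball x (r x) ∩ {x | x ∈ Ω ∧ u x ≠ c x₀}, inter_comm _ _ ▸
      inter_mem_nhdsWithin _ (Metric.ball_mem_nhds x (hr x hx.1)), ?_⟩
    refine measure_mono_null ?_ (ae_iff.1 (hae x hx.1))
    rintro y ⟨hy1, -, hy2⟩
    simp only [mem_ofPred_eq, Classical.not_imp]
    exact ⟨hy1, by rw [hall x hx.1]; exact hy2⟩
  rw [ae_iff]
  convert hnull using 2
  ext x
  simp only [mem_ofPred_eq, Classical.not_imp, ne_eq]

/-! ### Rigid motions and the range of the divergence -/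

theorem IsPolyhedralDomain.isBounded {d : ℕ} {Ω : Set (E d)} (hΩ : IsPolyhedralDomain Ω) :
    Bornology.IsBounded Ω := by
  obtain ⟨S, hS, hcl⟩ := hΩ.simplices
  refine Bornology.IsBounded.subset ?_ subset_closure
  rw [hcl]
  refine (Bornology.isBounded_biUnion hS).2 fun s _ => ?_
  exact ((finite_range s.points).isCompact_convexHull (𝕜 := ℝ)).isBounded

theorem pderiv_pderiv_comm {d : ℕ} {φ : E d → ℝ} (hφ : ContDiff ℝ ∞ φ) (i j : Fin d) :
    pderiv (pderiv φ i) j = pderiv (pderiv φ j) i := by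
  have hd : Differentiable ℝ (fderiv ℝ φ) :=
    (hφ.fderiv_right (m := ∞) (by simp)).differentiable (by simp)
  have key : ∀ (i j : Fin d) x, pderiv (pderiv φ i) j x
      = fderiv ℝ (fderiv ℝ φ) x (EuclideanSpace.single j 1) (EuclideanSpace.single i 1) := by
    intro i j x
    have h1 : HasFDerivAt (pderiv φ i) ((ContinuousLinearMap.apply ℝ ℝ
        (EuclideanSpace.single i (1 : ℝ))).comp (fderiv ℝ (fderiv ℝ φ) x)) x :=
      (ContinuousLinearMap.apply ℝ ℝ (EuclideanSpace.single i (1 : ℝ))).hasFDerivAt.comp x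
        (hd x).hasFDerivAt
    rw [pderiv, h1.fderiv]; rfl
  funext x
  rw [key, key]
  exact ((contDiff_infty.1 hφ 2).contDiffAt.isSymmSndFDerivAt (by simp)) _ _

/-- The integral `T i j k` of `∂_j v_k ∂_i φ` is symmetric in `i, j`, since weak derivatives
commute, and skew in `j, k`, since the strain vanishes. An array with both properties is zero. -/
theorem isWeakPartial_wpart_zero_of_strain {d : ℕ} {Ω : Set (E d)} {v : H1vec Ω}
    (h : ∀ i j, strain v i j = 0) (i j k : Fin d) : IsWeakPartial Ω i (wpart j (v k)) 0 := by
  intro φ hφ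
  have hz : ∫ x in Ω, (0 : L2 Ω) x * φ x = 0 := by
    rw [integral_mul_eq_inner hφ.memLp, inner_zero_right]
  rw [hz, neg_zero]
  have hskew : ∀ j k, wpart j (v k) = - wpart k (v j) := fun j k => by
    have := h j k
    rw [strain, smul_eq_zero] at this
    exact eq_neg_of_add_eq_zero_left (this.resolve_left (by norm_num))
  set T : Fin d → Fin d → Fin d → ℝ := fun i j k => ∫ x in Ω, wpart j (v k) x * pderiv φ i x
  have h1 : ∀ i j k, T i j k = T j i k := fun i j k => by
    simp only [T]
    have e1 := isWeakPartial_wpart j (v k) _ (hφ.pderiv i)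
    have e2 := isWeakPartial_wpart i (v k) _ (hφ.pderiv j)
    rw [pderiv_pderiv_comm hφ.smooth] at e1
    rw [e1] at e2
    exact neg_injective e2
  have h2 : ∀ i j k, T i j k = - T i k j := fun i j k => by
    simp only [T]
    rw [integral_mul_eq_inner (hφ.pderiv i).memLp, integral_mul_eq_inner (hφ.pderiv i).memLp,
      hskew, inner_neg_right]
  change T i j k = 0
  have : T i j k = - T i j k := by
    calc T i j k = - T i k j := h2 _ _ _
      _ = - T k i j := by rw [h1]
      _ = T k j i := by rw [h2 k i j, neg_neg]
      _ = T j k i := h1 _ _ _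
      _ = - T j i k := h2 _ _ _
      _ = - T i j k := by rw [h1]
  linarith

theorem contDiff_coord {d : ℕ} (j : Fin d) : ContDiff ℝ ∞ fun x : E d => x j :=
  (EuclideanSpace.proj (𝕜 := ℝ) j).contDiff

theorem pderiv_coord {d : ℕ} (i j : Fin d) (x : E d) :
    pderiv (fun x : E d => x j) i x = if i = j then 1 else 0 := by
  have h : HasFDerivAt (fun x : E d => x j) (EuclideanSpace.proj (𝕜 := ℝ) j) x :=
    (EuclideanSpace.proj (𝕜 := ℝ) j).hasFDerivAt
  rw [pderiv, h.fderiv]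
  simp [eq_comm]

theorem eq_of_ae_eq_const {d : ℕ} {Ω : Set (E d)} (hΩ : IsOpen Ω) (hne : Ω.Nonempty) {a b : ℝ}
    (h : ∀ᵐ _x ∂(volume.restrict Ω), a = b) : a = b := by
  rw [ae_restrict_iff' hΩ.measurableSet] at h
  obtain ⟨x, hx, hx'⟩ := (Measure.dense_of_ae h).inter_open_nonempty _ hΩ hne
  exact hx' hx

/-- A field with vanishing strain is a rigid motion. -/
theorem exists_rigid_of_strain_eq_zero {d : ℕ} {Ω : Set (E d)} (hΩ : IsOpen Ω)
    (hc : IsConnected Ω) (hb : Bornology.IsBounded Ω) {v : H1vec Ω}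
    (h : ∀ i j, strain v i j = 0) :
    ∃ (a : Fin d → ℝ) (A : Matrix (Fin d) (Fin d) ℝ), Aᵀ = -A ∧
      ∀ i, ∀ᵐ x ∂(volume.restrict Ω), toL2 (v i) x = rigid a A i x := by
  choose c hcc using fun j k => exists_ae_eq_const_of_weakPartial_zero hΩ hc (wpart j (v k))
    fun i => isWeakPartial_wpart_zero_of_strain h i j k
  -- The gradient of `v` is a constant matrix; with the linear field of that matrix removed, every
  -- component has zero gradient.
  let w : Fin d → H1 Ω := fun k => v k - ∑ j, c j k • ofSmooth hb (contDiff_coord j)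
  have hw : ∀ i k, wpart i (w k) = 0 := by
    intro i k
    rw [← wpartL_apply]
    simp only [w, map_sub, map_sum, map_smul, wpartL_apply, wpart_ofSmooth]
    have e : ∀ j : Fin d, (memLp_of_continuous hb (continuous_pderiv (contDiff_coord j) i) 2).toLp
        (pderiv (fun x : E d => x j) i) = if i = j then
          (memLp_of_continuous hb (continuous_const (y := (1 : ℝ))) 2).toLp (fun _ => 1)
          else (0 : L2 Ω) := by
      intro j
      split_ifs with hij
      · refine (MemLp.toLp_eq_toLp_iff _ _).2 (Eventually.of_forall fun x => ?_)
        rw [pderiv_coord, if_pos hij]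
      · rw [← MemLp.toLp_zero (MemLp.zero (ε := ℝ))]
        refine (MemLp.toLp_eq_toLp_iff _ _).2 (Eventually.of_forall fun x => ?_)
        rw [pderiv_coord, if_neg hij]; rfl
    simp only [e, smul_ite, smul_zero, Finset.sum_ite_eq, Finset.mem_univ, if_true]
    rw [sub_eq_zero]
    refine Lp.ext ?_
    filter_upwards [hcc i k, Lp.coeFn_smul (c i k) ((memLp_of_continuous hb
      (continuous_const (y := (1 : ℝ))) 2).toLp (fun _ => 1) : L2 Ω),
      (memLp_of_continuous (Ω := Ω) hb (continuous_const (y := (1 : ℝ))) 2).coeFn_toLp]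
      with x h1 h2 h3
    rw [h1, h2, Pi.smul_apply, h3, smul_eq_mul, mul_one]
  choose a ha using fun k => exists_ae_eq_const_of_weakPartial_zero hΩ hc (toL2 (w k)) fun i => by
    have := isWeakPartial_wpart i (w k)
    rwa [hw] at this
  refine ⟨a, Matrix.of fun k j => c j k, ?_, fun k => ?_⟩
  · ext j k
    rw [Matrix.transpose_apply, Matrix.neg_apply, Matrix.of_apply, Matrix.of_apply]
    refine eq_of_ae_eq_const hΩ hc.nonempty ?_
    have hs := h j k
    rw [strain, smul_eq_zero] at hs
    have hs' := eq_neg_of_add_eq_zero_left (hs.resolve_left (by norm_num))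
    filter_upwards [hcc j k, hcc k j, Lp.coeFn_neg (wpart k (v j))] with x h1 h2 h3
    rw [← h1, hs', h3, Pi.neg_apply, h2]
  · have e1 : toL2 (v k) = toL2 (w k) + ∑ j, c j k • toL2 (ofSmooth hb (contDiff_coord j)) := by
      simp only [← toL2L_apply, w, map_sub, map_sum, map_smul, sub_add_cancel]
    have e2 : ∀ s : Finset (Fin d), ∀ᵐ x ∂(volume.restrict Ω),
        (∑ j ∈ s, c j k • toL2 (ofSmooth hb (contDiff_coord j)) : L2 Ω) x
          = ∑ j ∈ s, c j k * x j := by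
      intro s
      induction s using Finset.induction_on with
      | empty =>
        simp only [Finset.sum_empty]
        filter_upwards [Lp.coeFn_zero ℝ 2 (volume.restrict Ω)] with x hx
        rw [hx]; rfl
      | insert j s hj ih =>
        rw [Finset.sum_insert hj]
        filter_upwards [ih, Lp.coeFn_add (c j k • toL2 (ofSmooth hb (contDiff_coord j)))
          (∑ j ∈ s, c j k • toL2 (ofSmooth hb (contDiff_coord j)) : L2 Ω),
          Lp.coeFn_smul (c j k) (toL2 (ofSmooth hb (contDiff_coord j))),
          (memLp_of_continuous (Ω := Ω) hb (contDiff_coord j).continuous 2).coeFn_toLp]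
          with x h1 h2 h3 h4
        rw [h2, Pi.add_apply, h1, h3, Pi.smul_apply, toL2_ofSmooth, h4, smul_eq_mul,
          Finset.sum_insert hj]
    rw [e1]
    filter_upwards [ha k, e2 Finset.univ, Lp.coeFn_add (toL2 (w k))
      (∑ j, c j k • toL2 (ofSmooth hb (contDiff_coord j)) : L2 Ω)] with x h1 h2 h3
    rw [h3, Pi.add_apply, h1, h2]
    rfl

theorem continuous_rigid {d : ℕ} (a : Fin d → ℝ) (A : Matrix (Fin d) (Fin d) ℝ) (i : Fin d) :
    Continuous (rigid a A i) := by
  unfold rigid; fun_prop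

/-- The uniqueness part of Korn's inequality. -/
theorem eq_zero_of_strain_eq_zero {d : ℕ} {Ω : Set (E d)} (hΩ : IsOpen Ω)
    (hc : IsConnected Ω) (hb : Bornology.IsBounded Ω) {v : H1vec Ω}
    (h : ∀ i j, strain v i j = 0) (ho : OrthRM v) : v = 0 := by
  obtain ⟨a, A, hA, hv⟩ := exists_rigid_of_strain_eq_zero hΩ hc hb h
  have h1 := ho a A hA
  -- Since `v` is itself a rigid motion, the orthogonality condition tested with it gives `‖v‖² =
  -- 0`.
  have h2 : ∀ i, ∫ x in Ω, toL2 (v i) x * rigid a A i x = ‖toL2 (v i)‖ ^ 2 := by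
    intro i
    rw [← real_inner_self_eq_norm_sq, L2.inner_def]
    refine integral_congr_ae ?_
    filter_upwards [hv i] with x hx
    rw [← hx]; rfl
  simp only [h2] at h1
  have h3 := (Finset.sum_eq_zero_iff_of_nonneg fun i _ => sq_nonneg _).1 h1
  refine PiLp.ext fun i => H1_eq_zero hΩ (v i) ?_
  exact norm_eq_zero.1 (pow_eq_zero_iff two_ne_zero |>.1 (h3 i (Finset.mem_univ i)))

/-- The pairing with a rigid motion as a functional. -/
def rigidL {d : ℕ} {Ω : Set (E d)} (hb : Bornology.IsBounded Ω) (a : Fin d → ℝ)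
    (A : Matrix (Fin d) (Fin d) ℝ) : H1vec Ω →L[ℝ] ℝ :=
  ∑ i, (innerSL ℝ ((memLp_of_continuous hb (continuous_rigid a A i) 2).toLp _ : L2 Ω)).comp
    ((toL2L Ω).comp (compL Ω i))

theorem rigidL_apply {d : ℕ} {Ω : Set (E d)} (hb : Bornology.IsBounded Ω) (a : Fin d → ℝ)
    (A : Matrix (Fin d) (Fin d) ℝ) (v : H1vec Ω) :
    rigidL hb a A v = ∑ i, ∫ x in Ω, toL2 (v i) x * rigid a A i x := by
  simp only [rigidL, sum_apply, integral_mul_eq_inner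
    (memLp_of_continuous hb (continuous_rigid a A _) 2)]
  rfl

/-- The divergences of `H¹` vector fields are dense in `L²`. -/
theorem eq_zero_of_forall_inner_divg {d : ℕ} (hd : 0 < d) {Ω : Set (E d)} (hΩ : IsOpen Ω)
    (hc : IsConnected Ω) (hb : Bornology.IsBounded Ω) {f : L2 Ω}
    (h : ∀ v : H1vec Ω, inner ℝ f (divg v) = 0) : f = 0 := by
  -- No boundary condition is imposed on `v`, so `φ` is an arbitrary smooth function: compactly
  -- supported ones show that `f` is constant, and `φ = x_i` that the constant is zero.
  have key : ∀ (i : Fin d) (φ : E d → ℝ), ContDiff ℝ ∞ φ → ∫ x in Ω, f x * pderiv φ i x = 0 := by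
    intro i φ hφ
    have h1 := h (PiLp.single 2 i (ofSmooth hb hφ))
    have h2 : divg (PiLp.single 2 i (ofSmooth hb hφ)) = wpart i (ofSmooth hb hφ) := by
      rw [divg, Finset.sum_eq_single i]
      · simp
      · intro j _ hj
        simp only [PiLp.single_apply, if_neg hj, ← wpartL_apply, map_zero]
      · simp
    rw [h2, wpart_ofSmooth, real_inner_comm, ← integral_mul_eq_inner] at h1
    exact h1
  obtain ⟨c, hcc⟩ := exists_ae_eq_const_of_weakPartial_zero hΩ hc f fun i φ hφ => by
    rw [key i φ hφ.smooth, integral_mul_eq_inner hφ.memLp, inner_zero_right, neg_zero]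
  let i : Fin d := ⟨0, hd⟩
  have h1 := key i _ (contDiff_coord i)
  have h2 : ∫ x in Ω, f x * pderiv (fun x : E d => x i) i x = ∫ _x in Ω, c := by
    refine integral_congr_ae ?_
    filter_upwards [hcc] with x hx
    rw [hx, pderiv_coord, if_pos rfl, mul_one]
  rw [h2, setIntegral_const, smul_eq_mul] at h1
  have hpos : 0 < volume.real Ω := by
    rw [measureReal_def]
    exact ENNReal.toReal_pos (hΩ.measure_pos volume hc.nonempty).ne'
      (hb.measure_lt_top).ne
  have hc0 : c = 0 := (mul_eq_zero.1 h1).resolve_left hpos.ne'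
  refine Lp.ext ?_
  filter_upwards [hcc, Lp.coeFn_zero ℝ 2 (volume.restrict Ω)] with x hx h0
  rw [hx, h0, hc0]; rfl

/-! ### The Darcy flux -/

theorem memLp_mul_of_bounded {d : ℕ} {Ω : Set (E d)} {k : E d → ℝ}
    (hk : AEMeasurable k (volume.restrict Ω)) {M : ℝ}
    (hM : ∀ᵐ x ∂(volume.restrict Ω), |k x| ≤ M) (f : L2 Ω) :
    MemLp (fun x => k x * f x) 2 (volume.restrict Ω) :=
  (Lp.memLp f).of_le_mul (c := M) (hk.aestronglyMeasurable.mul (Lp.aestronglyMeasurable f)) (by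
    filter_upwards [hM] with x hx
    rw [norm_mul]
    exact mul_le_mul_of_nonneg_right hx (norm_nonneg _))

/-- Multiplication by a bounded measurable function on `L²(Ω)`. -/
def mulL {d : ℕ} {Ω : Set (E d)} {k : E d → ℝ} (hk : AEMeasurable k (volume.restrict Ω)) {M : ℝ}
    (hM : ∀ᵐ x ∂(volume.restrict Ω), |k x| ≤ M) : L2 Ω →L[ℝ] L2 Ω :=
  have hmem := memLp_mul_of_bounded hk hM
  LinearMap.mkContinuous
    { toFun := fun f => (memLp_mul_of_bounded hk hM f).toLp _
      map_add' := fun f g => by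
        refine Lp.ext ?_
        filter_upwards [(hmem (f + g)).coeFn_toLp, (hmem f).coeFn_toLp, (hmem g).coeFn_toLp,
          Lp.coeFn_add f g, Lp.coeFn_add ((hmem f).toLp _) ((hmem g).toLp _)] with x h1 h2 h3 h4 h5
        rw [h1, h5, Pi.add_apply, h2, h3, h4, Pi.add_apply, mul_add]
      map_smul' := fun c f => by
        refine Lp.ext ?_
        filter_upwards [(hmem (c • f)).coeFn_toLp, (hmem f).coeFn_toLp,
          Lp.coeFn_smul c f, Lp.coeFn_smul c ((hmem f).toLp _)] with x h1 h2 h3 h4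
        rw [h1, RingHom.id_apply, h4, Pi.smul_apply, h2, h3, Pi.smul_apply, smul_eq_mul,
          smul_eq_mul]
        ring } M (fun f => by
      refine Lp.norm_le_mul_norm_of_ae_le_mul ?_
      filter_upwards [(hmem f).coeFn_toLp, hM] with x h1 h2
      rw [LinearMap.coe_mk, AddHom.coe_mk, h1, norm_mul]
      exact mul_le_mul_of_nonneg_right h2 (norm_nonneg _))

theorem coeFn_mulL {d : ℕ} {Ω : Set (E d)} {k : E d → ℝ}
    (hk : AEMeasurable k (volume.restrict Ω)) {M : ℝ}
    (hM : ∀ᵐ x ∂(volume.restrict Ω), |k x| ≤ M) (f : L2 Ω) :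
    mulL hk hM f =ᵐ[volume.restrict Ω] fun x => k x * f x :=
  (memLp_mul_of_bounded hk hM f).coeFn_toLp

theorem coeFn_sum {d : ℕ} {Ω : Set (E d)} {I : Type*} (s : Finset I) (f : I → L2 Ω) :
    ⇑(∑ i ∈ s, f i) =ᵐ[volume.restrict Ω] fun x => ∑ i ∈ s, f i x := by
  classical
  induction s using Finset.induction_on with
  | empty =>
    simp only [Finset.sum_empty]
    exact Lp.coeFn_zero ℝ 2 (volume.restrict Ω)
  | insert j s hj ih =>
    rw [Finset.sum_insert hj]
    filter_upwards [ih, Lp.coeFn_add (f j) (∑ i ∈ s, f i)] with x h1 h2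
    rw [h2, Pi.add_apply, h1, Finset.sum_insert hj]

/-- Minkowski's inequality; `√T` is the norm of the constant `1` in `L²(0,T)`. -/
theorem eLpNorm_two_le_of_norm_le {X Y : Type*} [NormedAddCommGroup X] [NormedAddCommGroup Y]
    {T : ℝ} (hT : 0 < T) {u : ℝ → X} {w : ℝ → Y} (hw : AEStronglyMeasurable w (timeMeas T))
    {a c : ℝ} (ha : 0 ≤ a) (hc : 0 ≤ c) (h : ∀ᵐ t ∂(timeMeas T), ‖u t‖ ≤ a * ‖w t‖ + c) :
    eLpNorm u 2 (timeMeas T)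
      ≤ ENNReal.ofReal a * eLpNorm w 2 (timeMeas T) + ENNReal.ofReal (Real.sqrt T * c) := by
  refine (eLpNorm_mono_ae (g := fun t => a * ‖w t‖ + c)
    (h.mono fun t ht => ht.trans (Real.le_norm_self _))).trans ?_
  have hm : AEStronglyMeasurable (fun t => a * ‖w t‖) (timeMeas T) := hw.norm.const_mul _
  refine (eLpNorm_add_le hm aestronglyMeasurable_const (by norm_num)).trans ?_
  refine add_le_add (le_of_eq ?_) (le_of_eq ?_)
  · have e : (fun t => a * ‖w t‖) = a • fun t => ‖w t‖ := rfl
    rw [e, eLpNorm_const_smul, eLpNorm_norm, Real.enorm_eq_ofReal ha]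
  · rw [eLpNorm_const' _ (by norm_num) (by norm_num), timeMeas, Measure.restrict_apply_univ,
      Real.volume_Ioo, sub_zero, Real.enorm_eq_ofReal hc, ENNReal.ofReal_rpow_of_pos hT, mul_comm,
      ← ENNReal.ofReal_mul (Real.rpow_nonneg hT.le _), Real.sqrt_eq_rpow]
    norm_num

namespace Data

variable {d : ℕ} {Ω : Set (E d)} (D : Data Ω)

/-- Polarisation: `ζ = e_i` controls the diagonal, then `ζ = e_i + e_j` and symmetry control the
other entries. The constant is not sharp; boundedness is what makes `K` act on `L²(Ω)`. -/
theorem K_entry_bound : ∀ᵐ x ∂(volume.restrict Ω), ∀ i j, |D.K x i j| ≤ 2 * D.K₂ := by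
  filter_upwards [D.K_symm, D.K_bounds] with x hs hb i j
  have hK2 := D.K₂_pos
  have hdiag : ∀ i, 0 ≤ D.K x i i ∧ D.K x i i ≤ D.K₂ := fun i => by
    have := hb (Pi.single i 1)
    simp only [Matrix.mulVec_single_one, dotProduct_single, Matrix.col_apply, mul_one,
      Pi.single_eq_same] at this
    exact ⟨D.K₁_pos.le.trans this.1, this.2⟩
  have hsym : D.K x j i = D.K x i j := by
    have := congrFun (congrFun hs i) j
    rwa [Matrix.transpose_apply] at this
  rcases eq_or_ne i j with rfl | hij
  · rw [abs_of_nonneg (hdiag i).1]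
    linarith [(hdiag i).2]
  have := hb (Pi.single i 1 + Pi.single j 1)
  simp only [Matrix.mulVec_add, Matrix.mulVec_single_one, dotProduct_add,
    dotProduct_single, Pi.add_apply, Matrix.col_apply, mul_one, Pi.single_eq_same,
    Pi.single_eq_of_ne hij,
    Pi.single_eq_of_ne hij.symm] at this
  rw [hsym] at this
  have h1 := D.K₁_pos
  have hi := hdiag i
  have hj := hdiag j
  rw [abs_le]
  constructor <;> linarith [this.1, this.2]

/-- The gravity term `ρ_f g` as an element of `L²(Ω)^d`. -/
theorem memLp_gravity (hb : Bornology.IsBounded Ω) (j : Fin d) :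
    MemLp (fun x => D.ρf x * D.grav j) 2 (volume.restrict Ω) := by
  have : IsFiniteMeasure (volume.restrict Ω) := isFiniteMeasure_restrict.2 hb.measure_lt_top.ne
  exact (D.ρf_mem.mono_exponent le_top).mul_const _

/-- Multiplication by an entry of the permeability tensor. -/
def KL (i j : Fin d) : L2 Ω →L[ℝ] L2 Ω :=
  mulL (D.K_meas i j) (D.K_entry_bound.mono fun _ h => h i j)

/-- The linear part of the flux. -/
def fluxL : H1 Ω →L[ℝ] L2vec Ω :=
  (PiLp.continuousLinearEquiv 2 ℝ (fun _ : Fin d => L2 Ω)).symm.toContinuousLinearMap.comp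
    (ContinuousLinearMap.pi fun i => ∑ j, (D.KL i j).comp (wpartL Ω j))

/-- The flux as an element of `L²(Ω)^d`. -/
def fluxVec (hb : Bornology.IsBounded Ω) (p : H1 Ω) : L2vec Ω :=
  D.fluxL p - WithLp.toLp 2 fun i => ∑ j, D.KL i j ((D.memLp_gravity hb j).toLp _)

theorem coeFn_fluxVec (hb : Bornology.IsBounded Ω) (p : H1 Ω) (i : Fin d) :
    D.fluxVec hb p i =ᵐ[volume.restrict Ω] fun x => D.flux p x i := by
  have e : D.fluxVec hb p i
      = ∑ j, D.KL i j (wpart j p - (D.memLp_gravity hb j).toLp _) := by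
    simp only [map_sub, Finset.sum_sub_distrib]
    simp [fluxVec, fluxL, wpartL_apply]
  rw [e]
  have h1 : ∀ᵐ x ∂(volume.restrict Ω), ∀ j,
      D.KL i j (wpart j p - (D.memLp_gravity hb j).toLp _) x
        = D.K x i j * (wpart j p x - D.ρf x * D.grav j) := by
    rw [ae_all_iff]
    intro j
    filter_upwards [coeFn_mulL (D.K_meas i j) (D.K_entry_bound.mono fun _ h => h i j)
      (wpart j p - (D.memLp_gravity hb j).toLp _), Lp.coeFn_sub (wpart j p)
      ((D.memLp_gravity hb j).toLp _), (D.memLp_gravity hb j).coeFn_toLp] with x h1 h2 h3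
    rw [KL, h1, h2, Pi.sub_apply, h3]
  filter_upwards [coeFn_sum Finset.univ fun j =>
    D.KL i j (wpart j p - (D.memLp_gravity hb j).toLp _), h1] with x h2 h3
  rw [h2]
  simp only [h3]
  rfl

/-- The weak gradient. -/
def gradL (Ω : Set (E d)) : H1 Ω →L[ℝ] L2vec Ω :=
  (WithLp.sndL 2 ℝ (L2 Ω) (L2vec Ω)).comp (H1 Ω).subtypeL

theorem norm_gradL_le (p : H1 Ω) : ‖gradL Ω p‖ ≤ ‖p‖ := WithLp.norm_snd_le (p := 2) (x := p.1)

theorem darcy_eq_inner (hb : Bornology.IsBounded Ω) (p ψ : H1 Ω) :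
    D.darcy p ψ = inner ℝ (D.fluxVec hb p) (gradL Ω ψ) := by
  rw [PiLp.inner_apply]
  simp only [L2.inner_def]
  rw [← integral_finsetSum _ fun i _ => L2.integrable_inner _ _]
  refine integral_congr_ae ?_
  have h1 : ∀ᵐ x ∂(volume.restrict Ω), ∀ i, D.fluxVec hb p i x = D.flux p x i :=
    ae_all_iff.2 fun i => D.coeFn_fluxVec hb p i
  filter_upwards [h1] with x hx
  refine Finset.sum_congr rfl fun i _ => ?_
  rw [hx i]
  change _ = wpart i ψ x * D.flux p x i
  exact mul_comm _ _

theorem lintegral_flux (hb : Bornology.IsBounded Ω) (p : H1 Ω) :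
    ∫⁻ x in Ω, ‖D.flux p x‖ₑ ^ 2 = ‖D.fluxVec hb p‖ₑ ^ 2 := by
  have e1 : ‖D.fluxVec hb p‖ₑ ^ 2 = ∑ i, ‖D.fluxVec hb p i‖ₑ ^ 2 := by
    simp only [← ofReal_norm, ← ENNReal.ofReal_pow (norm_nonneg _)]
    rw [PiLp.norm_sq_eq_of_L2, ENNReal.ofReal_sum_of_nonneg fun i _ => sq_nonneg _]
  have e2 : ∀ x, ‖D.flux p x‖ₑ ^ 2 = ∑ i, ENNReal.ofReal (D.flux p x i ^ 2) := fun x => by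
    rw [← ofReal_norm, ← ENNReal.ofReal_pow (norm_nonneg _), EuclideanSpace.real_norm_sq_eq,
      ENNReal.ofReal_sum_of_nonneg fun i _ => sq_nonneg _]
  have h1 : ∀ᵐ x ∂(volume.restrict Ω), ∀ i, D.fluxVec hb p i x = D.flux p x i :=
    ae_all_iff.2 fun i => D.coeFn_fluxVec hb p i
  have e3 : ∫⁻ x in Ω, ‖D.flux p x‖ₑ ^ 2
      = ∫⁻ x in Ω, ∑ i, ENNReal.ofReal (D.fluxVec hb p i x ^ 2) := by
    refine lintegral_congr_ae ?_
    filter_upwards [h1] with x hx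
    rw [e2]
    simp only [hx]
  rw [e3, e1, lintegral_finsetSum' _ fun i _ =>
    ((Lp.aestronglyMeasurable (D.fluxVec hb p i)).aemeasurable.pow_const 2).ennreal_ofReal]
  refine Finset.sum_congr rfl fun i _ => ?_
  rw [← sq_eLpNorm_two, Lp.enorm_def]

theorem fluxNorm_eq (hb : Bornology.IsBounded Ω) (T : ℝ) (p : ℝ → H1 Ω) :
    D.fluxNorm T p = eLpNorm (fun t => D.fluxVec hb (p t)) 2 (timeMeas T) := by
  rw [fluxNorm, eLpNorm_eq_lintegral_rpow_enorm_toReal (by norm_num) (by norm_num)]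
  simp only [ENNReal.toReal_ofNat, D.lintegral_flux hb]
  congr 2
  funext t
  rw [← ENNReal.rpow_natCast]
  norm_num

variable {D} {T : ℝ} {τ : ℝ → H1vec Ω} {δ ϖ : ℝ → L2 Ω} {p : ℝ → H1 Ω} {q : ℝ → L2 Ω}
  {ϖt : ℝ → H1dual Ω} {r : ℝ → L2 Ω}

/-- The flux is a continuous affine function of `p`, hence inherits strong measurability and square
integrability in time. -/
theorem memLp_fluxVec (hb : Bornology.IsBounded Ω) (hp : MemLp p 2 (timeMeas T)) :
    MemLp (fun t => D.fluxVec hb (p t)) 2 (timeMeas T) :=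
  (D.fluxL.comp_memLp' hp).sub (memLp_const _)

/-- `trace` is defined by choice, so its linearity is not visible. The diffusion equation at a
single time expresses the pairing through bounded linear functionals, which makes it measurable
along `p`. -/
theorem IsWeakSolution.exists_bdPair_eq (h : D.IsWeakSolution T τ δ ϖ p q ϖt r) (hT : 0 < T)
    (hb : Bornology.IsBounded Ω) : ∃ L : H1 Ω →L[ℝ] ℝ, ∀ ψ, bdPair D.φ₁ ψ = L ψ := by
  obtain ⟨t, -, ht⟩ := exists_of_ae_timeMeas hT h.diffusion
  refine ⟨ϖt t + (1 / D.θf) • (innerSL ℝ (D.fluxVec hb (p t))).comp (gradL Ω)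
    - (innerSL ℝ D.φ).comp (toL2L Ω), fun ψ => ?_⟩
  have h1 := ht ψ
  rw [D.darcy_eq_inner hb, source] at h1
  simp only [sub_apply, add_apply, smul_apply, ContinuousLinearMap.comp_apply, innerSL_apply_apply,
    toL2L_apply, smul_eq_mul]
  linarith

/-- The pointwise bound for `ϖ_t` in the dual of `H¹`. -/
theorem IsWeakSolution.norm_deriv_le (h : D.IsWeakSolution T τ δ ϖ p q ϖt r)
    (hb : Bornology.IsBounded Ω) {C : ℝ} (hC0 : 0 < C) (hC : ∀ u : H1 Ω, ‖trace u‖ ≤ C * ‖u‖) :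
    ∀ᵐ t ∂(timeMeas T),
      ‖ϖt t‖ ≤ (1 / D.θf) * ‖D.fluxVec hb (p t)‖ + (‖D.φ‖ + C * ‖D.φ₁‖) := by
  have hθ := D.θf_pos
  filter_upwards [h.diffusion] with t ht
  refine ContinuousLinearMap.opNorm_le_bound _ (by positivity) fun ψ => ?_
  have h1 := ht ψ
  rw [D.darcy_eq_inner hb, source] at h1
  have h2 : ϖt t ψ = inner ℝ D.φ (toL2 ψ) + bdPair D.φ₁ ψ
      - (1 / D.θf) * inner ℝ (D.fluxVec hb (p t)) (gradL Ω ψ) := by linarith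
  have h3 : |inner ℝ D.φ (toL2 ψ)| ≤ ‖D.φ‖ * ‖ψ‖ :=
    (abs_real_inner_le_norm _ _).trans
      (mul_le_mul_of_nonneg_left (norm_toL2_le ψ) (norm_nonneg _))
  have h4 := abs_bdPair_le hC D.φ₁ ψ
  have h5 : |inner ℝ (D.fluxVec hb (p t)) (gradL Ω ψ)| ≤ ‖D.fluxVec hb (p t)‖ * ‖ψ‖ :=
    (abs_real_inner_le_norm _ _).trans
      (mul_le_mul_of_nonneg_left (norm_gradL_le ψ) (norm_nonneg _))
  have h6 := mul_le_mul_of_nonneg_left h5 (one_div_pos.2 hθ).le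
  have h7 : |(1 / D.θf) * inner ℝ (D.fluxVec hb (p t)) (gradL Ω ψ)|
      = (1 / D.θf) * |inner ℝ (D.fluxVec hb (p t)) (gradL Ω ψ)| := by
    rw [abs_mul, abs_of_pos (one_div_pos.2 hθ)]
  rw [Real.norm_eq_abs, h2]
  refine (abs_sub _ _).trans ?_
  rw [h7]
  have h8 := abs_add_le (inner ℝ D.φ (toL2 ψ)) (bdPair D.φ₁ ψ)
  linarith

/-- The bound for `ϖ_t` in `L²(0,T;H¹(Ω)')`. -/
theorem IsWeakSolution.eLpNorm_deriv_le (h : D.IsWeakSolution T τ δ ϖ p q ϖt r) (hT : 0 < T)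
    (hb : Bornology.IsBounded Ω) {C : ℝ} (hC0 : 0 < C) (hC : ∀ u : H1 Ω, ‖trace u‖ ≤ C * ‖u‖) :
    D.fluxNorm T p < ⊤ ∧
      eLpNorm ϖt 2 (timeMeas T)
        ≤ ENNReal.ofReal (1 / D.θf) * D.fluxNorm T p
          + ENNReal.ofReal (Real.sqrt T * (‖D.φ‖ + C * ‖D.φ₁‖)) := by
  have hmem : MemLp (fun t => D.fluxVec hb (p t)) 2 (timeMeas T) := memLp_fluxVec hb h.p_mem
  rw [D.fluxNorm_eq hb]
  exact ⟨hmem.eLpNorm_lt_top, eLpNorm_two_le_of_norm_le (X := H1dual Ω) (Y := L2vec Ω) (u := ϖt) hT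
    hmem.1 (one_div_pos.2 D.θf_pos).le (add_nonneg (norm_nonneg _) (mul_nonneg hC0.le (norm_nonneg _)))
    (h.norm_deriv_le hb hC0 hC)⟩

end Data

/-! ### The energy law in an abstract setting -/

theorem intervalIntegral_congr_timeMeas {T : ℝ} {X : Type*} [NormedAddCommGroup X] [NormedSpace ℝ X]
    {f g : ℝ → X} (h : f =ᵐ[timeMeas T] g) {a b : ℝ} (ha : a ∈ Icc 0 T) (hb : b ∈ Icc 0 T) :
    ∫ t in a..b, f t = ∫ t in a..b, g t := by
  have h1 : f =ᵐ[volume.restrict (Ioc 0 T)] g := by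
    rwa [timeMeas, restrict_Ioo_eq_restrict_Ioc] at h
  refine intervalIntegral.integral_congr_ae ?_
  filter_upwards [(ae_restrict_iff' measurableSet_Ioc).1 h1] with t ht hmem
  refine ht ⟨(le_min ha.1 hb.1).trans_lt hmem.1, hmem.2.trans (max_le ha.2 hb.2)⟩

/-- A linear evolution problem with the structure of the reformulated Biot problem: `a` is the
elastic energy, `dv` the divergence, `ι` the inclusion `H¹ → L²`, `ρ` the pairings with rigid
motions, and `ℓ` the load. -/
structure IsAbstractSolution {V H Q I : Type*} [NormedAddCommGroup V] [InnerProductSpace ℝ V]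
    [NormedAddCommGroup H] [InnerProductSpace ℝ H] [NormedAddCommGroup Q] [NormedSpace ℝ Q]
    (a : V →L[ℝ] V →L[ℝ] ℝ) (dv : V →L[ℝ] H) (ι : Q →L[ℝ] H) (ρ : I → V →L[ℝ] ℝ) (ℓ : V →L[ℝ] ℝ)
    (χ₁ χ₂ χ₃ lam T : ℝ) (w₀ : H) (τ : ℝ → V) (δ ϖ : ℝ → H) (p : ℝ → Q) (ϖt : ℝ → Q →L[ℝ] ℝ)
    (r : ℝ → H) : Prop where
  T_pos : 0 < T
  χ₂_nonneg : 0 ≤ χ₂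
  χ₃_pos : 0 < χ₃
  lam_nonneg : 0 ≤ lam
  a_symm : ∀ u v, a u v = a v u
  a_nonneg : ∀ v, 0 ≤ a v v
  korn : ∀ v, a v v = 0 → (∀ k, ρ k v = 0) → v = 0
  dense_ι : ∀ f : H, (∀ ψ, inner ℝ f (ι ψ) = 0) → f = 0
  dense_dv : ∀ f : H, (∀ v, inner ℝ f (dv v) = 0) → f = 0
  τ_mem : MemLp τ ∞ (timeMeas T)
  δ_mem : MemLp δ ∞ (timeMeas T)
  ϖ_mem : MemLp ϖ ∞ (timeMeas T)
  ϖt_mem : MemLp ϖt 2 (timeMeas T)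
  p_mem : MemLp p 2 (timeMeas T)
  τ_ker : ∀ᵐ t ∂(timeMeas T), ∀ k, ρ k (τ t) = 0
  ϖ_deriv : HasWeakTimeDeriv T (fun t => (innerSL ℝ (ϖ t)).comp ι) ϖt
  r_deriv : 0 < lam → HasWeakTimeDeriv T (fun t => dv (τ t)) r
  momentum : ∀ᵐ t ∂(timeMeas T), ∀ v, a (τ t) v - inner ℝ (δ t) (dv v) = ℓ v
  constraint : ∀ᵐ t ∂(timeMeas T), χ₃ • δ t + dv (τ t) + (lam * χ₃) • r t = χ₁ • ϖ t
  p_eq : ∀ᵐ t ∂(timeMeas T), ι (p t) = χ₁ • δ t + χ₂ • ϖ t + (lam * χ₁) • r t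
  initial : HasInitialValue T (fun t => (innerSL ℝ (ϖ t)).comp ι) ((innerSL ℝ w₀).comp ι)

namespace IsAbstractSolution

variable {V H Q I : Type*} [NormedAddCommGroup V] [InnerProductSpace ℝ V]
  [NormedAddCommGroup H] [InnerProductSpace ℝ H] [NormedAddCommGroup Q] [NormedSpace ℝ Q]
  {a : V →L[ℝ] V →L[ℝ] ℝ} {dv : V →L[ℝ] H} {ι : Q →L[ℝ] H} {ρ : I → V →L[ℝ] ℝ} {ℓ : V →L[ℝ] ℝ}
  {χ₁ χ₂ χ₃ lam T : ℝ} {w₀ : H} {τ : ℝ → V} {δ ϖ : ℝ → H} {p : ℝ → Q} {ϖt : ℝ → Q →L[ℝ] ℝ}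
  {r : ℝ → H}

/-- The representative of `ϖ` in the dual of `Q` is continuous and equals a constant plus the
primitive of `ϖt`. As `ι` has dense range, boundedness of `ϖ` lifts it to a weakly continuous
function in `H`, with the initial value and the increments identified by testing. -/
theorem exists_ϖ [CompleteSpace H]
    (h : IsAbstractSolution a dv ι ρ ℓ χ₁ χ₂ χ₃ lam T w₀ τ δ ϖ p ϖt r) :
    ∃ ϖ' : ℝ → H, ϖ' =ᵐ[timeMeas T] ϖ ∧ WeaklyContinuous T ϖ' ∧ ϖ' 0 = w₀ ∧
      ∀ t ∈ Icc 0 T, ∀ s ∈ Icc 0 T, ∀ ψ,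
        inner ℝ (ϖ' s - ϖ' t) (ι ψ) = (∫ σ in t..s, ϖt σ) ψ := by
  have hT := h.T_pos
  obtain ⟨c, hc, hcϖ, hc0⟩ := h.initial
  obtain ⟨x, hx⟩ := h.ϖ_deriv.exists_ae_eq hT
  have hϖti : Integrable ϖt (timeMeas T) := h.ϖ_deriv.2.1
  have hcx : EqOn c (fun t => x + ∫ s in (0 : ℝ)..t, ϖt s) (Icc 0 T) := by
    refine eqOn_of_ae_eq hT hc
      (continuousOn_const.add (continuousOn_primitive_of_timeMeas hϖti hT)) ?_
    filter_upwards [hcϖ, hx] with t h1 h2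
    rw [h1, h2]
  obtain ⟨ϖ', h1, h2, h3⟩ := exists_weaklyContinuous hT h.ϖ_mem
    (fun ψ : Q => innerSL ℝ (ι ψ)) (fun ψ t => c t ψ) (fun ψ => hc.clm_apply continuousOn_const)
    (fun y hy => h.dense_ι y fun ψ => by
      rw [real_inner_comm]
      exact hy ψ) (by
      filter_upwards [hcϖ] with t ht ψ
      rw [ht, innerSL_apply_apply, ContinuousLinearMap.comp_apply, innerSL_apply_apply,
        real_inner_comm])
  have h4 : ∀ t ∈ Icc 0 T, ∀ ψ, inner ℝ (ϖ' t) (ι ψ) = c t ψ := fun t ht ψ => by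
    rw [← h3 t ht ψ, innerSL_apply_apply, real_inner_comm]
  refine ⟨ϖ', h1, h2, ?_, fun t ht s hs ψ => ?_⟩
  · rw [← sub_eq_zero]
    refine h.dense_ι _ fun ψ => ?_
    rw [inner_sub_left, h4 0 (left_mem_Icc.2 hT.le), hc0, ContinuousLinearMap.comp_apply,
      innerSL_apply_apply, sub_self]
  · have h0 : (0 : ℝ) ∈ Icc 0 T := left_mem_Icc.2 hT.le
    rw [inner_sub_left, h4 s hs, h4 t ht, hcx hs, hcx ht, ← sub_apply,
      ← intervalIntegral.integral_interval_sub_left (intervalIntegrable_of_timeMeas hϖti h0 hs)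
        (intervalIntegrable_of_timeMeas hϖti h0 ht)]
    congr 1
    exact add_sub_add_left_eq_sub _ _ _

/-- Solved for `r`, the constraint has bounded terms only, so an integrable derivative is
automatically bounded in time. -/
theorem memLp_r (h : IsAbstractSolution a dv ι ρ ℓ χ₁ χ₂ χ₃ lam T w₀ τ δ ϖ p ϖt r)
    (hl : 0 < lam) : MemLp r ∞ (timeMeas T) := by
  have h1 : MemLp (fun t => (lam * χ₃)⁻¹ • (χ₁ • ϖ t - χ₃ • δ t - dv (τ t))) ∞ (timeMeas T) :=
    (((h.ϖ_mem.const_smul χ₁).sub (h.δ_mem.const_smul χ₃)).sub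
      (dv.comp_memLp' h.τ_mem)).const_smul _
  refine h1.ae_eq ?_
  filter_upwards [h.constraint] with t e1
  rw [← e1, add_assoc, add_sub_cancel_left, add_sub_cancel_left, smul_smul,
    inv_mul_cancel₀ (mul_pos hl h.χ₃_pos).ne', one_smul]

/-- Weakly continuous representatives, for which the relations hold at every time. -/
theorem exists_representatives [CompleteSpace V] [CompleteSpace H]
    (h : IsAbstractSolution a dv ι ρ ℓ χ₁ χ₂ χ₃ lam T w₀ τ δ ϖ p ϖt r) {ϖ' : ℝ → H}
    (hae : ϖ' =ᵐ[timeMeas T] ϖ) (hwc : WeaklyContinuous T ϖ') :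
    ∃ (τ' : ℝ → V) (δ' r' : ℝ → H), τ' =ᵐ[timeMeas T] τ ∧ δ' =ᵐ[timeMeas T] δ ∧
      WeaklyContinuous T τ' ∧ WeaklyContinuous T δ' ∧ WeaklyContinuous T r' ∧
      MemLp r' ∞ (timeMeas T) ∧ (0 < lam → r' =ᵐ[timeMeas T] r) ∧
      (∀ t ∈ Icc 0 T, ∀ v, a (τ' t) v - inner ℝ (δ' t) (dv v) = ℓ v) ∧
      (∀ t ∈ Icc 0 T, χ₃ • δ' t + dv (τ' t) + (lam * χ₃) • r' t = χ₁ • ϖ' t) ∧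
      (∀ t ∈ Icc 0 T, ∀ s ∈ Icc 0 T,
        lam • (dv (τ' s) - dv (τ' t)) = lam • ∫ σ in t..s, r' σ) := by
  have hT := h.T_pos
  have hχ := h.χ₃_pos
  rcases h.lam_nonneg.eq_or_lt with hl | hl
  -- For `lam = 0`, eliminating `δ` leaves the elliptic problem `χ₃ a(τ, v) + (dv τ, dv v) = χ₃ ℓ v
  -- + χ₁ (ϖ, dv v)`, whose right side is continuous in time. Together with the rigid-motion
  -- pairings it determines `τ`; the constraint then gives `δ`.
  · obtain ⟨τ', h1, h2, h3⟩ := exists_weaklyContinuous hT h.τ_mem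
      (Sum.elim (fun v : V => χ₃ • a.flip v + (innerSL ℝ (dv v)).comp dv) ρ)
      (Sum.elim (fun v t => χ₃ * ℓ v + χ₁ * inner ℝ (ϖ' t) (dv v)) fun _ _ => 0)
      (by
        rintro (v | k)
        · exact continuousOn_const.add (continuousOn_const.mul (hwc (dv v)))
        · exact continuousOn_const)
      (fun u hu => by
        refine h.korn u ?_ fun k => hu (Sum.inr k)
        have h1 := hu (Sum.inl u)
        simp only [Sum.elim_inl, add_apply, smul_apply, ContinuousLinearMap.flip_apply,
          ContinuousLinearMap.comp_apply, innerSL_apply_apply, real_inner_self_eq_norm_sq,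
          smul_eq_mul] at h1
        have h2 := h.a_nonneg u
        have h3 := sq_nonneg ‖dv u‖
        have h4 := mul_nonneg hχ.le h2
        exact (mul_eq_zero.1 (show χ₃ * a u u = 0 by linarith)).resolve_left hχ.ne')
      (by
        filter_upwards [h.momentum, h.constraint, h.τ_ker, hae] with t h1 h2 h3 h4 i
        rcases i with v | k
        · have h5 := congrArg (fun y => inner ℝ y (dv v)) h2
          simp only [← hl, zero_mul, zero_smul, add_zero, inner_add_left, real_inner_smul_left]
            at h5
          simp only [Sum.elim_inl, add_apply, smul_apply, ContinuousLinearMap.flip_apply,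
            ContinuousLinearMap.comp_apply, innerSL_apply_apply, smul_eq_mul]
          rw [h4, ← h1 v, ← h5, real_inner_comm (dv v) (dv (τ t))]
          ring
        · exact h3 k)
    have h4 : ∀ t ∈ Icc 0 T, ∀ v, χ₃ * a (τ' t) v + inner ℝ (dv (τ' t)) (dv v)
        = χ₃ * ℓ v + χ₁ * inner ℝ (ϖ' t) (dv v) := fun t ht v => by
      have := h3 t ht (Sum.inl v)
      simp only [Sum.elim_inl, add_apply, smul_apply, ContinuousLinearMap.flip_apply,
        ContinuousLinearMap.comp_apply, innerSL_apply_apply, smul_eq_mul] at this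
      rw [← this, real_inner_comm]
    -- Zero is a legitimate choice of `r'` here, as it only occurs multiplied by `lam`.
    refine ⟨τ', fun t => χ₃⁻¹ • (χ₁ • ϖ' t - dv (τ' t)), fun _ => 0, h1, ?_, h2,
      ((hwc.const_smul χ₁).sub (h2.comp_clm dv)).const_smul _,
      ContinuousOn.weaklyContinuous continuousOn_const,
      memLp_const 0, fun h0 => absurd hl h0.ne,
      fun t ht v => ?_, fun t _ => ?_, fun t _ s _ => by rw [← hl, zero_smul, zero_smul]⟩
    · filter_upwards [h.constraint, hae, h1] with t h5 h6 h7
      rw [h6, h7, ← h5, ← hl, zero_mul, zero_smul, add_zero, add_sub_cancel_right, smul_smul,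
        inv_mul_cancel₀ hχ.ne', one_smul]
    · have h5 := h4 t ht v
      rw [real_inner_smul_left, inner_sub_left, real_inner_smul_left]
      field_simp
      linarith
    · rw [smul_smul, mul_inv_cancel₀ hχ.ne', one_smul, smul_zero, add_zero, sub_add_cancel]
  -- For `lam > 0`, the divergence of `τ` is a continuous primitive of `r`, and on divergence-free
  -- `v` the momentum equation reads `a(τ, v) = ℓ v`, constant in time. These data determine `τ`: a
  -- difference of two candidates is divergence-free, so it may be tested with itself.
  · obtain ⟨x, hx⟩ := (h.r_deriv hl).exists_ae_eq hT
    have hri : Integrable r (timeMeas T) := (h.r_deriv hl).2.1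
    have hz : ContinuousOn (fun t => x + ∫ s in (0 : ℝ)..t, r s) (Icc 0 T) :=
      continuousOn_const.add (continuousOn_primitive_of_timeMeas hri hT)
    obtain ⟨τ', h1, h2, h3⟩ := exists_weaklyContinuous hT h.τ_mem
      (Sum.elim (fun η : H => (innerSL ℝ η).comp dv)
        (Sum.elim (fun v : {v : V // dv v = 0} => a.flip v) ρ))
      (Sum.elim (fun η t => inner ℝ η (x + ∫ s in (0 : ℝ)..t, r s))
        (Sum.elim (fun v _ => ℓ v) fun _ _ => 0))
      (by
        rintro (η | v | k)
        · exact continuousOn_const.inner hz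
        · exact continuousOn_const
        · exact continuousOn_const)
      (fun u hu => by
        have h0 : dv u = 0 := inner_self_eq_zero.1 (hu (Sum.inl (dv u)))
        exact h.korn u (hu (Sum.inr (Sum.inl ⟨u, h0⟩))) fun k => hu (Sum.inr (Sum.inr k)))
      (by
        filter_upwards [h.momentum, hx, h.τ_ker] with t h1 h2 h3 i
        rcases i with η | ⟨v, hv⟩ | k
        · simp only [Sum.elim_inl, ContinuousLinearMap.comp_apply, innerSL_apply_apply]
          rw [h2]
        · have h4 := h1 v
          rw [hv, inner_zero_right, sub_zero] at h4
          exact h4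
        · exact h3 k)
    have h4 : ∀ t ∈ Icc 0 T, dv (τ' t) = x + ∫ s in (0 : ℝ)..t, r s := fun t ht =>
      ext_inner_left ℝ fun η => h3 t ht (Sum.inl η)
    have h5 : ∀ t ∈ Icc 0 T, ∀ v, dv v = 0 → a (τ' t) v = ℓ v := fun t ht v hv =>
      h3 t ht (Sum.inr (Sum.inl ⟨v, hv⟩))
    -- The momentum equation prescribes `δ` against all divergences, which are dense; the constraint
    -- then defines `r'`.
    obtain ⟨δ', g1, g2, g3⟩ := exists_weaklyContinuous hT h.δ_mem
      (fun v : V => innerSL ℝ (dv v)) (fun v t => a.flip v (τ' t) - ℓ v)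
      (fun v => (h2.clm (a.flip v)).sub continuousOn_const)
      (fun y hy => h.dense_dv y fun v => by
        rw [real_inner_comm]
        exact hy v)
      (by
        filter_upwards [h.momentum, h1] with t h6 h7 v
        rw [h7, innerSL_apply_apply, real_inner_comm, ContinuousLinearMap.flip_apply]
        linarith [h6 v])
    have hlχ : lam * χ₃ ≠ 0 := (mul_pos hl hχ).ne'
    have hr : (fun t => (lam * χ₃)⁻¹ • (χ₁ • ϖ' t - χ₃ • δ' t - dv (τ' t))) =ᵐ[timeMeas T] r := by
      filter_upwards [h.constraint, hae, g1, h1] with t e1 e2 e3 e4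
      rw [e2, e3, e4, ← e1, add_assoc, add_sub_cancel_left, add_sub_cancel_left, smul_smul,
        inv_mul_cancel₀ hlχ, one_smul]
    refine ⟨τ', δ', fun t => (lam * χ₃)⁻¹ • (χ₁ • ϖ' t - χ₃ • δ' t - dv (τ' t)), h1, g1, h2, g2,
      (((hwc.const_smul χ₁).sub (g2.const_smul χ₃)).sub (h2.comp_clm dv)).const_smul _,
      (h.memLp_r hl).ae_eq hr.symm, fun _ => hr, fun t ht v => ?_, fun t _ => ?_, fun t ht s hs => ?_⟩
    · have := g3 t ht v
      rw [innerSL_apply_apply, real_inner_comm, ContinuousLinearMap.flip_apply] at this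
      linarith
    · rw [smul_smul, mul_inv_cancel₀ hlχ, one_smul]
      abel
    · have h0 : (0 : ℝ) ∈ Icc 0 T := left_mem_Icc.2 hT.le
      rw [h4 s hs, h4 t ht, add_sub_add_left_eq_sub, intervalIntegral_congr_timeMeas hr ht hs,
        intervalIntegral.integral_interval_sub_left (intervalIntegrable_of_timeMeas hri h0 hs)
        (intervalIntegrable_of_timeMeas hri h0 ht)]

end IsAbstractSolution

/-- The energy of a state. -/
def stateEnergy {V H : Type*} [NormedAddCommGroup V] [InnerProductSpace ℝ V]
    [NormedAddCommGroup H] [InnerProductSpace ℝ H] (a : V →L[ℝ] V →L[ℝ] ℝ) (ℓ : V →L[ℝ] ℝ)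
    (χ₂ χ₃ lam : ℝ) (τ : V) (δ ϖ r : H) : ℝ :=
  (1 / 2) * (a τ τ + χ₂ * ‖ϖ‖ ^ 2 + χ₃ * ‖δ‖ ^ 2 + lam ^ 2 * χ₃ * ‖r‖ ^ 2
    + 2 * lam * χ₃ * inner ℝ r δ - 2 * ℓ τ)

/-- Convexity of the energy: the increment is bounded below by its linearisation. -/
theorem le_stateEnergy_sub {V H : Type*} [NormedAddCommGroup V] [InnerProductSpace ℝ V]
    [NormedAddCommGroup H] [InnerProductSpace ℝ H] {a : V →L[ℝ] V →L[ℝ] ℝ} {dv : V →L[ℝ] H}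
    {ℓ : V →L[ℝ] ℝ} {χ₁ χ₂ χ₃ lam : ℝ} (hχ₂ : 0 ≤ χ₂) (hχ₃ : 0 < χ₃)
    (a_symm : ∀ u v, a u v = a v u) (a_nonneg : ∀ v, 0 ≤ a v v)
    {τ τ' : V} {δ δ' ϖ ϖ' r r' : H} (hm : ∀ v, a τ v - inner ℝ δ (dv v) = ℓ v)
    (hc : χ₃ • δ + dv τ + (lam * χ₃) • r = χ₁ • ϖ)
    (hc' : χ₃ • δ' + dv τ' + (lam * χ₃) • r' = χ₁ • ϖ') :
    inner ℝ (ϖ' - ϖ) (χ₁ • δ + χ₂ • ϖ + (lam * χ₁) • r) - inner ℝ r (lam • (dv τ' - dv τ))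
      ≤ stateEnergy a ℓ χ₂ χ₃ lam τ' δ' ϖ' r' - stateEnergy a ℓ χ₂ χ₃ lam τ δ ϖ r := by
  -- Completing the square: `δ` and `r` enter only through `k = δ + lam • r`, which makes convexity
  -- visible.
  have e : ∀ (τ : V) (δ ϖ r : H), stateEnergy a ℓ χ₂ χ₃ lam τ δ ϖ r
      = (1 / 2) * (a τ τ + χ₂ * ‖ϖ‖ ^ 2 + χ₃ * ‖δ + lam • r‖ ^ 2 - 2 * ℓ τ) := fun τ δ ϖ r => by
    rw [stateEnergy, norm_add_sq_real, norm_smul, mul_pow, Real.norm_eq_abs, sq_abs,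
      real_inner_smul_right, real_inner_comm]
    ring
  obtain ⟨k, hk⟩ : ∃ k, k = δ + lam • r := ⟨_, rfl⟩
  obtain ⟨k', hk'⟩ : ∃ k', k' = δ' + lam • r' := ⟨_, rfl⟩
  obtain ⟨u, rfl⟩ : ∃ u, τ' = τ + u := ⟨τ' - τ, (add_sub_cancel _ _).symm⟩
  obtain ⟨w, rfl⟩ : ∃ w, ϖ' = ϖ + w := ⟨ϖ' - ϖ, (add_sub_cancel _ _).symm⟩
  obtain ⟨g, rfl⟩ : ∃ g, k' = k + g := ⟨k' - k, (add_sub_cancel _ _).symm⟩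
  -- The difference of the two constraints trades the increment of `k` for those of `ϖ` and `τ`;
  -- paired with `k`, it turns the linear part of the energy increment into the left side of the
  -- claim.
  have hg : χ₃ • g + dv u = χ₁ • w := by
    have h1 : χ₃ • k + dv τ = χ₁ • ϖ := by
      rw [hk, ← hc, smul_add, smul_smul, mul_comm χ₃ lam]
      abel
    have h2 : χ₃ • (k + g) + dv (τ + u) = χ₁ • (ϖ + w) := by
      rw [hk', ← hc', smul_add, smul_smul, mul_comm χ₃ lam]
      abel
    rw [smul_add, map_add, smul_add, ← h1] at h2
    have h3 : (χ₃ • k + dv τ) + (χ₃ • g + dv u) = (χ₃ • k + dv τ) + χ₁ • w := by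
      rw [← h2]; abel
    exact add_left_cancel h3
  have hg' := congrArg (fun y => inner ℝ k y) hg
  simp only [inner_add_right, real_inner_smul_right] at hg'
  have hku : inner ℝ k (dv u) = inner ℝ δ (dv u) + lam * inner ℝ r (dv u) := by
    rw [hk, inner_add_left, real_inner_smul_left]
  have hp : χ₁ • δ + χ₂ • ϖ + (lam * χ₁) • r = χ₁ • k + χ₂ • ϖ := by
    rw [hk, smul_add, smul_smul, mul_comm χ₁ lam]
    abel
  rw [e, e, ← hk, ← hk', hp]
  simp only [add_sub_cancel_left, map_add, add_apply, norm_add_sq_real, inner_add_right,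
    real_inner_smul_right, a_symm u τ]
  have h1 := a_nonneg u
  have h2 := mul_nonneg hχ₂ (sq_nonneg ‖w‖)
  have h3 := mul_nonneg hχ₃.le (sq_nonneg ‖g‖)
  have h4 := hm u
  rw [real_inner_comm k w, real_inner_comm ϖ w]
  linarith

namespace IsAbstractSolution

variable {V H Q I : Type*} [NormedAddCommGroup V] [InnerProductSpace ℝ V]
  [NormedAddCommGroup H] [InnerProductSpace ℝ H] [NormedAddCommGroup Q] [NormedSpace ℝ Q]
  {a : V →L[ℝ] V →L[ℝ] ℝ} {dv : V →L[ℝ] H} {ι : Q →L[ℝ] H} {ρ : I → V →L[ℝ] ℝ} {ℓ : V →L[ℝ] ℝ}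
  {χ₁ χ₂ χ₃ lam T : ℝ} {w₀ : H} {τ : ℝ → V} {δ ϖ : ℝ → H} {p : ℝ → Q} {ϖt : ℝ → Q →L[ℝ] ℝ}
  {r : ℝ → H}

theorem integrable_energy {τ' : ℝ → V} {δ' ϖ' r' : ℝ → H} (hτ : MemLp τ' 2 (timeMeas T))
    (hδ : MemLp δ' 2 (timeMeas T)) (hϖ : MemLp ϖ' 2 (timeMeas T)) (hr : MemLp r' 2 (timeMeas T)) :
    Integrable (fun t => stateEnergy a ℓ χ₂ χ₃ lam (τ' t) (δ' t) (ϖ' t) (r' t)) (timeMeas T) := by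
  have hn : ∀ f : ℝ → H, MemLp f 2 (timeMeas T) →
      Integrable (fun t => ‖f t‖ ^ 2) (timeMeas T) := fun f hf => by
    simp only [← real_inner_self_eq_norm_sq]
    exact integrable_pairing (innerSL ℝ) hf hf
  exact ((((((integrable_pairing a hτ hτ).add ((hn _ hϖ).const_mul _)).add
    ((hn _ hδ).const_mul _)).add ((hn _ hr).const_mul _)).add
    ((integrable_pairing (innerSL ℝ) hr hδ).const_mul _)).sub
    ((ℓ.integrable_comp (hτ.integrable (by norm_num))).const_mul _)).const_mul _

/-- The energy law. -/
theorem exists_energy_law [CompleteSpace V] [CompleteSpace H]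
    (h : IsAbstractSolution a dv ι ρ ℓ χ₁ χ₂ χ₃ lam T w₀ τ δ ϖ p ϖt r) :
    ∃ (τ' : ℝ → V) (δ' ϖ' r' : ℝ → H), τ' =ᵐ[timeMeas T] τ ∧ δ' =ᵐ[timeMeas T] δ ∧
      ϖ' =ᵐ[timeMeas T] ϖ ∧ WeaklyContinuous T τ' ∧ WeaklyContinuous T δ' ∧
      WeaklyContinuous T ϖ' ∧ (0 < lam → r' =ᵐ[timeMeas T] r ∧ WeaklyContinuous T r') ∧
      ϖ' 0 = w₀ ∧ ∀ s ∈ Icc 0 T, stateEnergy a ℓ χ₂ χ₃ lam (τ' s) (δ' s) (ϖ' s) (r' s)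
        + lam * (∫ t in (0 : ℝ)..s, ‖r t‖ ^ 2) - ∫ t in (0 : ℝ)..s, ϖt t (p t)
        = stateEnergy a ℓ χ₂ χ₃ lam (τ' 0) (δ' 0) (ϖ' 0) (r' 0) := by
  have hT := h.T_pos
  obtain ⟨ϖ', w1, w2, w3, w4⟩ := h.exists_ϖ
  obtain ⟨τ', δ', r', t1, d1, t2, d2, r2, rm, r1, hm, hc, hd⟩ := h.exists_representatives w1 w2
  refine ⟨τ', δ', ϖ', r', t1, d1, w1, t2, d2, w2, fun hl => ⟨r1 hl, r2⟩, w3, ?_⟩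
  -- For `lam = 0` the functions `r'` and `r` are unrelated, so only the products are compared.
  have hrr : ∀ᵐ t ∂(timeMeas T), lam • r' t = lam • r t := by
    rcases h.lam_nonneg.eq_or_lt with hl | hl
    · simp [← hl]
    · filter_upwards [r1 hl] with t ht
      rw [ht]
  have ri : Integrable r' (timeMeas T) := rm.integrable le_top
  have hϖti : Integrable ϖt (timeMeas T) := h.ϖ_deriv.2.1
  have hF : MemLp (fun t => (ϖt t, r' t)) 2 (timeMeas T) :=
    MemLp.of_fst_snd ⟨h.ϖt_mem, rm.mono_exponent le_top⟩
  have hG : MemLp (fun t => (p t, -(lam • r' t))) 2 (timeMeas T) :=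
    MemLp.of_fst_snd ⟨h.p_mem, ((rm.mono_exponent le_top).const_smul lam).neg⟩
  have hJi := integrable_energy (a := a) (ℓ := ℓ) (χ₂ := χ₂) (χ₃ := χ₃) (lam := lam)
    ((h.τ_mem.ae_eq t1.symm).mono_exponent le_top) ((h.δ_mem.ae_eq d1.symm).mono_exponent le_top)
    ((h.ϖ_mem.ae_eq w1.symm).mono_exponent le_top) (rm.mono_exponent le_top)
  have hconv : ∀ t ∈ Icc 0 T, ∀ s ∈ Icc 0 T, _ := fun t ht s hs =>
    le_stateEnergy_sub h.χ₂_nonneg h.χ₃_pos h.a_symm h.a_nonneg (hm t ht) (hc t ht) (hc s hs)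
  obtain ⟨B, hB⟩ : ∃ B : ((Q →L[ℝ] ℝ) × H) →L[ℝ] (Q × H) →L[ℝ] ℝ,
      ∀ x y, B x y = x.1 y.1 + inner ℝ x.2 y.2 :=
    ⟨(ContinuousLinearMap.id ℝ (Q →L[ℝ] ℝ)).bilinearComp (ContinuousLinearMap.fst ℝ _ _)
        (ContinuousLinearMap.fst ℝ _ _)
      + (innerSL ℝ).bilinearComp (ContinuousLinearMap.snd ℝ _ _) (ContinuousLinearMap.snd ℝ _ _),
      fun x y => rfl⟩
  have key := energy_identity B hT hF hG hJi (by
    filter_upwards [ae_mem_timeMeas T, h.p_eq, d1, w1, hrr] with t ht e1 e2 e3 e4 s hs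
    have ht' : t ∈ Icc 0 T := Ioo_subset_Icc_self ht
    refine le_of_eq_of_le ?_ (hconv t ht' s hs)
    have hint : ∫ σ in t..s, (ϖt σ, r' σ) = (∫ σ in t..s, ϖt σ, ∫ σ in t..s, r' σ) := by
      have hi : IntervalIntegrable (fun σ => (ϖt σ, r' σ)) volume t s :=
        intervalIntegrable_of_timeMeas (hF.integrable (by norm_num)) ht' hs
      exact Prod.ext
        ((ContinuousLinearMap.fst ℝ (Q →L[ℝ] ℝ) H).intervalIntegral_comp_comm hi).symm
        ((ContinuousLinearMap.snd ℝ (Q →L[ℝ] ℝ) H).intervalIntegral_comp_comm hi).symm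
    -- The linearisation point must be a time at which this combination is the image of `p t`; only
    -- then can the increment of `ϖ'` be paired with it as the integral of `ϖt`. Hence almost every
    -- `t`, but every `s`.
    have e5 : χ₁ • δ' t + χ₂ • ϖ' t + (lam * χ₁) • r' t = ι (p t) := by
      rw [e1, e2, e3, mul_comm, mul_smul, mul_smul, e4]
    rw [hint, hB, e5, w4 t ht' s hs, hd t ht' s hs, inner_neg_right, real_inner_smul_right,
      real_inner_smul_right, real_inner_comm]
    ring) (fun s hs ε hε => by
    -- Lower semicontinuity: linearised at the fixed time `s`, convexity bounds the energy at `t`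
    -- from below by an affine function of the weakly continuous `ϖ' t` and `dv (τ' t)`.
    have hg : ContinuousOn (fun t => inner ℝ (ϖ' t) (χ₁ • δ' s + χ₂ • ϖ' s + (lam * χ₁) • r' s)
        - lam * inner ℝ (dv (τ' t)) (r' s)) (Icc 0 T) :=
      (w2 _).sub (continuousOn_const.mul ((t2.comp_clm dv) _))
    filter_upwards [(hg s hs).eventually (lt_mem_nhds (sub_lt_self _ hε)), self_mem_nhdsWithin]
      with t h1 h2
    have h3 := hconv s hs t h2
    rw [inner_sub_left, real_inner_smul_right, inner_sub_right, real_inner_comm (dv (τ' t)),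
      real_inner_comm (dv (τ' s))] at h3
    linarith)
  intro s hs
  have h0 : (0 : ℝ) ∈ Icc 0 T := left_mem_Icc.2 hT.le
  have hn : Integrable (fun t => ‖r' t‖ ^ 2) (timeMeas T) := by
    simp only [← real_inner_self_eq_norm_sq]
    exact integrable_pairing (innerSL ℝ) (rm.mono_exponent le_top) (rm.mono_exponent le_top)
  have hp : Integrable (fun t => ϖt t (p t)) (timeMeas T) :=
    integrable_pairing (ContinuousLinearMap.id ℝ (Q →L[ℝ] ℝ)) h.ϖt_mem h.p_mem
  have e1 : ∫ t in (0 : ℝ)..s, B (ϖt t, r' t) (p t, -(lam • r' t))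
      = (∫ t in (0 : ℝ)..s, ϖt t (p t)) - lam * ∫ t in (0 : ℝ)..s, ‖r' t‖ ^ 2 := by
    rw [← intervalIntegral.integral_const_mul, ← intervalIntegral.integral_sub
      (intervalIntegrable_of_timeMeas hp h0 hs)
      ((intervalIntegrable_of_timeMeas hn h0 hs).const_mul lam)]
    refine intervalIntegral.integral_congr fun t _ => ?_
    simp only [hB, inner_neg_right, real_inner_smul_right, real_inner_self_eq_norm_sq]
    ring
  have e2 : lam * ∫ t in (0 : ℝ)..s, ‖r' t‖ ^ 2 = lam * ∫ t in (0 : ℝ)..s, ‖r t‖ ^ 2 := by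
    rcases h.lam_nonneg.eq_or_lt with hl | hl
    · rw [← hl, zero_mul, zero_mul]
    · rw [intervalIntegral_congr_timeMeas (f := fun t => ‖r' t‖ ^ 2) (g := fun t => ‖r t‖ ^ 2)
        ((r1 hl).mono fun t ht => congrArg (fun y : H => ‖y‖ ^ 2) ht) h0 hs]
  have h1 := key s hs
  rw [e1, e2] at h1
  linarith

end IsAbstractSolution

/-! ### The Biot problem as an instance of the abstract setting. -/

/-- The bilinear form `(ε(v), ε(w))`. -/
def strainForm {d : ℕ} (Ω : Set (E d)) : H1vec Ω →L[ℝ] H1vec Ω →L[ℝ] ℝ :=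
  ∑ i, ∑ j, (innerSL ℝ).bilinearComp (strainL Ω i j) (strainL Ω i j)

theorem strainForm_apply {d : ℕ} {Ω : Set (E d)} (v w : H1vec Ω) :
    strainForm Ω v w = strainInner v w := by
  simp only [strainForm, sum_apply, ContinuousLinearMap.bilinearComp_apply, strainL_apply,
    innerSL_apply_apply, strainInner]

theorem strainInner_comm {d : ℕ} {Ω : Set (E d)} (v w : H1vec Ω) :
    strainInner v w = strainInner w v := by
  simp only [strainInner, real_inner_comm]

theorem strainInner_self_nonneg {d : ℕ} {Ω : Set (E d)} (v : H1vec Ω) : 0 ≤ strainInner v v :=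
  Finset.sum_nonneg fun _ _ => Finset.sum_nonneg fun _ _ => real_inner_self_nonneg

theorem strain_eq_zero_of_strainInner {d : ℕ} {Ω : Set (E d)} {v : H1vec Ω}
    (h : strainInner v v = 0) (i j : Fin d) : strain v i j = 0 := by
  rw [strainInner, Finset.sum_eq_zero_iff_of_nonneg fun _ _ =>
    Finset.sum_nonneg fun _ _ => real_inner_self_nonneg] at h
  have h1 := h i (Finset.mem_univ i)
  rw [Finset.sum_eq_zero_iff_of_nonneg fun _ _ => real_inner_self_nonneg] at h1
  exact inner_self_eq_zero.1 (h1 j (Finset.mem_univ j))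

namespace Data

variable {d : ℕ} {Ω : Set (E d)} {D : Data Ω} {T : ℝ} {τ : ℝ → H1vec Ω} {δ ϖ : ℝ → L2 Ω}
  {p : ℝ → H1 Ω} {q : ℝ → L2 Ω} {ϖt : ℝ → H1dual Ω} {r : ℝ → L2 Ω}

/-- The load contains traces defined by choice; the momentum equation at one time exhibits it as a
bounded linear functional. -/
theorem IsWeakSolution.exists_load_eq (h : D.IsWeakSolution T τ δ ϖ p q ϖt r) (hT : 0 < T) :
    ∃ ℓ : H1vec Ω →L[ℝ] ℝ, ∀ v, D.load v = ℓ v := by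
  obtain ⟨t, -, ht⟩ := exists_of_ae_timeMeas hT h.momentum
  refine ⟨D.γ • strainForm Ω (τ t) - (innerSL ℝ (δ t)).comp (divL Ω), fun v => ?_⟩
  rw [sub_apply, smul_apply, strainForm_apply, ContinuousLinearMap.comp_apply, innerSL_apply_apply,
    divL_apply, ← ht v, smul_eq_mul]

-- The index set consists of the pairs `(a, A)` with `A` skew, so `τ_ker` is orthogonality to rigid
-- motions and `korn` is `eq_zero_of_strain_eq_zero`. The constraint, tested with all of `L²(Ω)`,
-- becomes an equation in `L²(Ω)`.
set_option synthInstance.maxHeartbeats 200000 in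
set_option maxHeartbeats 2000000 in
theorem IsWeakSolution.isAbstractSolution (h : D.IsWeakSolution T τ δ ϖ p q ϖt r) (hd : 0 < d)
    (hT : 0 < T) (hΩ : IsPolyhedralDomain Ω) {ℓ : H1vec Ω →L[ℝ] ℝ} (hℓ : ∀ v, D.load v = ℓ v) :
    IsAbstractSolution (V := H1vec Ω) (H := L2 Ω) (Q := H1 Ω)
      (I := {k : (Fin d → ℝ) × Matrix (Fin d) (Fin d) ℝ // k.2ᵀ = -k.2}) (D.γ • strainForm Ω)
      (divL Ω) (toL2L Ω) (fun k => rigidL hΩ.isBounded k.1.1 k.1.2) ℓ D.χ₁ D.χ₂ D.χ₃ D.lam T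
      D.ϖ₀ τ δ ϖ p ϖt r where
  T_pos := hT
  χ₂_nonneg := by
    have h1 := D.β_nonneg
    have h2 := D.b₀_pos
    have h3 := D.a₀_pos
    unfold χ₂
    positivity
  χ₃_pos := by
    have h1 := D.β_nonneg
    have h2 := D.b₀_pos
    have h3 := D.a₀_pos
    unfold χ₃
    positivity
  lam_nonneg := D.lam_nonneg
  a_symm u v := by
    rw [smul_apply, smul_apply, smul_apply, smul_apply, strainForm_apply, strainForm_apply,
      strainInner_comm]
  a_nonneg v := by
    rw [smul_apply, smul_apply, strainForm_apply]
    exact mul_nonneg D.γ_pos.le (strainInner_self_nonneg v)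
  korn v hv hk := by
    rw [smul_apply, smul_apply, strainForm_apply, smul_eq_mul] at hv
    refine eq_zero_of_strain_eq_zero hΩ.isOpen hΩ.isConnected hΩ.isBounded
      (strain_eq_zero_of_strainInner ((mul_eq_zero.1 hv).resolve_left D.γ_pos.ne'))
      fun a A hA => ?_
    rw [← rigidL_apply hΩ.isBounded]
    exact hk ⟨(a, A), hA⟩
  dense_ι f hf := L2_eq_zero_of_forall_H1 hΩ.isOpen hΩ.isBounded f hf
  dense_dv f hf := eq_zero_of_forall_inner_divg hd hΩ.isOpen hΩ.isConnected hΩ.isBounded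
    fun v => by rw [← divL_apply]; exact hf v
  τ_mem := h.τ_mem
  δ_mem := h.δ_mem
  ϖ_mem := h.ϖ_mem
  ϖt_mem := h.ϖt_mem
  p_mem := h.p_mem
  τ_ker := by
    filter_upwards [h.τ_orth] with t ht k
    rw [rigidL_apply hΩ.isBounded]
    exact ht _ _ k.2
  ϖ_deriv := h.ϖ_deriv
  r_deriv hl := by
    simp only [divL_apply]
    exact h.r_deriv hl
  momentum := by
    filter_upwards [h.momentum] with t ht v
    rw [smul_apply, smul_apply, strainForm_apply, divL_apply, ← hℓ]
    exact ht v
  constraint := by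
    filter_upwards [h.constraint] with t ht
    refine ext_inner_right ℝ fun η => ?_
    rw [inner_add_left, inner_add_left, real_inner_smul_left, real_inner_smul_left,
      real_inner_smul_left, divL_apply]
    exact ht η
  p_eq := h.p_eq
  initial := h.initial

end Data

namespace Data

variable {d : ℕ} {Ω : Set (E d)} {D : Data Ω} {T : ℝ} {τ : ℝ → H1vec Ω} {δ ϖ : ℝ → L2 Ω}
  {p : ℝ → H1 Ω} {q : ℝ → L2 Ω} {ϖt : ℝ → H1dual Ω} {r : ℝ → L2 Ω}

set_option synthInstance.maxHeartbeats 200000 in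
set_option maxHeartbeats 1000000 in
theorem J_eq_stateEnergy {ℓ : H1vec Ω →L[ℝ] ℝ} (hℓ : ∀ v, D.load v = ℓ v) (τ : H1vec Ω)
    (δ ϖ r : L2 Ω) :
    D.J τ δ ϖ r = stateEnergy (D.γ • strainForm Ω) ℓ D.χ₂ D.χ₃ D.lam τ δ ϖ r := by
  rw [J, stateEnergy, smul_apply, smul_apply, strainForm_apply, hℓ, smul_eq_mul]

theorem IsWeakSolution.integrable_darcy (h : D.IsWeakSolution T τ δ ϖ p q ϖt r)
    (hb : Bornology.IsBounded Ω) : Integrable (fun t => D.darcy (p t) (p t)) (timeMeas T) := by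
  simp only [D.darcy_eq_inner hb]
  have h1 : MemLp (fun t => D.fluxVec hb (p t)) 2 (timeMeas T) := memLp_fluxVec hb h.p_mem
  have h2 : MemLp (fun t => gradL Ω (p t)) 2 (timeMeas T) := (gradL Ω).comp_memLp' h.p_mem
  exact integrable_pairing (innerSL ℝ) h1 h2

theorem IsWeakSolution.integrable_inner_source (h : D.IsWeakSolution T τ δ ϖ p q ϖt r) :
    Integrable (fun t => inner ℝ D.φ (toL2 (p t))) (timeMeas T) :=
  ((innerSL ℝ D.φ).comp (toL2L Ω)).integrable_comp (h.p_mem.integrable (by norm_num))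

theorem IsWeakSolution.integrable_bdPair (h : D.IsWeakSolution T τ δ ϖ p q ϖt r) (hT : 0 < T)
    (hb : Bornology.IsBounded Ω) : Integrable (fun t => bdPair D.φ₁ (p t)) (timeMeas T) := by
  obtain ⟨L, hL⟩ := h.exists_bdPair_eq hT hb
  simp only [hL]
  exact L.integrable_comp (h.p_mem.integrable (by norm_num))

/-- The diffusion equation at time `t` tested with `ψ = p t`, which lies in `H¹(Ω)` for almost every
`t`. -/
theorem IsWeakSolution.integral_deriv_apply (h : D.IsWeakSolution T τ δ ϖ p q ϖt r) (hT : 0 < T)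
    (hb : Bornology.IsBounded Ω) {s : ℝ} (hs : s ∈ Icc 0 T) :
    ∫ t in (0 : ℝ)..s, ϖt t (p t) = (∫ t in (0 : ℝ)..s, inner ℝ D.φ (toL2 (p t)))
      + (∫ t in (0 : ℝ)..s, bdPair D.φ₁ (p t))
      - (1 / D.θf) * ∫ t in (0 : ℝ)..s, D.darcy (p t) (p t) := by
  have h0 : (0 : ℝ) ∈ Icc 0 T := left_mem_Icc.2 hT.le
  have i1 := intervalIntegrable_of_timeMeas h.integrable_inner_source h0 hs
  have i2 := intervalIntegrable_of_timeMeas (h.integrable_bdPair hT hb) h0 hs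
  have i3 := intervalIntegrable_of_timeMeas (h.integrable_darcy hb) h0 hs
  rw [← intervalIntegral.integral_const_mul, ← intervalIntegral.integral_add i1 i2,
    ← intervalIntegral.integral_sub (i1.add i2) (i3.const_mul _)]
  refine intervalIntegral_congr_timeMeas ?_ h0 hs
  filter_upwards [h.diffusion] with t ht
  have h1 := ht (p t)
  rw [source] at h1
  linarith

end Data

end Biot

end

/-! ### The energy law and the bound for weak solutions. -/

theorem mainTheorem4 {d : ℕ} (hd : d = 2 ∨ d = 3) (Ω : Set (E d)) (hΩ : IsPolyhedralDomain Ω) :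
    ∃ C : ℝ, 0 < C ∧
      ∀ (D : Data Ω) (T : ℝ), 0 < T →
      ∀ (τ : ℝ → H1vec Ω) (δ ϖ : ℝ → L2 Ω) (p : ℝ → H1 Ω) (q : ℝ → L2 Ω)
        (ϖt : ℝ → H1dual Ω) (r : ℝ → L2 Ω),
      D.IsWeakSolution T τ δ ϖ p q ϖt r →
      -- the time integrands of the energy law are integrable
      (0 < D.lam → MemLp r 2 (timeMeas T)) ∧
      Integrable (fun t => D.darcy (p t) (p t)) (timeMeas T) ∧
      Integrable (fun t => inner ℝ D.φ (toL2 (p t))) (timeMeas T) ∧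
      Integrable (fun t => bdPair D.φ₁ (p t)) (timeMeas T) ∧
      -- the energy law, at every time, for the weakly continuous representatives
      (∃ (τ' : ℝ → H1vec Ω) (δ' ϖ' r' : ℝ → L2 Ω),
        τ' =ᵐ[timeMeas T] τ ∧ δ' =ᵐ[timeMeas T] δ ∧ ϖ' =ᵐ[timeMeas T] ϖ ∧
        WeaklyContinuous T τ' ∧ WeaklyContinuous T δ' ∧ WeaklyContinuous T ϖ' ∧
        (0 < D.lam → r' =ᵐ[timeMeas T] r ∧ WeaklyContinuous T r') ∧
        ϖ' 0 = D.ϖ₀ ∧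
        ∀ s ∈ Icc 0 T,
          D.J (τ' s) (δ' s) (ϖ' s) (r' s)
            + D.lam * (∫ t in (0 : ℝ)..s, ‖r t‖ ^ 2)
            + (1 / D.θf) * (∫ t in (0 : ℝ)..s, D.darcy (p t) (p t))
            - (∫ t in (0 : ℝ)..s, inner ℝ D.φ (toL2 (p t)))
            - (∫ t in (0 : ℝ)..s, bdPair D.φ₁ (p t))
          = D.J (τ' 0) (δ' 0) (ϖ' 0) (r' 0)) ∧
      -- the bound for `ϖ_t` in `L²(0,T;H¹(Ω)')`
      D.fluxNorm T p < ⊤ ∧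
      eLpNorm ϖt 2 (timeMeas T)
        ≤ ENNReal.ofReal (1 / D.θf) * D.fluxNorm T p
          + ENNReal.ofReal (Real.sqrt T * (‖D.φ‖ + C * ‖D.φ₁‖)) := by
  -- `C` is the constant of the trace inequality, fixed before the data and `T`, hence dependent on
  -- `Ω` only.
  obtain ⟨C, hC0, hC⟩ := hΩ.exists_norm_trace_le
  refine ⟨C, hC0, fun D T hT τ δ ϖ p q ϖt r h => ?_⟩
  have hb := hΩ.isBounded
  obtain ⟨ℓ, hℓ⟩ := h.exists_load_eq hT
  have habs := h.isAbstractSolution (by rcases hd with rfl | rfl <;> norm_num) hT hΩ hℓ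
  refine ⟨fun hl => (habs.memLp_r hl).mono_exponent le_top, h.integrable_darcy hb,
    h.integrable_inner_source, h.integrable_bdPair hT hb, ?_, h.eLpNorm_deriv_le hT hb hC0 hC⟩
  obtain ⟨τ', δ', ϖ', r', h1, h2, h3, h4, h5, h6, h7, h8, h9⟩ := habs.exists_energy_law
  refine ⟨τ', δ', ϖ', r', h1, h2, h3, h4, h5, h6, h7, h8, fun s hs => ?_⟩
  have e := h9 s hs
  rw [h.integral_deriv_apply hT hb hs] at e
  rw [Data.J_eq_stateEnergy hℓ, Data.J_eq_stateEnergy hℓ, ← e]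
  ring
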